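/- Let $0<\epsilon<1<M$, $T>0$, $\overline c>0$, $R>0$, put $\Omega_T=(\epsilon,M)\times(0,T)$, and let $[\cdot,\cdot]$, $[\cdot]$ be the scalar product and the norm of the real Sobolev space $H^5(\Omega_T)\subset C^3(\overline{\Omega_T})$; boundary values below are those of the $C^3(\overline{\Omega_T})$ representative. For real functions $g_0,g_1$ let $$H=\Big\{q\in H^5(\Omega_T): q(\epsilon,t)=g_0(t+\epsilon),\ q_x(\epsilon,t)=g_1(t+\epsilon)+g_0'(t+\epsilon),\ q_x(M,t)=0\ \ \forall t\in[0,T];\ \ q(x,0)\ge \tfrac1{2\overline c^{1/4}}\ \ \forall x\in[\epsilon,M]\Big\},$$ where $g_0'$ is the derivative on $[\epsilon,T+\epsilon]$ (one-sided at the end points), and let $$H_0=\{h\in H^5(\Omega_T): h(\epsilon,t)=h_x(\epsilon,t)=h_x(M,t)=0\ \ \forall t\in[0,T]\},\qquad \overline{B(R)}=\{q\in H^5(\Omega_T):[q]\le R\}.$$ For real $\lambda,\alpha,\beta$ put $$F(q)=q_{xx}-\frac{q_{xt}}{2q^2(x,0)}+\frac{q_t\,q_x(x,0)}{2q^3(x,0)},\qquad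 J_{\lambda,\alpha,\beta}(q)=\int_{\Omega_T}e^{-2\lambda(x+\alpha t)}|F(q)|^2\,dx\,dt+\beta[q]^2 .$$ 1. For all $g_0,g_1$, all real $\lambda,\alpha,\beta$ and every $q\in H$ the functional $J_{\lambda,\alpha,\beta}$ has a unique Fréchet derivative $J'_{\lambda,\alpha,\beta}(q)\in H_0$, that is, $J_{\lambda,\alpha,\beta}(q+h)-J_{\lambda,\alpha,\beta}(q)=[J'_{\lambda,\alpha,\beta}(q),h]+o([h])$ as $[h]\to0$, $h\in H_0$. It is Lipschitz continuous on $\overline{B(R)}\cap H$: there is a constant $D>0$ such that $[J'_{\lambda,\alpha,\beta}(q_2)-J'_{\lambda,\alpha,\beta}(q_1)]\le D[q_2-q_1]$ for all $q_1,q_2\in\overline{B(R)}\cap H$. 2. Let $\alpha\in\big(0,1/(2\sqrt{\overline c})\big)$. There are constants $C>0$ and $\lambda_1\ge1$, depending only on $R,T,\epsilon,\overline c,\alpha,M$ (and not on $g_0,g_1$), where $\lambda_1$ may be taken larger than any prescribed number $\lambda_0\ge 1$ without changing $C$, such that for all $\lambda\ge\lambda_1$ and all $\beta\in[2e^{-\lambda\alpha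 T},1)$ the functional $J_{\lambda,\alpha,\beta}$ is strictly convex on $\overline{B(R)}\cap H$ and, for all $q,q+h\in\overline{B(R)}\cap H$, $$J_{\lambda,\alpha,\beta}(q+h)-J_{\lambda,\alpha,\beta}(q)-[J'_{\lambda,\alpha,\beta}(q),h]\ge C\int_{\Omega_T}e^{-2\lambda(x+\alpha t)}\big(|h_x|^2+|h_t|^2+|h|^2\big)\,dx\,dt+C\int_\epsilon^Me^{-2\lambda x}\big(|h_x(x,0)|^2+|h(x,0)|^2\big)\,dx+\frac\beta2[h]^2 .$$ 3. For the same $\alpha,\lambda,\beta$, if $\overline{B(R)}\cap H\ne\varnothing$, then $J_{\lambda,\alpha,\beta}$ has a unique minimizer $q_{\min}$ on $\overline{B(R)}\cap H$, and a point $q_{\min}\in\overline{B(R)}\cap H$ is this minimizer if and only if $[J'_{\lambda,\alpha,\beta}(q_{\min}),q_{\min}-q]\le0$ for all $q\in\overline{B(R)}\cap H$. -/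

import Mathlib

open MeasureTheory Set Topology
open scoped ContDiff

noncomputable section

namespace Convexification

/-- The partial derivative in the first variable. -/
def dx (φ : ℝ × ℝ → ℝ) : ℝ × ℝ → ℝ := fun p => deriv (fun s => φ (s, p.2)) p.1

/-- The partial derivative in the second variable. -/
def dt (φ : ℝ × ℝ → ℝ) : ℝ × ℝ → ℝ := fun p => deriv (fun s => φ (p.1, s)) p.2

/-- The classical mixed derivative `∂ₓⁱ ∂ₜʲ φ`, used for test functions. -/
def mixedDeriv (i j : ℕ) (φ : ℝ × ℝ → ℝ) : ℝ × ℝ → ℝ := dx^[i] (dt^[j] φ)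

/-- Test functions on `Ω`: smooth functions with compact support contained in `Ω`. -/
def IsTest (Ω : Set (ℝ × ℝ)) (φ : ℝ × ℝ → ℝ) : Prop :=
  ContDiff ℝ ∞ φ ∧ HasCompactSupport φ ∧ tsupport φ ⊆ Ω

/-- Multi-indices `(i, j)` of order `i + j ≤ k`. -/
abbrev MIdx (k : ℕ) : Type := {a : Fin (k + 1) × Fin (k + 1) // a.1.val + a.2.val ≤ k}

/-- The multi-index `(0, 0)`. -/
def MIdx.zero (k : ℕ) : MIdx k := ⟨(0, 0), by simp⟩

/-- The real Hilbert space `L²(Ω)`. -/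
abbrev L2 (Ω : Set (ℝ × ℝ)) : Type := Lp ℝ 2 ((volume : Measure (ℝ × ℝ)).restrict Ω)

/-- `w` is the weak derivative `∂ₓⁱ ∂ₜʲ u` on `Ω`. -/
def IsWeakDeriv (Ω : Set (ℝ × ℝ)) (i j : ℕ) (u w : L2 Ω) : Prop :=
  ∀ φ : ℝ × ℝ → ℝ, IsTest Ω φ →
    ∫ p in Ω, u p * mixedDeriv i j φ p = (-1) ^ (i + j) * ∫ p in Ω, w p * φ p

lemma IsTest.dx {Ω : Set (ℝ × ℝ)} {φ : ℝ × ℝ → ℝ} (h : IsTest Ω φ) : IsTest Ω (dx φ) := by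
  obtain ⟨h1, h2, h3⟩ := h
  have hd : Convexification.dx φ = fun p => fderiv ℝ φ p (1, 0) := by
    funext p
    have hc : HasDerivAt (fun s : ℝ => (s, p.2)) ((1 : ℝ), (0 : ℝ)) p.1 :=
      (hasDerivAt_id p.1).prodMk (hasDerivAt_const p.1 p.2)
    exact (((h1.differentiable (by simp)) p).hasFDerivAt.comp_hasDerivAt p.1 hc).deriv
  have hs : tsupport (Convexification.dx φ) ⊆ tsupport φ := by
    rw [hd]; exact tsupport_fderiv_apply_subset ℝ _
  refine ⟨?_, ?_, hs.trans h3⟩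
  · rw [hd]; exact (h1.fderiv_right (m := ∞) (by simp)).clm_apply contDiff_const
  · exact h2.of_isClosed_subset (isClosed_tsupport _) hs

lemma IsTest.dt {Ω : Set (ℝ × ℝ)} {φ : ℝ × ℝ → ℝ} (h : IsTest Ω φ) : IsTest Ω (dt φ) := by
  obtain ⟨h1, h2, h3⟩ := h
  have hd : Convexification.dt φ = fun p => fderiv ℝ φ p (0, 1) := by
    funext p
    have hc : HasDerivAt (fun s : ℝ => (p.1, s)) ((0 : ℝ), (1 : ℝ)) p.2 :=
      (hasDerivAt_const p.2 p.1).prodMk (hasDerivAt_id p.2)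
    exact (((h1.differentiable (by simp)) p).hasFDerivAt.comp_hasDerivAt p.2 hc).deriv
  have hs : tsupport (Convexification.dt φ) ⊆ tsupport φ := by
    rw [hd]; exact tsupport_fderiv_apply_subset ℝ _
  refine ⟨?_, ?_, hs.trans h3⟩
  · rw [hd]; exact (h1.fderiv_right (m := ∞) (by simp)).clm_apply contDiff_const
  · exact h2.of_isClosed_subset (isClosed_tsupport _) hs

lemma IsTest.mixedDeriv {Ω : Set (ℝ × ℝ)} {φ : ℝ × ℝ → ℝ} (h : IsTest Ω φ) (i j : ℕ) :
    IsTest Ω (mixedDeriv i j φ) := by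
  have hj : IsTest Ω (Convexification.dt^[j] φ) := by
    induction j with
    | zero => exact h
    | succ n ih => rw [Function.iterate_succ_apply']; exact ih.dt
  unfold Convexification.mixedDeriv
  induction i with
  | zero => exact hj
  | succ n ih => rw [Function.iterate_succ_apply']; exact ih.dx

lemma integrable_mul_test {Ω : Set (ℝ × ℝ)} {φ : ℝ × ℝ → ℝ} (u : L2 Ω) (h : IsTest Ω φ) :
    Integrable (fun p => u p * φ p) ((volume : Measure (ℝ × ℝ)).restrict Ω) :=
  (Lp.memLp u).integrable_mul
    ((h.1.continuous.memLp_of_hasCompactSupport (p := 2) h.2.1).restrict Ω)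

lemma IsWeakDeriv.zero {Ω : Set (ℝ × ℝ)} (i j : ℕ) : IsWeakDeriv Ω i j 0 0 := by
  intro φ _
  have h0 : ∀ ψ : ℝ × ℝ → ℝ, ∫ p in Ω, (0 : L2 Ω) p * ψ p = 0 := by
    intro ψ
    rw [integral_eq_zero_of_ae]
    filter_upwards [Lp.coeFn_zero ℝ 2 ((volume : Measure (ℝ × ℝ)).restrict Ω)] with p hp
    rw [hp]; simp
  rw [h0, h0, mul_zero]

lemma integral_add_mul_test {Ω : Set (ℝ × ℝ)} {φ : ℝ × ℝ → ℝ} (u v : L2 Ω) (h : IsTest Ω φ) :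
    ∫ p in Ω, (u + v) p * φ p = (∫ p in Ω, u p * φ p) + ∫ p in Ω, v p * φ p := by
  rw [← integral_add (integrable_mul_test u h) (integrable_mul_test v h)]
  refine integral_congr_ae ?_
  filter_upwards [Lp.coeFn_add u v] with p hp
  rw [hp, Pi.add_apply, add_mul]

lemma integral_smul_mul_test {Ω : Set (ℝ × ℝ)} (φ : ℝ × ℝ → ℝ) (c : ℝ) (u : L2 Ω) :
    ∫ p in Ω, (c • u) p * φ p = c * ∫ p in Ω, u p * φ p := by
  rw [← integral_const_mul]
  refine integral_congr_ae ?_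
  filter_upwards [Lp.coeFn_smul c u] with p hp
  rw [hp, Pi.smul_apply, smul_eq_mul, mul_assoc]

/-- The Sobolev space `Hᵏ(Ω) = Wᵏ˒²(Ω)`: an element is the tuple of all weak derivatives of order at
most `k` of an `L²` function. As a subspace of a finite Hilbert sum of copies of `L²(Ω)` it carries
the standard scalar product `[u, v] = ∑_{|a| ≤ k} ∫_Ω Dᵃu Dᵃv`. -/
def sobolev (k : ℕ) (Ω : Set (ℝ × ℝ)) : Submodule ℝ (PiLp 2 (fun _ : MIdx k => L2 Ω)) where
  carrier := {u | ∀ a : MIdx k, IsWeakDeriv Ω a.1.1 a.1.2 (u (MIdx.zero k)) (u a)}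
  zero_mem' := fun a => IsWeakDeriv.zero _ _
  add_mem' := by
    intro u v hu hv a φ hφ
    simp only [PiLp.add_apply]
    rw [integral_add_mul_test _ _ (hφ.mixedDeriv _ _), integral_add_mul_test _ _ hφ,
      hu a φ hφ, hv a φ hφ, mul_add]
  smul_mem' := by
    intro c u hu a φ hφ
    simp only [PiLp.smul_apply]
    rw [integral_smul_mul_test, integral_smul_mul_test, hu a φ hφ]
    ring

/-- The rectangle `Ω_T = (ε, M) × (0, T)`. -/
def rect (ε M T : ℝ) : Set (ℝ × ℝ) := Ioo ε M ×ˢ Ioo 0 T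

/-- The Hilbert space `H⁵(Ω_T)`; `‖·‖` and `inner ℝ` are its norm and scalar product. -/
abbrev H5 (ε M T : ℝ) : Type := ↥(sobolev 5 (rect ε M T))

variable {ε M T : ℝ}

open Classical in
/-- A function on `[ε, M] × [0, T]` that is continuous there and agrees almost everywhere in `Ω_T`
with the given `L²` function (unique on the closed rectangle when it exists). -/
def contRep (w : L2 (rect ε M T)) : ℝ × ℝ → ℝ :=
  if h : ∃ f : ℝ × ℝ → ℝ, ContinuousOn f (Icc ε M ×ˢ Icc 0 T) ∧
      f =ᵐ[(volume : Measure (ℝ × ℝ)).restrict (rect ε M T)] w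
  then h.choose else 0

/-- The value at `(x, t) ∈ [ε, M] × [0, T]` of the derivative `∂ₓⁱ ∂ₜʲ q`, `i + j ≤ 5`. It is used for
`i + j ≤ 2` only, where the continuous representative exists because `H⁵(Ω_T) ⊂ C³` of the closed
rectangle. -/
def D (q : H5 ε M T) (i j : ℕ) (x t : ℝ) (hij : i + j ≤ 5 := by norm_num) : ℝ :=
  contRep (q.1 ⟨(⟨i, by omega⟩, ⟨j, by omega⟩), hij⟩) (x, t)

/-- `F(q) = q_xx - q_xt / (2 q²(x,0)) + q_t q_x(x,0) / (2 q³(x,0))`. -/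
def F (q : H5 ε M T) (x t : ℝ) : ℝ :=
  D q 2 0 x t - D q 1 1 x t / (2 * D q 0 0 x 0 ^ 2)
    + D q 0 1 x t * D q 1 0 x 0 / (2 * D q 0 0 x 0 ^ 3)

/-- The weighted Tikhonov-like functional `J_{λ,α,β}`. -/
def J (lam α β : ℝ) (q : H5 ε M T) : ℝ :=
  (∫ p in rect ε M T, Real.exp (-2 * lam * (p.1 + α * p.2)) * |F q p.1 p.2| ^ 2) + β * ‖q‖ ^ 2

/-- The set `H` of admissible functions for the data `g₀, g₁`. The data enter only through their
values on `[ε, T + ε]`; `g₀'` is the derivative on that interval (one-sided at its end points). -/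
def admissible (ε M T cbar : ℝ) (g₀ g₁ : ℝ → ℝ) : Set (H5 ε M T) :=
  {q | (∀ t ∈ Icc 0 T,
          D q 0 0 ε t = g₀ (t + ε) ∧
          D q 1 0 ε t = g₁ (t + ε) + derivWithin g₀ (Icc ε (T + ε)) (t + ε) ∧
          D q 1 0 M t = 0) ∧
        ∀ x ∈ Icc ε M, 1 / (2 * cbar ^ (1 / 4 : ℝ)) ≤ D q 0 0 x 0}

/-- The subspace `H₀` of `H⁵(Ω_T)`. -/
def H0 (ε M T : ℝ) : Set (H5 ε M T) :=
  {h | ∀ t ∈ Icc 0 T,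
    D h 0 0 ε t = 0 ∧ D h 1 0 ε t = 0 ∧ D h 1 0 M t = 0}

/-- `G ∈ H₀` is the Fréchet derivative of `I` at `q`:
`I (q + h) - I q = [G, h] + o([h])` as `[h] → 0`, `h ∈ H₀`. -/
def IsFrechetDeriv (I : H5 ε M T → ℝ) (q G : H5 ε M T) : Prop :=
  G ∈ H0 ε M T ∧ HasFDerivWithinAt (fun h => I (q + h)) (innerSL ℝ G) (H0 ε M T) 0

/-- The set `closure B(R) ∩ H`. -/
def feasible (ε M T cbar R : ℝ) (g₀ g₁ : ℝ → ℝ) : Set (H5 ε M T) :=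
  Metric.closedBall 0 R ∩ admissible ε M T cbar g₀ g₁

end Convexification

end

noncomputable section

namespace Convexification

/-! ### Test functions on a box and their primitives -/

section TestFunctions

variable {a b c d : ℝ} {φ χ : ℝ × ℝ → ℝ}

/-! The heart of the matter is the strong convexity inequality `exists_convexity_inequality`. Write
`δF = F(q+h) - F(q)`, let `L` be the linearization of `F` at `q` applied to `h`, and let `w` be the
weight. Expanding the square, `J(q+h) - J(q) - J'(q)h` is `∫ w (δF² + 2 F(q) (δF - L)) + β‖h‖²`
(`J_sub_eq`). The principal part of `δF` is `h_xx - a(x) h_xt` with `a = 1/(2 (q+h)²(x,0))`; the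
rest is bounded by `|h(x,0)|`, `|h_t|`, `|h_x(x,0)|`.

Applied to `p = h_x`, the principal part is the transport operator `p_x - a p_t`. The weight makes
it coercive as soon as `αa` stays below `1` (`transport_estimate`). The trace constraint gives `a ≤
2√c̄`, which is exactly where `α < 1/(2√c̄)` is needed. Hardy's inequality in `x` recovers `h` from
`h_x`. It also controls `h_x - a h_t`, whose `x`-derivative is the operator up to `a' h_t`, and so
recovers `h_t`. The resulting `carleman_estimate` controls `λ²` times the interior integrals and `λ`
times the traces at `t = 0`, with an error at `t = T` of size `λ e^{-2λαT}`.

The remainder `δF - L` is quadratic in `h`. All its terms but one involve only quantities that the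
Carleman estimate controls. The exception is a multiple of `h_xt h(x,0)`; it is integrated by parts
in `t` (`mixed_term_ge`), which uses that `h(x,0)` does not depend on `t` and that `F(q)` has a
bounded `t`-derivative, hence third derivatives of `q`. The factor `λ` so produced is paid for by
the Carleman estimate and by the gain `1/λ` for functions independent of `t`
(`setIntegral_weight_trace_le`). For large `λ` everything is absorbed with constant `1`, and the
errors at `t = T` are covered by half of `β‖h‖²` because `β ≥ 2e^{-λαT}` (`key_combine`).

Differentiability and the Lipschitz bound need only a uniform second order Taylor estimate
(`exists_taylor_le`) and the Riesz theorem on the closed subspace `H₀`. Existence, uniqueness and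
the variational inequality for the minimizer follow from strong convexity on a closed convex set.

All this rests on continuous representatives of the derivatives of order at most `3` (`rep`). They
come from an explicit integral representation of a function by its means and its derivatives
(`HasWeakDx.ae_eq_rep`, `ae_eq_boxRep`), which also gives the sup bound by the `H⁵` norm. -/

lemma exists_Icc_of_isCompact_subset_Ioo {K : Set ℝ} (hK : IsCompact K) (h : K ⊆ Ioo a b) :
    ∃ a' b', a < a' ∧ b' < b ∧ K ⊆ Icc a' b' := by
  rcases K.eq_empty_or_nonempty with rfl | hne
  · exact ⟨a + 1, b - 1, by linarith, by linarith, by simp⟩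
  · obtain ⟨x, hx⟩ := hK.exists_isLeast hne
    obtain ⟨y, hy⟩ := hK.exists_isGreatest hne
    exact ⟨x, y, (h hx.1).1, (h hy.1).2, fun z hz => ⟨hx.2 hz, hy.2 hz⟩⟩

lemma IsTest.exists_box (h : IsTest (Ioo a b ×ˢ Ioo c d) φ) :
    ∃ a' b' c' d', a < a' ∧ b' < b ∧ c < c' ∧ d' < d ∧
      ∀ x t, φ (x, t) ≠ 0 → x ∈ Icc a' b' ∧ t ∈ Icc c' d' := by
  obtain ⟨-, h2, h3⟩ := h
  have hK : IsCompact (tsupport φ) := h2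
  obtain ⟨a', b', ha, hb, h1⟩ := exists_Icc_of_isCompact_subset_Ioo (a := a) (b := b)
    (hK.image continuous_fst) (by rintro _ ⟨p, hp, rfl⟩; exact (h3 hp).1)
  obtain ⟨c', d', hc, hd, h2⟩ := exists_Icc_of_isCompact_subset_Ioo (a := c) (b := d)
    (hK.image continuous_snd) (by rintro _ ⟨p, hp, rfl⟩; exact (h3 hp).2)
  refine ⟨a', b', c', d', ha, hb, hc, hd, fun x t hxt => ?_⟩
  have hm : (x, t) ∈ tsupport φ := subset_tsupport _ hxt
  exact ⟨h1 ⟨_, hm, rfl⟩, h2 ⟨_, hm, rfl⟩⟩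

lemma isTest_of_box {a' b' c' d' : ℝ} (hφ : ContDiff ℝ ∞ φ) (ha : a < a') (hb : b' < b)
    (hc : c < c') (hd : d' < d)
    (h : ∀ x t, φ (x, t) ≠ 0 → x ∈ Icc a' b' ∧ t ∈ Icc c' d') :
    IsTest (Ioo a b ×ˢ Ioo c d) φ := by
  have hs : tsupport φ ⊆ Icc a' b' ×ˢ Icc c' d' :=
    closure_minimal (fun p hp => h p.1 p.2 hp) (isClosed_Icc.prod isClosed_Icc)
  refine ⟨hφ, (isCompact_Icc.prod isCompact_Icc).of_isClosed_subset (isClosed_tsupport _) hs,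
    hs.trans ?_⟩
  rintro ⟨x, t⟩ ⟨hx, ht⟩
  exact ⟨⟨ha.trans_le hx.1, hx.2.trans_lt hb⟩, ⟨hc.trans_le ht.1, ht.2.trans_lt hd⟩⟩

/-- The primitive in the first variable, from `-∞`. -/
def xprim (χ : ℝ × ℝ → ℝ) : ℝ × ℝ → ℝ := fun p => ∫ x in Iic p.1, χ (x, p.2)

/-- On each line the primitive is the convolution of `χ` with the Heaviside function. The other
variable is a parameter, so joint smoothness comes from smoothness of convolutions depending on a
parameter. -/
lemma contDiff_xprim (h1 : ContDiff ℝ ∞ χ) (h2 : HasCompactSupport χ) :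
    ContDiff ℝ ∞ (xprim χ) := by
  have hK : IsCompact (Prod.fst '' tsupport χ) := IsCompact.image h2 continuous_fst
  have key := contDiffOn_convolution_right_with_param (n := ⊤) (μ := (volume : Measure ℝ))
    (f := (Ici (0 : ℝ)).indicator fun _ => (1 : ℝ)) (ContinuousLinearMap.mul ℝ ℝ)
    (g := fun t x => χ (x, t)) (s := univ) isOpen_univ hK
    (fun p x _ hx => by
      by_contra hne
      exact hx ⟨(x, p), subset_tsupport _ hne, rfl⟩)
    ((locallyIntegrable_const (1 : ℝ)).indicator measurableSet_Ici)
    (by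
      have : ContDiff ℝ ∞ (fun p : ℝ × ℝ => χ (p.2, p.1)) :=
        h1.comp (contDiff_snd.prodMk contDiff_fst)
      exact this.contDiffOn)
  rw [univ_prod_univ, contDiffOn_univ] at key
  have key2 : ContDiff ℝ ∞ (fun p : ℝ × ℝ =>
      (convolution ((Ici (0 : ℝ)).indicator fun _ => (1 : ℝ)) (fun x => χ (x, p.2))
        (ContinuousLinearMap.mul ℝ ℝ) volume) p.1) :=
    key.comp (contDiff_snd.prodMk contDiff_fst)
  convert key2 using 1
  funext p
  rw [xprim, convolution, ← integral_indicator measurableSet_Iic,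
    ← integral_sub_left_eq_self _ volume p.1]
  congr 1
  funext y
  by_cases hy : 0 ≤ y
  · simp [indicator, hy]
  · simp [indicator, hy]

lemma hasDerivAt_integral_Iic {g : ℝ → ℝ} (hg : Continuous g) (hi : Integrable g) (s : ℝ) :
    HasDerivAt (fun s => ∫ x in Iic s, g x) (g s) s := by
  have h : (fun s => ∫ x in Iic s, g x) = fun s => (∫ x in Iic 0, g x) + ∫ x in (0:ℝ)..s, g x := by
    funext s
    rw [← intervalIntegral.integral_Iic_sub_Iic hi.integrableOn hi.integrableOn]
    ring
  rw [h]
  exact ((hg.integral_hasStrictDerivAt 0 s).hasDerivAt).const_add _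

lemma IsTest.continuous_slice (h : IsTest (Ioo a b ×ˢ Ioo c d) φ) (t : ℝ) :
    Continuous fun x => φ (x, t) := h.1.continuous.comp (by fun_prop)

lemma IsTest.integrable_slice (h : IsTest (Ioo a b ×ˢ Ioo c d) φ) (t : ℝ) :
    Integrable fun x => φ (x, t) := by
  obtain ⟨a', b', c', d', -, -, -, -, hs⟩ := h.exists_box
  refine (h.continuous_slice t).integrable_of_hasCompactSupport ?_
  exact HasCompactSupport.intro (isCompact_Icc (a := a') (b := b')) fun x hx => by
    by_contra hne
    exact hx (hs x t hne).1

lemma dx_xprim (h : IsTest (Ioo a b ×ˢ Ioo c d) φ) : dx (xprim φ) = φ := by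
  funext p
  exact (hasDerivAt_integral_Iic (h.continuous_slice p.2) (h.integrable_slice p.2) p.1).deriv

/-- The vanishing integral on every line is what makes the primitive vanish again to the right of
the support. -/
lemma IsTest.xprim (h : IsTest (Ioo a b ×ˢ Ioo c d) φ) (h0 : ∀ t, ∫ x, φ (x, t) = 0) :
    IsTest (Ioo a b ×ˢ Ioo c d) (xprim φ) := by
  obtain ⟨a', b', c', d', ha, hb, hc, hd, hs⟩ := h.exists_box
  refine isTest_of_box (contDiff_xprim h.1 h.2.1) ha hb hc hd fun s t hst => ?_
  by_contra hcon
  apply hst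
  rw [not_and_or] at hcon
  have hzero : ∀ x, x ∉ Icc a' b' → φ (x, t) = 0 := fun x hx => by
    by_contra hne; exact hx (hs x t hne).1
  by_cases ht : t ∈ Icc c' d'
  · have hsn : s ∉ Icc a' b' := by tauto
    rw [mem_Icc, not_and_or, not_le, not_le] at hsn
    rcases hsn with hsn | hsn
    · exact setIntegral_eq_zero_of_forall_eq_zero fun x hx =>
        hzero x fun hx' => absurd (hx'.1.trans hx) (not_le.2 hsn)
    · change ∫ x in Iic s, φ (x, t) = 0
      rw [setIntegral_eq_integral_of_forall_compl_eq_zero, h0 t]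
      intro x hx
      exact hzero x fun hx' => hx (hx'.2.trans hsn.le)
  · exact setIntegral_eq_zero_of_forall_eq_zero fun x _ => by
      by_contra hne; exact ht (hs x t hne).2

end TestFunctions

/-! ### The averaging bump and the representation kernel -/

section Cutoff

variable {a b : ℝ}

/-- A smooth bump of integral one supported in the middle half of `(a, b)`. -/
def cutoff (a b : ℝ) : ℝ → ℝ :=
  if h : a < b then
    (⟨(b - a) / 8, (b - a) / 4, by linarith, by linarith⟩ : ContDiffBump ((a + b) / 2)).normed volume
  else 0

lemma contDiff_cutoff : ContDiff ℝ ∞ (cutoff a b) := by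
  unfold cutoff
  split_ifs with h
  · exact ContDiffBump.contDiff_normed _
  · exact contDiff_const

lemma cutoff_nonneg (x : ℝ) : 0 ≤ cutoff a b x := by
  unfold cutoff
  split_ifs with h
  · exact ContDiffBump.nonneg_normed _ _
  · simp

lemma integral_cutoff (h : a < b) : ∫ x, cutoff a b x = 1 := by
  simp only [cutoff, h, dif_pos]
  exact ContDiffBump.integral_normed _

lemma cutoff_ne_zero (h : a < b) {x : ℝ} (hx : cutoff a b x ≠ 0) :
    x ∈ Icc (a + (b - a) / 4) (b - (b - a) / 4) := by
  simp only [cutoff, h, dif_pos] at hx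
  have := (ContDiffBump.support_normed_eq _ (μ := volume)).subset (Function.mem_support.2 hx)
  rw [Metric.mem_ball, Real.dist_eq, abs_lt] at this
  constructor <;> linarith [this.1, this.2]

lemma integrable_cutoff : Integrable (cutoff a b) := by
  by_cases h : a < b
  · exact contDiff_cutoff.continuous.integrable_of_hasCompactSupport
      (HasCompactSupport.intro isCompact_Icc fun x hx => by
        by_contra hne; exact hx (cutoff_ne_zero h hne))
  · simp [cutoff, h]

lemma exists_cutoff_le (a b : ℝ) : ∃ K, ∀ x, ‖cutoff a b x‖ ≤ K := by
  by_cases h : a < b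
  · exact contDiff_cutoff.continuous.bounded_above_of_compact_support
      (HasCompactSupport.intro isCompact_Icc fun x hx => by
        by_contra hne; exact hx (cutoff_ne_zero h hne))
  · exact ⟨0, by simp [cutoff, h]⟩

/-- The kernel of the representation of a function by its mean and its derivative. -/
def kernel (a b x s : ℝ) : ℝ := (∫ y in Iic s, cutoff a b y) - (Iic s).indicator 1 x

lemma abs_kernel_le (h : a < b) (x s : ℝ) : ‖kernel a b x s‖ ≤ 1 := by
  have h1 : 0 ≤ ∫ y in Iic s, cutoff a b y := integral_nonneg cutoff_nonneg
  have h2 : ∫ y in Iic s, cutoff a b y ≤ 1 := by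
    rw [← integral_cutoff h]
    exact setIntegral_le_integral integrable_cutoff (Filter.Eventually.of_forall cutoff_nonneg)
  rw [kernel, Real.norm_eq_abs, abs_le]
  by_cases hx : x ∈ Iic s
  · simp only [hx, indicator_of_mem, Pi.one_apply]; constructor <;> linarith
  · simp only [hx, not_false_eq_true, indicator_of_notMem]; constructor <;> linarith

lemma measurable_kernel : Measurable fun p : ℝ × ℝ => kernel a b p.1 p.2 := by
  have h1 : Continuous fun s => ∫ y in Iic s, cutoff a b y :=
    continuous_iff_continuousAt.2 fun s =>
      (hasDerivAt_integral_Iic contDiff_cutoff.continuous integrable_cutoff s).continuousAt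
  have h2 : (fun p : ℝ × ℝ => (Iic p.2).indicator (1 : ℝ → ℝ) p.1)
      = {p : ℝ × ℝ | p.1 ≤ p.2}.indicator 1 := by
    funext p; simp [indicator]
  unfold kernel
  refine (h1.measurable.comp measurable_snd).sub ?_
  rw [h2]
  exact measurable_one.indicator (measurableSet_le measurable_fst measurable_snd)

/-- The averaging part of the kernel does not depend on the evaluation point, so it cancels in
differences. This is how the representation formula becomes the fundamental theorem of calculus. -/
lemma kernel_sub_kernel {x₁ x₂ : ℝ} (h : x₁ ≤ x₂) (s : ℝ) :
    kernel a b x₂ s - kernel a b x₁ s = (Ico x₁ x₂).indicator 1 s := by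
  simp only [kernel, indicator, mem_Iic, mem_Ico]
  by_cases h1 : x₁ ≤ s
  · by_cases h2 : x₂ ≤ s
    · simp [h1, h2]
    · simp [h1, h2, not_le.1 h2]
  · have h2 : ¬ x₂ ≤ s := fun h2 => h1 (h.trans h2)
    simp [h1, h2]

/-- Averaging in the first variable against `cutoff`. -/
def xmean (a b : ℝ) (ψ : ℝ × ℝ → ℝ) : ℝ × ℝ → ℝ := fun p => cutoff a b p.1 * ∫ x, ψ (x, p.2)

variable {c d : ℝ} {ψ : ℝ × ℝ → ℝ}

lemma IsTest.xmean (hab : a < b) (h : IsTest (Ioo a b ×ˢ Ioo c d) ψ) :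
    IsTest (Ioo a b ×ˢ Ioo c d) (xmean a b ψ) := by
  obtain ⟨a', b', c', d', ha, hb, hc, hd, hs⟩ := h.exists_box
  -- The integral over a whole line is the primitive evaluated at `x = b`, to the right of the
  -- support, so its smoothness in `t` is that of the primitive.
  have hmean : ∀ t, ∫ x, ψ (x, t) = Convexification.xprim ψ (b, t) := fun t => by
    rw [Convexification.xprim, setIntegral_eq_integral_of_forall_compl_eq_zero]
    intro x hx
    by_contra hne
    exact hx ((hs x t hne).1.2.trans hb.le)
  refine isTest_of_box (a' := a + (b - a) / 4) (b' := b - (b - a) / 4) (c' := c') (d' := d')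
    ?_ (by linarith) (by linarith) hc hd ?_
  · unfold Convexification.xmean
    simp only [hmean]
    exact (contDiff_cutoff.comp contDiff_fst).mul
      ((contDiff_xprim h.1 h.2.1).comp (contDiff_const.prodMk contDiff_snd))
  · intro x t hxt
    have h1 := left_ne_zero_of_mul hxt
    have h2 := right_ne_zero_of_mul hxt
    refine ⟨cutoff_ne_zero hab h1, ?_⟩
    by_contra ht
    refine h2 (integral_eq_zero_of_ae (Filter.Eventually.of_forall fun x => ?_))
    by_contra hne
    exact ht (hs x t hne).2

lemma IsTest.sub {Ω : Set (ℝ × ℝ)} {φ : ℝ × ℝ → ℝ} (h : IsTest Ω φ) (h' : IsTest Ω ψ) :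
    IsTest Ω (fun p => φ p - ψ p) :=
  ⟨h.1.sub h'.1, h.2.1.sub h'.2.1,
    (tsupport_sub φ ψ).trans (union_subset h.2.2 h'.2.2)⟩

lemma integral_xmean_sub (hab : a < b) (h : IsTest (Ioo a b ×ˢ Ioo c d) ψ) (t : ℝ) :
    ∫ x, (xmean a b ψ (x, t) - ψ (x, t)) = 0 := by
  rw [integral_sub ((h.xmean hab).integrable_slice t) (h.integrable_slice t)]
  simp only [xmean]
  rw [integral_mul_const, integral_cutoff hab]
  ring

/-- This is where the kernel comes from: it represents the operation "subtract `ψ` from its mean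
profile and take the primitive", so it appears in the representation of a function by duality. -/
lemma xprim_xmean_sub (hab : a < b) (h : IsTest (Ioo a b ×ˢ Ioo c d) ψ) (s t : ℝ) :
    xprim (fun p => xmean a b ψ p - ψ p) (s, t) = ∫ x, kernel a b x s * ψ (x, t) := by
  simp only [xprim]
  rw [integral_sub ((h.xmean hab).integrable_slice t).integrableOn
    (h.integrable_slice t).integrableOn]
  simp only [xmean, kernel, sub_mul]
  rw [integral_mul_const, integral_sub ((h.integrable_slice t).const_mul _), integral_const_mul]
  · congr 1
    rw [← integral_indicator measurableSet_Iic]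
    congr 1; funext x
    simp [indicator]
  · have := (h.integrable_slice t).indicator (measurableSet_Iic (a := s))
    refine this.congr (Filter.Eventually.of_forall fun x => ?_)
    simp [indicator]

end Cutoff

/-! ### Representation of a function by its mean and its weak derivative -/

section Representation

variable {a b c d : ℝ} {u v : ℝ × ℝ → ℝ}

/-- `v` is the weak derivative of `u` on `Ω` in the first variable. -/
def HasWeakDx (Ω : Set (ℝ × ℝ)) (u v : ℝ × ℝ → ℝ) : Prop :=
  ∀ φ : ℝ × ℝ → ℝ, IsTest Ω φ → ∫ p in Ω, u p * dx φ p = -∫ p in Ω, v p * φ p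

/-- `v` is the weak derivative of `u` on `Ω` in the second variable. -/
def HasWeakDt (Ω : Set (ℝ × ℝ)) (u v : ℝ × ℝ → ℝ) : Prop :=
  ∀ φ : ℝ × ℝ → ℝ, IsTest Ω φ → ∫ p in Ω, u p * dt φ p = -∫ p in Ω, v p * φ p

/-- The exchange of the evaluation point and the integration variable on a line, with `t` fixed: the
form of Fubini needed to move the kernel from the function onto the test function. -/
lemma measurePreserving_exchange (μ ν : Measure ℝ) [SFinite μ] [SFinite ν] :
    MeasurePreserving (fun z : (ℝ × ℝ) × ℝ => ((z.2, z.1.2), z.1.1))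
      ((μ.prod ν).prod μ) ((μ.prod ν).prod μ) := by
  have h1 : MeasurePreserving (fun z : (ℝ × ℝ) × ℝ => (z.1.1, (z.1.2, z.2)))
      ((μ.prod ν).prod μ) (μ.prod (ν.prod μ)) := measurePreserving_prodAssoc μ ν μ
  have h2 : MeasurePreserving (fun z : ℝ × (ℝ × ℝ) => (z.1, z.2.swap))
      (μ.prod (ν.prod μ)) (μ.prod (μ.prod ν)) :=
    (MeasurePreserving.id μ).prod Measure.measurePreserving_swap
  have h3 : MeasurePreserving (Prod.swap : ℝ × (ℝ × ℝ) → (ℝ × ℝ) × ℝ)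
      (μ.prod (μ.prod ν)) ((μ.prod ν).prod μ) := Measure.measurePreserving_swap
  exact h3.comp (h2.comp h1)

lemma integral_exchange {μ ν : Measure ℝ} [SFinite μ] [SFinite ν] {f : (ℝ × ℝ) × ℝ → ℝ}
    (hf : Integrable f ((μ.prod ν).prod μ)) :
    ∫ z, (f ∘ fun z : (ℝ × ℝ) × ℝ => ((z.2, z.1.2), z.1.1)) z ∂((μ.prod ν).prod μ)
      = ∫ z, f z ∂((μ.prod ν).prod μ) := by
  have hσ := measurePreserving_exchange μ ν
  have := integral_map (μ := (μ.prod ν).prod μ) hσ.measurable.aemeasurable (f := f)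
    (by rw [hσ.map_eq]; exact hf.aestronglyMeasurable)
  rw [hσ.map_eq] at this
  exact this.symm

lemma volume_restrict_box : (volume : Measure (ℝ × ℝ)).restrict (Ioo a b ×ˢ Ioo c d)
    = (volume.restrict (Ioo a b)).prod (volume.restrict (Ioo c d)) := by
  rw [Measure.prod_restrict]; rfl

lemma integrable_rep (hab : a < b) (hu : IntegrableOn u (Ioo a b ×ˢ Ioo c d))
    (hv : IntegrableOn v (Ioo a b ×ˢ Ioo c d)) :
    Integrable (fun z : (ℝ × ℝ) × ℝ =>
      cutoff a b z.2 * u (z.2, z.1.2) + kernel a b z.1.1 z.2 * v (z.2, z.1.2))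
      (((volume.restrict (Ioo a b)).prod (volume.restrict (Ioo c d))).prod
        (volume.restrict (Ioo a b))) := by
  rw [IntegrableOn, volume_restrict_box] at hu hv
  obtain ⟨K, hK⟩ := exists_cutoff_le a b
  have hσ := measurePreserving_exchange (volume.restrict (Ioo a b)) (volume.restrict (Ioo c d))
  have hu' := hσ.integrable_comp_of_integrable (hu.comp_fst (volume.restrict (Ioo a b)))
  have hv' := hσ.integrable_comp_of_integrable (hv.comp_fst (volume.restrict (Ioo a b)))
  refine Integrable.add ?_ ?_
  · refine hu'.bdd_mul (c := K) ?_ (Filter.Eventually.of_forall fun z => hK _)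
    exact (contDiff_cutoff.continuous.measurable.comp measurable_snd).aestronglyMeasurable
  · refine hv'.bdd_mul (c := 1) ?_ (Filter.Eventually.of_forall fun z => abs_kernel_le hab _ _)
    exact (measurable_kernel.comp
      (measurable_fst.fst.prodMk measurable_snd)).aestronglyMeasurable

lemma setIntegral_slice {ψ : ℝ × ℝ → ℝ} (h : IsTest (Ioo a b ×ˢ Ioo c d) ψ) (g : ℝ → ℝ) (t : ℝ) :
    ∫ x, g x * ψ (x, t) = ∫ x in Ioo a b, g x * ψ (x, t) := by
  refine (setIntegral_eq_integral_of_forall_compl_eq_zero fun x hx => ?_).symm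
  have : ψ (x, t) = 0 := by
    by_contra hne
    exact hx (h.2.2 (subset_tsupport _ hne)).1
  rw [this, mul_zero]

/-- A function with a weak derivative in the first variable is, on almost every line, the sum of its
weighted mean and an integral of the derivative. -/
lemma HasWeakDx.ae_eq_rep (hab : a < b) (hu : IntegrableOn u (Ioo a b ×ˢ Ioo c d))
    (hv : IntegrableOn v (Ioo a b ×ˢ Ioo c d)) (h : HasWeakDx (Ioo a b ×ˢ Ioo c d) u v) :
    ∀ᵐ p ∂(volume.restrict (Ioo a b ×ˢ Ioo c d)),
      u p = ∫ s in Ioo a b, (cutoff a b s * u (s, p.2) + kernel a b p.1 s * v (s, p.2)) := by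
  have hrep := integrable_rep hab hu hv
  set w : ℝ × ℝ → ℝ := fun p =>
    ∫ s in Ioo a b, (cutoff a b s * u (s, p.2) + kernel a b p.1 s * v (s, p.2)) with hw
  have hwi : IntegrableOn w (Ioo a b ×ˢ Ioo c d) := by
    rw [IntegrableOn, volume_restrict_box]; exact hrep.integral_prod_left
  have hopen : IsOpen (Ioo a b ×ˢ Ioo c d) := isOpen_Ioo.prod isOpen_Ioo
  -- By the fundamental lemma of the calculus of variations it suffices to test `u - w` against
  -- every test function `ψ`.
  have key := hopen.ae_eq_zero_of_integral_contDiff_smul_eq_zero (μ := volume) (f := fun p => u p - w p)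
    (hu.sub hwi).locallyIntegrableOn (fun ψ h1 h2 h3 => ?_)
  · rw [ae_restrict_iff' hopen.measurableSet]
    filter_upwards [key] with p hp hm
    exact sub_eq_zero.1 (hp hm)
  · have hψ : IsTest (Ioo a b ×ˢ Ioo c d) ψ := ⟨h1, h2, h3⟩
    obtain ⟨K, hK⟩ := h1.continuous.bounded_above_of_compact_support h2
    have hbm : ∀ {f : ℝ × ℝ → ℝ}, IntegrableOn f (Ioo a b ×ˢ Ioo c d) →
        IntegrableOn (fun p => ψ p * f p) (Ioo a b ×ˢ Ioo c d) := fun hf =>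
      Integrable.bdd_mul hf h1.continuous.aestronglyMeasurable (Filter.Eventually.of_forall hK)
    have hset : ∫ p, ψ p • (u p - w p) = ∫ p in Ioo a b ×ˢ Ioo c d, (ψ p * u p - ψ p * w p) := by
      rw [setIntegral_eq_integral_of_forall_compl_eq_zero]
      · simp [mul_sub]
      · intro p hp
        have : ψ p = 0 := by
          by_contra hne; exact hp (h3 (subset_tsupport _ hne))
        simp [this]
    rw [hset, integral_sub (hbm hu) (hbm hwi), sub_eq_zero]
    -- The mean profile minus `ψ` has integral zero on every line, so its primitive `B` is a test
    -- function. The weak derivative tested on `B` gives `∫ uψ = ∫ u · mean + ∫ v B`, and the right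
    -- side is `∫ ψw` by Fubini.
    have hχ := (hψ.xmean hab).sub hψ
    have hχ0 : ∀ t, ∫ x, (xmean a b ψ (x, t) - ψ (x, t)) = 0 := integral_xmean_sub hab hψ
    have hB := hχ.xprim hχ0
    have hweak := h _ hB
    rw [dx_xprim hχ] at hweak
    -- the representation tested against `ψ`
    have hswap : ∫ p in Ioo a b ×ˢ Ioo c d, ψ p * w p =
        ∫ p in Ioo a b ×ˢ Ioo c d, (u p * xmean a b ψ p +
          v p * xprim (fun p => xmean a b ψ p - ψ p) p) := by
      rw [volume_restrict_box]
      have hσ := measurePreserving_exchange (volume.restrict (Ioo a b)) (volume.restrict (Ioo c d))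
      have hI : Integrable (fun z : (ℝ × ℝ) × ℝ => ψ z.1 * (cutoff a b z.2 * u (z.2, z.1.2) +
          kernel a b z.1.1 z.2 * v (z.2, z.1.2)))
          (((volume.restrict (Ioo a b)).prod (volume.restrict (Ioo c d))).prod
            (volume.restrict (Ioo a b))) :=
        hrep.bdd_mul (c := K) (h1.continuous.comp continuous_fst).aestronglyMeasurable
          (Filter.Eventually.of_forall fun z => hK _)
      have hI' := hσ.integrable_comp_of_integrable hI
      have e1 := integral_prod _ hI
      have e2 := integral_prod _ hI'
      have e3 := integral_exchange hI
      have e4 : ∀ p : ℝ × ℝ, ψ p * w p = ∫ s in Ioo a b, ψ p * (cutoff a b s * u (s, p.2) +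
          kernel a b p.1 s * v (s, p.2)) := fun p => by rw [integral_const_mul]
      simp only [e4]
      rw [← e1, ← e3, e2]
      congr 1
      funext ⟨s, t⟩
      rw [xprim_xmean_sub hab hψ, setIntegral_slice hψ, xmean]
      have e5 : ∫ x, ψ (x, t) = ∫ x in Ioo a b, ψ (x, t) := by
        simpa using setIntegral_slice hψ (fun _ => 1) t
      simp only [Function.comp]
      rw [e5, ← integral_const_mul, ← integral_const_mul, ← integral_const_mul, ← integral_add]
      · congr 1; funext x; ring
      · exact (((hψ.integrable_slice t).integrableOn).const_mul _).const_mul _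
      · refine ((((hψ.integrable_slice t).integrableOn).bdd_mul (c := 1) ?_
          (Filter.Eventually.of_forall fun x => abs_kernel_le hab x s))).const_mul _
        exact (measurable_kernel.comp (measurable_id.prodMk measurable_const)).aestronglyMeasurable
    have hbt : ∀ {f φ : ℝ × ℝ → ℝ}, IsTest (Ioo a b ×ˢ Ioo c d) φ →
        IntegrableOn f (Ioo a b ×ˢ Ioo c d) →
        IntegrableOn (fun p => f p * φ p) (Ioo a b ×ˢ Ioo c d) := fun {f φ} hφ hf => by
      obtain ⟨K', hK'⟩ := hφ.1.continuous.bounded_above_of_compact_support hφ.2.1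
      exact Integrable.mul_bdd hf hφ.1.continuous.aestronglyMeasurable
        (Filter.Eventually.of_forall hK')
    rw [hswap, integral_add (hbt (hψ.xmean hab) hu) (hbt hB hv)]
    have : ∫ p in Ioo a b ×ˢ Ioo c d, u p * (xmean a b ψ p - ψ p) =
        (∫ p in Ioo a b ×ˢ Ioo c d, u p * xmean a b ψ p) - ∫ p in Ioo a b ×ˢ Ioo c d, u p * ψ p := by
      rw [← integral_sub (hbt (hψ.xmean hab) hu) (hbt hψ hu)]
      simp only [mul_sub]
    rw [this] at hweak
    simp only [mul_comm (ψ _)]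
    linarith

lemma IsTest.swap {φ : ℝ × ℝ → ℝ} (h : IsTest (Ioo a b ×ˢ Ioo c d) φ) :
    IsTest (Ioo c d ×ˢ Ioo a b) (fun p => φ p.swap) := by
  obtain ⟨a', b', c', d', ha, hb, hc, hd, hs⟩ := h.exists_box
  exact isTest_of_box (h.1.comp (contDiff_snd.prodMk contDiff_fst)) hc hd ha hb
    fun x t hxt => (hs t x hxt).symm

/-- Reflection in the diagonal turns every statement on `t`-derivatives into one on `x`-derivatives.
-/
lemma HasWeakDt.swap (h : HasWeakDt (Ioo a b ×ˢ Ioo c d) u v) :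
    HasWeakDx (Ioo c d ×ˢ Ioo a b) (fun p => u p.swap) (fun p => v p.swap) := by
  intro φ hφ
  have := h _ hφ.swap
  have e1 := setIntegral_prod_swap (μ := volume) (ν := volume) (Ioo a b) (Ioo c d)
    (fun p : ℝ × ℝ => u p * dt (fun p => φ p.swap) p)
  have e2 := setIntegral_prod_swap (μ := volume) (ν := volume) (Ioo a b) (Ioo c d)
    (fun p : ℝ × ℝ => v p * φ p.swap)
  simp only [Prod.swap_swap] at e2
  rw [← Measure.volume_eq_prod] at e1 e2
  rw [← e1, ← e2] at this
  exact this

lemma integrableOn_swap (hu : IntegrableOn u (Ioo a b ×ˢ Ioo c d)) :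
    IntegrableOn (fun p => u p.swap) (Ioo c d ×ˢ Ioo a b) := by
  rw [IntegrableOn, volume_restrict_box] at *
  exact hu.swap

lemma HasWeakDt.ae_eq_rep (hcd : c < d) (hu : IntegrableOn u (Ioo a b ×ˢ Ioo c d))
    (hv : IntegrableOn v (Ioo a b ×ˢ Ioo c d)) (h : HasWeakDt (Ioo a b ×ˢ Ioo c d) u v) :
    ∀ᵐ p ∂(volume.restrict (Ioo a b ×ˢ Ioo c d)),
      u p = ∫ τ in Ioo c d, (cutoff c d τ * u (p.1, τ) + kernel c d p.2 τ * v (p.1, τ)) := by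
  have key := h.swap.ae_eq_rep hcd (integrableOn_swap hu) (integrableOn_swap hv)
  rw [volume_restrict_box] at key ⊢
  exact Measure.measurePreserving_swap.quasiMeasurePreserving.ae key

end Representation

/-! ### Continuous representatives on a box -/

section Embedding

variable {a b c d : ℝ} {w wx wt wxt u v : ℝ × ℝ → ℝ}

/-- The continuous representative of a function `w` with weak derivatives `wx`, `wt` and `wxt` on the
box `(a, b) × (c, d)`. -/
def boxRep (a b c d : ℝ) (w wx wt wxt : ℝ × ℝ → ℝ) (p : ℝ × ℝ) : ℝ :=
  ∫ z in Ioo a b ×ˢ Ioo c d,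
    (cutoff a b z.1 * (cutoff c d z.2 * w z + kernel c d p.2 z.2 * wt z)
      + kernel a b p.1 z.1 * (cutoff c d z.2 * wx z + kernel c d p.2 z.2 * wxt z))

lemma aestronglyMeasurable_kernel_fst (x : ℝ) (μ : Measure (ℝ × ℝ)) :
    AEStronglyMeasurable (fun z : ℝ × ℝ => kernel a b x z.1) μ :=
  (measurable_kernel.comp (measurable_const.prodMk measurable_fst)).aestronglyMeasurable

lemma aestronglyMeasurable_kernel_snd (x : ℝ) (μ : Measure (ℝ × ℝ)) :
    AEStronglyMeasurable (fun z : ℝ × ℝ => kernel a b x z.2) μ :=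
  (measurable_kernel.comp (measurable_const.prodMk measurable_snd)).aestronglyMeasurable

lemma integrableOn_cutoff_mul_fst (hw : IntegrableOn w (Ioo a b ×ˢ Ioo c d)) :
    IntegrableOn (fun z => cutoff a b z.1 * w z) (Ioo a b ×ˢ Ioo c d) := by
  obtain ⟨K, hK⟩ := exists_cutoff_le a b
  exact Integrable.bdd_mul hw
    (contDiff_cutoff.continuous.comp continuous_fst).aestronglyMeasurable
    (Filter.Eventually.of_forall fun z => hK _)

lemma integrableOn_cutoff_mul_snd (hw : IntegrableOn w (Ioo a b ×ˢ Ioo c d)) :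
    IntegrableOn (fun z => cutoff c d z.2 * w z) (Ioo a b ×ˢ Ioo c d) := by
  obtain ⟨K, hK⟩ := exists_cutoff_le c d
  exact Integrable.bdd_mul hw
    (contDiff_cutoff.continuous.comp continuous_snd).aestronglyMeasurable
    (Filter.Eventually.of_forall fun z => hK _)

lemma integrableOn_kernel_mul_fst (hab : a < b) (x : ℝ)
    (hw : IntegrableOn w (Ioo a b ×ˢ Ioo c d)) :
    IntegrableOn (fun z => kernel a b x z.1 * w z) (Ioo a b ×ˢ Ioo c d) :=
  Integrable.bdd_mul hw (aestronglyMeasurable_kernel_fst x _)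
    (Filter.Eventually.of_forall fun _ => abs_kernel_le hab _ _)

lemma integrableOn_kernel_mul_snd (hcd : c < d) (x : ℝ)
    (hw : IntegrableOn w (Ioo a b ×ˢ Ioo c d)) :
    IntegrableOn (fun z => kernel c d x z.2 * w z) (Ioo a b ×ˢ Ioo c d) :=
  Integrable.bdd_mul hw (aestronglyMeasurable_kernel_snd x _)
    (Filter.Eventually.of_forall fun _ => abs_kernel_le hcd _ _)

lemma integrableOn_boxRep (hab : a < b) (hcd : c < d) (hw : IntegrableOn w (Ioo a b ×ˢ Ioo c d))
    (hwx : IntegrableOn wx (Ioo a b ×ˢ Ioo c d)) (hwt : IntegrableOn wt (Ioo a b ×ˢ Ioo c d))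
    (hwxt : IntegrableOn wxt (Ioo a b ×ˢ Ioo c d)) (p : ℝ × ℝ) :
    IntegrableOn (fun z => cutoff a b z.1 * (cutoff c d z.2 * w z + kernel c d p.2 z.2 * wt z)
      + kernel a b p.1 z.1 * (cutoff c d z.2 * wx z + kernel c d p.2 z.2 * wxt z))
      (Ioo a b ×ˢ Ioo c d) :=
  (integrableOn_cutoff_mul_fst
    ((integrableOn_cutoff_mul_snd hw).add (integrableOn_kernel_mul_snd hcd _ hwt))).add
    (integrableOn_kernel_mul_fst hab _
      ((integrableOn_cutoff_mul_snd hwx).add (integrableOn_kernel_mul_snd hcd _ hwxt)))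

lemma ae_ae_of_ae_box {P : ℝ × ℝ → Prop}
    (h : ∀ᵐ p ∂(volume.restrict (Ioo a b ×ˢ Ioo c d)), P p) :
    ∀ᵐ t ∂(volume.restrict (Ioo c d)), ∀ᵐ s ∂(volume.restrict (Ioo a b)), P (s, t) := by
  rw [volume_restrict_box] at h
  exact Measure.ae_ae_of_ae_prod (p := fun z => P z.swap)
    (Measure.measurePreserving_swap.quasiMeasurePreserving.ae h)

/-- The `x`-representation of `w` involves `w` and `wx` on almost every horizontal line, and both
are then replaced by their `t`-representations. Thus only the mixed second derivative is needed. The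
order of the a.e. quantifiers matters: for almost every `t` the second replacement holds for almost
every `s`. -/
lemma ae_eq_boxRep (hab : a < b) (hcd : c < d) (hw : IntegrableOn w (Ioo a b ×ˢ Ioo c d))
    (hwx : IntegrableOn wx (Ioo a b ×ˢ Ioo c d)) (hwt : IntegrableOn wt (Ioo a b ×ˢ Ioo c d))
    (hwxt : IntegrableOn wxt (Ioo a b ×ˢ Ioo c d))
    (h1 : HasWeakDx (Ioo a b ×ˢ Ioo c d) w wx) (h2 : HasWeakDt (Ioo a b ×ˢ Ioo c d) w wt)
    (h3 : HasWeakDt (Ioo a b ×ˢ Ioo c d) wx wxt) :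
    w =ᵐ[volume.restrict (Ioo a b ×ˢ Ioo c d)] boxRep a b c d w wx wt wxt := by
  have e1 := h1.ae_eq_rep hab hw hwx
  have e2 := ae_ae_of_ae_box (h2.ae_eq_rep hcd hw hwt)
  have e3 := ae_ae_of_ae_box (h3.ae_eq_rep hcd hwx hwxt)
  have e4 : ∀ᵐ p ∂(volume.restrict (Ioo a b ×ˢ Ioo c d)),
      (∀ᵐ s ∂(volume.restrict (Ioo a b)), w (s, p.2) =
        ∫ τ in Ioo c d, (cutoff c d τ * w (s, τ) + kernel c d p.2 τ * wt (s, τ))) ∧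
      (∀ᵐ s ∂(volume.restrict (Ioo a b)), wx (s, p.2) =
        ∫ τ in Ioo c d, (cutoff c d τ * wx (s, τ) + kernel c d p.2 τ * wxt (s, τ))) := by
    rw [volume_restrict_box]
    exact Measure.quasiMeasurePreserving_snd.ae (e2.and e3)
  filter_upwards [e1, e4] with p hp1 hp2
  obtain ⟨hp2, hp3⟩ := hp2
  have hI := integrableOn_boxRep hab hcd hw hwx hwt hwxt p
  have i1 := ((integrableOn_cutoff_mul_snd hw).add (integrableOn_kernel_mul_snd hcd p.2 hwt))
  have i2 := ((integrableOn_cutoff_mul_snd hwx).add (integrableOn_kernel_mul_snd hcd p.2 hwxt))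
  rw [IntegrableOn, volume_restrict_box] at hI i1 i2
  rw [hp1, boxRep, volume_restrict_box, integral_prod _ hI]
  refine integral_congr_ae ?_
  filter_upwards [hp2, hp3, i1.prod_right_ae, i2.prod_right_ae] with s hs2 hs3 j1 j2
  have j1' : Integrable (fun τ => cutoff c d τ * w (s, τ) + kernel c d p.2 τ * wt (s, τ))
    (volume.restrict (Ioo c d)) := j1
  have j2' : Integrable (fun τ => cutoff c d τ * wx (s, τ) + kernel c d p.2 τ * wxt (s, τ))
    (volume.restrict (Ioo c d)) := j2
  rw [hs2, hs3, ← integral_const_mul, ← integral_const_mul,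
    ← integral_add (j1'.const_mul _) (j2'.const_mul _)]

lemma continuousAt_kernel {x s : ℝ} (h : s ≠ x) : ContinuousAt (fun x => kernel a b x s) x := by
  unfold kernel
  refine continuousAt_const.sub ?_
  rcases lt_or_gt_of_ne h with h | h
  · have : (fun x => (Iic s).indicator (1 : ℝ → ℝ) x) =ᶠ[𝓝 x] fun _ => 0 := by
      filter_upwards [Ioi_mem_nhds h] with y hy
      simp [indicator, not_le.2 (mem_Ioi.1 hy)]
    exact continuousAt_const.congr this.symm
  · have : (fun x => (Iic s).indicator (1 : ℝ → ℝ) x) =ᶠ[𝓝 x] fun _ => 1 := by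
      filter_upwards [Iio_mem_nhds h] with y hy
      simp [indicator, (le_of_lt hy : y ≤ s)]
    exact continuousAt_const.congr this.symm

lemma exists_norm_boxRep_integrand_le (hab : a < b) (hcd : c < d) :
    ∃ K > 0, ∀ (w wx wt wxt : ℝ × ℝ → ℝ) (p z : ℝ × ℝ),
      ‖cutoff a b z.1 * (cutoff c d z.2 * w z + kernel c d p.2 z.2 * wt z)
        + kernel a b p.1 z.1 * (cutoff c d z.2 * wx z + kernel c d p.2 z.2 * wxt z)‖
        ≤ K * (‖w z‖ + ‖wx z‖ + ‖wt z‖ + ‖wxt z‖) := by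
  obtain ⟨K₁, hK₁⟩ := exists_cutoff_le a b
  obtain ⟨K₂, hK₂⟩ := exists_cutoff_le c d
  have n1 : 0 ≤ K₁ := (norm_nonneg _).trans (hK₁ 0)
  have n2 : 0 ≤ K₂ := (norm_nonneg _).trans (hK₂ 0)
  refine ⟨(K₁ + 1) * (K₂ + 1), by positivity, fun w wx wt wxt p z => ?_⟩
  have b1 := hK₁ z.1
  have b2 := hK₂ z.2
  have b3 := abs_kernel_le hab p.1 z.1
  have b4 := abs_kernel_le hcd p.2 z.2
  calc _ ≤ ‖cutoff a b z.1‖ * (‖cutoff c d z.2‖ * ‖w z‖ + ‖kernel c d p.2 z.2‖ * ‖wt z‖)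
        + ‖kernel a b p.1 z.1‖ * (‖cutoff c d z.2‖ * ‖wx z‖ + ‖kernel c d p.2 z.2‖ * ‖wxt z‖) := by
        refine (norm_add_le _ _).trans (add_le_add ?_ ?_)
        · rw [norm_mul]
          gcongr
          exact (norm_add_le _ _).trans (by rw [norm_mul, norm_mul])
        · rw [norm_mul]
          gcongr
          exact (norm_add_le _ _).trans (by rw [norm_mul, norm_mul])
    _ ≤ (K₁ + 1) * ((K₂ + 1) * ‖w z‖ + (K₂ + 1) * ‖wt z‖)
        + (K₁ + 1) * ((K₂ + 1) * ‖wx z‖ + (K₂ + 1) * ‖wxt z‖) := by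
        gcongr <;> linarith
    _ = _ := by ring

/-- Dominated convergence: the kernels jump only where `z.1 = p.1` or `z.2 = p.2`, which is a null
set of `z`. -/
lemma continuous_boxRep (hab : a < b) (hcd : c < d) (hw : IntegrableOn w (Ioo a b ×ˢ Ioo c d))
    (hwx : IntegrableOn wx (Ioo a b ×ˢ Ioo c d)) (hwt : IntegrableOn wt (Ioo a b ×ˢ Ioo c d))
    (hwxt : IntegrableOn wxt (Ioo a b ×ˢ Ioo c d)) :
    Continuous (boxRep a b c d w wx wt wxt) := by
  obtain ⟨K, -, hK⟩ := exists_norm_boxRep_integrand_le hab hcd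
  refine continuous_iff_continuousAt.2 fun p => ?_
  refine continuousAt_of_dominated
    (bound := fun z => K * (‖w z‖ + ‖wx z‖ + ‖wt z‖ + ‖wxt z‖))
    (Filter.Eventually.of_forall fun p =>
      (integrableOn_boxRep hab hcd hw hwx hwt hwxt p).aestronglyMeasurable)
    (Filter.Eventually.of_forall fun p => Filter.Eventually.of_forall fun z => hK _ _ _ _ _ _)
    ((((hw.norm.add hwx.norm).add hwt.norm).add hwxt.norm).const_mul K) ?_
  have e1 : ∀ᵐ z : ℝ × ℝ ∂(volume.restrict (Ioo a b ×ˢ Ioo c d)), z.1 ≠ p.1 := by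
    rw [volume_restrict_box]
    exact Measure.quasiMeasurePreserving_fst.ae (ae_restrict_of_ae (Measure.ae_ne volume p.1))
  have e2 : ∀ᵐ z : ℝ × ℝ ∂(volume.restrict (Ioo a b ×ˢ Ioo c d)), z.2 ≠ p.2 := by
    rw [volume_restrict_box]
    exact Measure.quasiMeasurePreserving_snd.ae (ae_restrict_of_ae (Measure.ae_ne volume p.2))
  filter_upwards [e1, e2] with z hz1 hz2
  have c1 : ContinuousAt (fun p : ℝ × ℝ => kernel a b p.1 z.1) p :=
    (continuousAt_kernel hz1).comp (f := Prod.fst) continuousAt_fst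
  have c2 : ContinuousAt (fun p : ℝ × ℝ => kernel c d p.2 z.2) p :=
    (continuousAt_kernel hz2).comp (f := Prod.snd) continuousAt_snd
  exact (continuousAt_const.mul (continuousAt_const.add (c2.mul continuousAt_const))).add
    (c1.mul (continuousAt_const.add (c2.mul continuousAt_const)))

/-- The constant depends on the box only, since the kernels and bumps are bounded. No relation
between the four functions is assumed. -/
lemma exists_abs_boxRep_le (hab : a < b) (hcd : c < d) :
    ∃ K > 0, ∀ (w wx wt wxt : ℝ × ℝ → ℝ), IntegrableOn w (Ioo a b ×ˢ Ioo c d) →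
      IntegrableOn wx (Ioo a b ×ˢ Ioo c d) → IntegrableOn wt (Ioo a b ×ˢ Ioo c d) →
      IntegrableOn wxt (Ioo a b ×ˢ Ioo c d) → ∀ p,
      |boxRep a b c d w wx wt wxt p| ≤ K * ((∫ z in Ioo a b ×ˢ Ioo c d, ‖w z‖)
        + (∫ z in Ioo a b ×ˢ Ioo c d, ‖wx z‖) + (∫ z in Ioo a b ×ˢ Ioo c d, ‖wt z‖)
        + ∫ z in Ioo a b ×ˢ Ioo c d, ‖wxt z‖) := by
  obtain ⟨K, hK0, hK⟩ := exists_norm_boxRep_integrand_le hab hcd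
  refine ⟨K, hK0, fun w wx wt wxt hw hwx hwt hwxt p => ?_⟩
  have i1 : IntegrableOn (fun z => ‖w z‖ + ‖wx z‖) (Ioo a b ×ˢ Ioo c d) := hw.norm.add hwx.norm
  have i2 : IntegrableOn (fun z => ‖w z‖ + ‖wx z‖ + ‖wt z‖) (Ioo a b ×ˢ Ioo c d) := i1.add hwt.norm
  have i3 : IntegrableOn (fun z => ‖w z‖ + ‖wx z‖ + ‖wt z‖ + ‖wxt z‖) (Ioo a b ×ˢ Ioo c d) :=
    i2.add hwxt.norm
  rw [← integral_add hw.norm hwx.norm, ← integral_add i1 hwt.norm, ← integral_add i2 hwxt.norm,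
    ← integral_const_mul]
  exact norm_integral_le_of_norm_le (i3.const_mul K)
    (Filter.Eventually.of_forall fun z => hK _ _ _ _ _ _)

lemma eqOn_closedBox (hab : a < b) (hcd : c < d) (hu : ContinuousOn u (Icc a b ×ˢ Icc c d))
    (hv : ContinuousOn v (Icc a b ×ˢ Icc c d))
    (h : u =ᵐ[volume.restrict (Ioo a b ×ˢ Ioo c d)] v) : EqOn u v (Icc a b ×ˢ Icc c d) := by
  have hsub : Ioo a b ×ˢ Ioo c d ⊆ Icc a b ×ˢ Icc c d :=
    prod_mono Ioo_subset_Icc_self Ioo_subset_Icc_self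
  refine (Measure.eqOn_open_of_ae_eq h (isOpen_Ioo.prod isOpen_Ioo) (hu.mono hsub)
    (hv.mono hsub)).of_subset_closure hu hv hsub ?_
  rw [closure_prod_eq, closure_Ioo hab.ne, closure_Ioo hcd.ne]

lemma continuous_integral_Ioo (hab : a ≤ b) {f : ℝ × ℝ → ℝ} (hf : Continuous f) :
    Continuous fun t => ∫ s in Ioo a b, f (s, t) := by
  have h : (fun t => ∫ s in Ioo a b, f (s, t)) = fun t => ∫ s in a..b, f (s, t) := by
    funext t
    rw [intervalIntegral.integral_of_le hab, integral_Ioc_eq_integral_Ioo]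
  rw [h]
  exact intervalIntegral.continuous_parametric_intervalIntegral_of_continuous'
    (f := fun t s => f (s, t)) (by fun_prop) a b

/-- A continuous weak derivative in the first variable is a classical derivative. -/
lemma HasWeakDx.exists_eq_add_integral (hab : a < b) (hcd : c < d) (hu : Continuous u)
    (hv : Continuous v) (h : HasWeakDx (Ioo a b ×ˢ Ioo c d) u v) :
    ∃ C : ℝ → ℝ, ∀ x ∈ Icc a b, ∀ t ∈ Icc c d, u (x, t) = C t + ∫ s in a..x, v (s, t) := by
  have hcpt : ∀ {f : ℝ × ℝ → ℝ}, Continuous f → IntegrableOn f (Ioo a b ×ˢ Ioo c d) :=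
    fun {f} hf => (hf.continuousOn.integrableOn_compact
      (isCompact_Icc.prod isCompact_Icc)).mono_set
      (prod_mono Ioo_subset_Icc_self Ioo_subset_Icc_self)
  obtain ⟨H, hH, hHe⟩ : ∃ H : ℝ → ℝ, Continuous H ∧ ∀ s, H s = ∫ y in Iic s, cutoff a b y :=
    ⟨_, continuous_iff_continuousAt.2 fun s =>
      (hasDerivAt_integral_Iic contDiff_cutoff.continuous integrable_cutoff s).continuousAt,
      fun _ => rfl⟩
  have hη : Continuous (cutoff a b) := contDiff_cutoff.continuous
  -- The value of the representation at `x = a`, where the kernel equals `H s - 1` for all `s` in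
  -- the interval.
  set C : ℝ → ℝ := fun t => ∫ s in Ioo a b,
    (cutoff a b s * u (s, t) + (H s - 1) * v (s, t)) with hC
  have hCc : Continuous C := continuous_integral_Ioo hab.le
    (f := fun p => cutoff a b p.1 * u p + (H p.1 - 1) * v p) (by fun_prop)
  have hprim : Continuous fun p : ℝ × ℝ => ∫ s in a..p.1, v (s, p.2) :=
    intervalIntegral.continuous_parametric_intervalIntegral_of_continuous
      (f := fun (p : ℝ × ℝ) s => v (s, p.2)) (by fun_prop) continuous_fst
  refine ⟨C, fun x hx t ht => ?_⟩
  -- Both sides are continuous, so it is enough to have the identity almost everywhere in the open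
  -- box.
  refine eqOn_closedBox hab hcd hu.continuousOn
    (v := fun p => C p.2 + ∫ s in a..p.1, v (s, p.2)) (by fun_prop) ?_ (mk_mem_prod hx ht)
  filter_upwards [h.ae_eq_rep hab (hcpt hu) (hcpt hv),
    ae_restrict_mem (measurableSet_Ioo.prod measurableSet_Ioo)] with p hp hmem
  rw [hp]
  have hvs : IntegrableOn (fun s => v (s, p.2)) (Ioo a b) :=
    ((by fun_prop : Continuous fun s => v (s, p.2)).continuousOn.integrableOn_Icc).mono_set
      Ioo_subset_Icc_self
  have e : ∫ s in a..p.1, v (s, p.2) = ∫ s in Ioo a b, (Ico a p.1).indicator 1 s * v (s, p.2) := by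
    rw [intervalIntegral.integral_of_le hmem.1.1.le, integral_Ioc_eq_integral_Ioo]
    have : ∀ s, (Ico a p.1).indicator (1 : ℝ → ℝ) s * v (s, p.2)
        = (Ico a p.1).indicator (fun s => v (s, p.2)) s := fun s => by simp [indicator]
    simp only [this]
    rw [setIntegral_indicator measurableSet_Ico]
    congr 2
    ext s
    simp only [mem_Ioo, mem_inter_iff, mem_Ico]
    constructor
    · rintro ⟨h1, h2⟩; exact ⟨⟨h1, h2.trans hmem.1.2⟩, h1.le, h2⟩
    · rintro ⟨⟨h1, h2⟩, h3, h4⟩; exact ⟨h1, h4⟩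
  rw [e]
  rw [← integral_add]
  · refine setIntegral_congr_fun measurableSet_Ioo fun s hs => ?_
    have hk := kernel_sub_kernel (a := a) (b := b) hmem.1.1.le s
    have hka : kernel a b a s = H s - 1 := by
      simp [kernel, indicator, hs.1.le, hHe]
    rw [← hk, ← hka]; ring
  · refine ((Continuous.continuousOn ?_).integrableOn_Icc).mono_set Ioo_subset_Icc_self
    fun_prop
  · refine hvs.bdd_mul (c := 1) ?_ (Filter.Eventually.of_forall fun s => ?_)
    · exact (measurable_one.indicator measurableSet_Ico).aestronglyMeasurable
    · by_cases hs : s ∈ Ico a p.1 <;> simp [hs]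

lemma HasWeakDx.hasDerivAt (hab : a < b) (hcd : c < d) (hu : Continuous u)
    (hv : Continuous v) (h : HasWeakDx (Ioo a b ×ˢ Ioo c d) u v) {x t : ℝ} (hx : x ∈ Ioo a b)
    (ht : t ∈ Icc c d) : HasDerivAt (fun s => u (s, t)) (v (x, t)) x := by
  obtain ⟨C, hC⟩ := h.exists_eq_add_integral hab hcd hu hv
  have hv' : Continuous fun s => v (s, t) := by fun_prop
  refine ((hv'.integral_hasStrictDerivAt a x).hasDerivAt.const_add (C t)).congr_of_eventuallyEq ?_
  filter_upwards [Ioo_mem_nhds hx.1 hx.2] with s hs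
  exact hC s (Ioo_subset_Icc_self hs) t ht

lemma HasWeakDt.hasDerivAt (hab : a < b) (hcd : c < d) (hu : Continuous u)
    (hv : Continuous v) (h : HasWeakDt (Ioo a b ×ˢ Ioo c d) u v) {x t : ℝ} (hx : x ∈ Icc a b)
    (ht : t ∈ Ioo c d) : HasDerivAt (fun s => u (x, s)) (v (x, t)) t :=
  h.swap.hasDerivAt hcd hab (hu.comp continuous_swap) (hv.comp continuous_swap) ht hx

lemma HasWeakDx.congr {Ω : Set (ℝ × ℝ)} {u' v' : ℝ × ℝ → ℝ} (h : HasWeakDx Ω u v)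
    (hu : u =ᵐ[volume.restrict Ω] u') (hv : v =ᵐ[volume.restrict Ω] v') : HasWeakDx Ω u' v' := by
  intro φ hφ
  have e1 : ∫ p in Ω, u' p * dx φ p = ∫ p in Ω, u p * dx φ p :=
    integral_congr_ae (by filter_upwards [hu] with p hp; rw [hp])
  have e2 : ∫ p in Ω, v' p * φ p = ∫ p in Ω, v p * φ p :=
    integral_congr_ae (by filter_upwards [hv] with p hp; rw [hp])
  rw [e1, e2, h φ hφ]

lemma HasWeakDt.congr {Ω : Set (ℝ × ℝ)} {u' v' : ℝ × ℝ → ℝ} (h : HasWeakDt Ω u v)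
    (hu : u =ᵐ[volume.restrict Ω] u') (hv : v =ᵐ[volume.restrict Ω] v') : HasWeakDt Ω u' v' := by
  intro φ hφ
  have e1 : ∫ p in Ω, u' p * dt φ p = ∫ p in Ω, u p * dt φ p :=
    integral_congr_ae (by filter_upwards [hu] with p hp; rw [hp])
  have e2 : ∫ p in Ω, v' p * φ p = ∫ p in Ω, v p * φ p :=
    integral_congr_ae (by filter_upwards [hv] with p hp; rw [hp])
  rw [e1, e2, h φ hφ]

end Embedding

/-! ### Continuous representatives of derivatives of elements of `H⁵` -/

section Sobolev

lemma dx_eq_fderiv {φ : ℝ × ℝ → ℝ} (h : Differentiable ℝ φ) :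
    dx φ = fun p => fderiv ℝ φ p (1, 0) := by
  funext p
  have hc : HasDerivAt (fun s : ℝ => (s, p.2)) ((1 : ℝ), (0 : ℝ)) p.1 :=
    (hasDerivAt_id p.1).prodMk (hasDerivAt_const p.1 p.2)
  exact ((h p).hasFDerivAt.comp_hasDerivAt p.1 hc).deriv

lemma dt_eq_fderiv {φ : ℝ × ℝ → ℝ} (h : Differentiable ℝ φ) :
    dt φ = fun p => fderiv ℝ φ p (0, 1) := by
  funext p
  have hc : HasDerivAt (fun s : ℝ => (p.1, s)) ((0 : ℝ), (1 : ℝ)) p.2 :=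
    (hasDerivAt_const p.2 p.1).prodMk (hasDerivAt_id p.2)
  exact ((h p).hasFDerivAt.comp_hasDerivAt p.2 hc).deriv

lemma dt_dx_comm {φ : ℝ × ℝ → ℝ} (h : ContDiff ℝ ∞ φ) : dt (dx φ) = dx (dt φ) := by
  have hd : Differentiable ℝ φ := h.differentiable (by simp)
  have h' : ContDiff ℝ ∞ (fderiv ℝ φ) := h.fderiv_right (m := ∞) (by simp)
  have hd' : Differentiable ℝ (fderiv ℝ φ) := h'.differentiable (by simp)
  rw [dx_eq_fderiv hd, dt_eq_fderiv hd,
    dt_eq_fderiv (fun p => (hd' p).clm_apply (differentiableAt_const _)),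
    dx_eq_fderiv (fun p => (hd' p).clm_apply (differentiableAt_const _))]
  funext p
  have hsymm : IsSymmSndFDerivAt ℝ φ p :=
    h.contDiffAt.isSymmSndFDerivAt (by
      rw [minSmoothness_of_isRCLikeNormedField]; exact WithTop.coe_le_coe.2 le_top)
  rw [fderiv_clm_apply (hd' p) (differentiableAt_const _),
    fderiv_clm_apply (hd' p) (differentiableAt_const _)]
  simpa using hsymm (0, 1) (1, 0)

lemma IsTest.dt_iterate {Ω : Set (ℝ × ℝ)} {φ : ℝ × ℝ → ℝ} (h : IsTest Ω φ) (j : ℕ) :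
    IsTest Ω (Convexification.dt^[j] φ) := h.mixedDeriv 0 j

/-- `mixedDeriv` applies the `t`-derivatives first, so an extra `x`-derivative must be commuted past
them. -/
lemma mixedDeriv_dx {Ω : Set (ℝ × ℝ)} {φ : ℝ × ℝ → ℝ} (h : IsTest Ω φ) (i j : ℕ) :
    mixedDeriv i j (dx φ) = mixedDeriv (i + 1) j φ := by
  have hj : dt^[j] (dx φ) = dx (dt^[j] φ) := by
    induction j with
    | zero => rfl
    | succ n ih =>
      rw [Function.iterate_succ_apply', ih, Function.iterate_succ_apply',
        dt_dx_comm (h.dt_iterate n).1]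
  rw [mixedDeriv, hj, mixedDeriv, Function.iterate_succ_apply]

lemma mixedDeriv_dt (φ : ℝ × ℝ → ℝ) (i j : ℕ) :
    mixedDeriv i j (dt φ) = mixedDeriv i (j + 1) φ := by
  rw [mixedDeriv, mixedDeriv, Function.iterate_succ_apply]

variable {ε M T : ℝ}

/-- The component `∂ₓⁱ ∂ₜʲ q` of an element of `H⁵`, as a function. -/
def comp (q : H5 ε M T) (i j : ℕ) : ℝ × ℝ → ℝ :=
  if h : i + j ≤ 5 then q.1 ⟨(⟨i, by omega⟩, ⟨j, by omega⟩), h⟩ else 0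

lemma comp_of_le (q : H5 ε M T) {i j : ℕ} (h : i + j ≤ 5) :
    comp q i j = q.1 ⟨(⟨i, by omega⟩, ⟨j, by omega⟩), h⟩ := dif_pos h

lemma comp_isWeakDeriv (q : H5 ε M T) {i j : ℕ} (h : i + j ≤ 5) {φ : ℝ × ℝ → ℝ}
    (hφ : IsTest (rect ε M T) φ) :
    ∫ p in rect ε M T, comp q 0 0 p * mixedDeriv i j φ p =
      (-1) ^ (i + j) * ∫ p in rect ε M T, comp q i j p * φ p := by
  rw [comp_of_le q h, comp_of_le q (Nat.zero_le 5)]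
  exact q.2 ⟨(⟨i, by omega⟩, ⟨j, by omega⟩), h⟩ φ hφ

/-- The definition relates each component only to the function itself. Testing against derivatives
of test functions relates consecutive components. -/
lemma hasWeakDx_comp (q : H5 ε M T) {i j : ℕ} (h : i + j ≤ 4) :
    HasWeakDx (rect ε M T) (comp q i j) (comp q (i + 1) j) := by
  intro φ hφ
  have h1 := comp_isWeakDeriv q (i := i) (j := j) (by omega) hφ.dx
  have h2 := comp_isWeakDeriv q (i := i + 1) (j := j) (by omega) hφ
  rw [mixedDeriv_dx hφ, h2, show i + 1 + j = i + j + 1 by ring, pow_succ] at h1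
  have : ((-1 : ℝ) ^ (i + j)) ≠ 0 := by simp
  apply mul_left_cancel₀ this
  rw [← h1]; ring

lemma hasWeakDt_comp (q : H5 ε M T) {i j : ℕ} (h : i + j ≤ 4) :
    HasWeakDt (rect ε M T) (comp q i j) (comp q i (j + 1)) := by
  intro φ hφ
  have h1 := comp_isWeakDeriv q (i := i) (j := j) (by omega) hφ.dt
  have h2 := comp_isWeakDeriv q (i := i) (j := j + 1) (by omega) hφ
  rw [mixedDeriv_dt, h2, show i + (j + 1) = i + j + 1 by ring, pow_succ] at h1
  have : ((-1 : ℝ) ^ (i + j)) ≠ 0 := by simp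
  apply mul_left_cancel₀ this
  rw [← h1]; ring

instance : IsFiniteMeasure ((volume : Measure (ℝ × ℝ)).restrict (rect ε M T)) := by
  refine ⟨?_⟩
  rw [Measure.restrict_apply_univ]
  exact ((isCompact_Icc.prod isCompact_Icc).measure_lt_top (μ := volume)).trans_le'
    (measure_mono (prod_mono (Ioo_subset_Icc_self (a := ε) (b := M))
      (Ioo_subset_Icc_self (a := 0) (b := T))))

lemma integrableOn_comp (q : H5 ε M T) (i j : ℕ) : IntegrableOn (comp q i j) (rect ε M T) := by
  unfold comp
  split_ifs with h
  · exact (Lp.memLp (q.1 ⟨(⟨i, by omega⟩, ⟨j, by omega⟩), h⟩)).integrable (by norm_num)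
  · exact integrable_zero _ _ _

lemma exists_integral_norm_le (ε M T : ℝ) :
    ∃ K > 0, ∀ (q : H5 ε M T) (i j : ℕ), ∫ p in rect ε M T, ‖comp q i j p‖ ≤ K * ‖q‖ := by
  set μ := (volume : Measure (ℝ × ℝ)).restrict (rect ε M T) with hμ
  set c := μ univ ^ (1 / (1 : ENNReal).toReal - 1 / (2 : ENNReal).toReal) with hc
  have hcf : c ≠ ⊤ := ENNReal.rpow_ne_top_of_nonneg (by norm_num) (measure_ne_top _ _)
  refine ⟨c.toReal + 1, by positivity, fun q i j => ?_⟩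
  unfold comp
  split_ifs with h
  · set w := q.1 ⟨(⟨i, by omega⟩, ⟨j, by omega⟩), h⟩ with hw
    have h1 : eLpNorm w 1 μ ≤ eLpNorm w 2 μ * c :=
      eLpNorm_le_eLpNorm_mul_rpow_measure_univ (by norm_num) (Lp.memLp w).1
    have h2 : ∫ p, ‖w p‖ ∂μ = (eLpNorm w 1 μ).toReal := by
      rw [eLpNorm_one_eq_lintegral_enorm, integral_norm_eq_lintegral_enorm (Lp.memLp w).1]
    have h3 : ‖w‖ ≤ ‖q‖ := PiLp.norm_apply_le q.1 _
    rw [h2]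
    calc (eLpNorm w 1 μ).toReal ≤ (eLpNorm w 2 μ * c).toReal :=
          ENNReal.toReal_mono (ENNReal.mul_ne_top (Lp.memLp w).2.ne hcf) h1
      _ = ‖w‖ * c.toReal := by rw [ENNReal.toReal_mul, Lp.norm_def]
      _ ≤ ‖q‖ * c.toReal := by gcongr
      _ ≤ (c.toReal + 1) * ‖q‖ := by nlinarith [norm_nonneg q]
  · simp only [Pi.zero_apply, norm_zero, integral_zero]; positivity

/-- The continuous representative of `∂ₓⁱ ∂ₜʲ q`, `i + j ≤ 3`, extended continuously to the plane. -/
def rep (q : H5 ε M T) (i j : ℕ) (x t : ℝ) : ℝ :=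
  boxRep ε M 0 T (comp q i j) (comp q (i + 1) j) (comp q i (j + 1)) (comp q (i + 1) (j + 1)) (x, t)

variable (hε : ε < M) (hT : 0 < T)
include hε hT

lemma continuous_rep (q : H5 ε M T) (i j : ℕ) : Continuous fun p : ℝ × ℝ => rep q i j p.1 p.2 :=
  continuous_boxRep hε hT (integrableOn_comp q i j) (integrableOn_comp q (i + 1) j)
    (integrableOn_comp q i (j + 1)) (integrableOn_comp q (i + 1) (j + 1))

lemma comp_ae_eq_rep (q : H5 ε M T) {i j : ℕ} (h : i + j ≤ 3) :
    comp q i j =ᵐ[volume.restrict (rect ε M T)] fun p => rep q i j p.1 p.2 :=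
  ae_eq_boxRep hε hT (integrableOn_comp q i j) (integrableOn_comp q (i + 1) j)
    (integrableOn_comp q i (j + 1)) (integrableOn_comp q (i + 1) (j + 1))
    (hasWeakDx_comp q (by omega)) (hasWeakDt_comp q (by omega)) (hasWeakDt_comp q (by omega))

/-- `D` evaluates a representative picked by choice. Continuous functions on the closed rectangle
that agree a.e. inside are equal, so the choice is irrelevant and `D` may be replaced by the
explicit `rep`, which is additive, homogeneous and bounded. -/
lemma D_eq_rep (q : H5 ε M T) {i j : ℕ} (h : i + j ≤ 3) {x t : ℝ} (hx : x ∈ Icc ε M)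
    (ht : t ∈ Icc 0 T) (h5 : i + j ≤ 5) : D q i j x t h5 = rep q i j x t := by
  have hex : ∃ f : ℝ × ℝ → ℝ, ContinuousOn f (Icc ε M ×ˢ Icc 0 T) ∧
      f =ᵐ[(volume : Measure (ℝ × ℝ)).restrict (rect ε M T)]
        q.1 ⟨(⟨i, by omega⟩, ⟨j, by omega⟩), h5⟩ :=
    ⟨_, (continuous_rep hε hT q i j).continuousOn,
      by rw [← comp_of_le q h5]; exact (comp_ae_eq_rep hε hT q h).symm⟩
  have hspec := hex.choose_spec
  rw [D, contRep, dif_pos hex]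
  refine eqOn_closedBox hε hT hspec.1 (continuous_rep hε hT q i j).continuousOn ?_
    (mk_mem_prod hx ht)
  refine hspec.2.trans ?_
  rw [← comp_of_le q h5]
  exact comp_ae_eq_rep hε hT q h

lemma hasDerivAt_rep_x (q : H5 ε M T) {i j : ℕ} (h : i + j ≤ 2) {x t : ℝ} (hx : x ∈ Ioo ε M)
    (ht : t ∈ Icc 0 T) : HasDerivAt (fun s => rep q i j s t) (rep q (i + 1) j x t) x :=
  HasWeakDx.hasDerivAt hε hT (continuous_rep hε hT q i j) (continuous_rep hε hT q (i + 1) j)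
    ((hasWeakDx_comp q (i := i) (j := j) (by omega)).congr (comp_ae_eq_rep hε hT q (by omega))
      (comp_ae_eq_rep hε hT q (by omega))) hx ht

lemma hasDerivAt_rep_t (q : H5 ε M T) {i j : ℕ} (h : i + j ≤ 2) {x t : ℝ} (hx : x ∈ Icc ε M)
    (ht : t ∈ Ioo 0 T) : HasDerivAt (fun s => rep q i j x s) (rep q i (j + 1) x t) t :=
  HasWeakDt.hasDerivAt hε hT (continuous_rep hε hT q i j) (continuous_rep hε hT q i (j + 1))
    ((hasWeakDt_comp q (i := i) (j := j) (by omega)).congr (comp_ae_eq_rep hε hT q (by omega))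
      (comp_ae_eq_rep hε hT q (by omega))) hx ht

/-- A single constant serves all orders `i`, `j`: the bound by `L¹` norms uses no relation between
components, and components of order above `5` are zero by convention. -/
lemma exists_abs_rep_le :
    ∃ K > 0, ∀ (q : H5 ε M T) (i j : ℕ) (x t : ℝ), |rep q i j x t| ≤ K * ‖q‖ := by
  obtain ⟨K₁, h1, hK₁⟩ := exists_abs_boxRep_le hε hT
  obtain ⟨K₂, h2, hK₂⟩ := exists_integral_norm_le ε M T
  refine ⟨K₁ * (4 * K₂), by positivity, fun q i j x t => ?_⟩
  refine (hK₁ _ _ _ _ (integrableOn_comp q i j) (integrableOn_comp q (i + 1) j)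
    (integrableOn_comp q i (j + 1)) (integrableOn_comp q (i + 1) (j + 1)) (x, t)).trans ?_
  rw [mul_assoc]
  refine mul_le_mul_of_nonneg_left ?_ h1.le
  have e1 : ∫ z in Ioo ε M ×ˢ Ioo 0 T, ‖comp q i j z‖ ≤ _ := hK₂ q i j
  have e2 : ∫ z in Ioo ε M ×ˢ Ioo 0 T, ‖comp q (i + 1) j z‖ ≤ _ := hK₂ q (i + 1) j
  have e3 : ∫ z in Ioo ε M ×ˢ Ioo 0 T, ‖comp q i (j + 1) z‖ ≤ _ := hK₂ q i (j + 1)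
  have e4 : ∫ z in Ioo ε M ×ˢ Ioo 0 T, ‖comp q (i + 1) (j + 1) z‖ ≤ _ := hK₂ q (i + 1) (j + 1)
  linarith

omit hε hT in
lemma comp_add (q h : H5 ε M T) (i j : ℕ) :
    comp (q + h) i j =ᵐ[volume.restrict (rect ε M T)] comp q i j + comp h i j := by
  unfold comp
  split_ifs with hij
  · exact Lp.coeFn_add _ _
  · simp

omit hε hT in
lemma comp_smul (c : ℝ) (q : H5 ε M T) (i j : ℕ) :
    comp (c • q) i j =ᵐ[volume.restrict (rect ε M T)] c • comp q i j := by
  unfold comp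
  split_ifs with hij
  · exact Lp.coeFn_smul _ _
  · simp

lemma rep_add (q h : H5 ε M T) (i j : ℕ) (x t : ℝ) :
    rep (q + h) i j x t = rep q i j x t + rep h i j x t := by
  have i1 := integrableOn_boxRep hε hT (integrableOn_comp q i j) (integrableOn_comp q (i + 1) j)
    (integrableOn_comp q i (j + 1)) (integrableOn_comp q (i + 1) (j + 1)) (x, t)
  have i2 := integrableOn_boxRep hε hT (integrableOn_comp h i j) (integrableOn_comp h (i + 1) j)
    (integrableOn_comp h i (j + 1)) (integrableOn_comp h (i + 1) (j + 1)) (x, t)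
  rw [rep, rep, rep, boxRep, boxRep, boxRep, ← integral_add i1 i2]
  refine integral_congr_ae ?_
  filter_upwards [comp_add q h i j, comp_add q h (i + 1) j, comp_add q h i (j + 1),
    comp_add q h (i + 1) (j + 1)] with z h1 h2 h3 h4
  rw [h1, h2, h3, h4]
  simp only [Pi.add_apply]
  ring

omit hε hT in
lemma rep_smul (c : ℝ) (q : H5 ε M T) (i j : ℕ) (x t : ℝ) :
    rep (c • q) i j x t = c * rep q i j x t := by
  rw [rep, rep, boxRep, boxRep, ← integral_const_mul]
  refine integral_congr_ae ?_
  filter_upwards [comp_smul c q i j, comp_smul c q (i + 1) j, comp_smul c q i (j + 1),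
    comp_smul c q (i + 1) (j + 1)] with z h1 h2 h3 h4
  rw [h1, h2, h3, h4]
  simp only [Pi.smul_apply, smul_eq_mul]
  ring

lemma rep_sub (q h : H5 ε M T) (i j : ℕ) (x t : ℝ) :
    rep (q - h) i j x t = rep q i j x t - rep h i j x t := by
  rw [sub_eq_add_neg, ← neg_one_smul ℝ h, rep_add hε hT, rep_smul]
  ring

end Sobolev

/-! ### Fubini and the fundamental theorem of calculus on the rectangle -/

section RectIntegral

variable {ε M T : ℝ}

lemma _root_.Continuous.integrableOn_rect {f : ℝ × ℝ → ℝ} (hf : Continuous f) :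
    IntegrableOn f (rect ε M T) :=
  (hf.continuousOn.integrableOn_compact (isCompact_Icc.prod isCompact_Icc)).mono_set
    (prod_mono (Ioo_subset_Icc_self (a := ε) (b := M)) (Ioo_subset_Icc_self (a := 0) (b := T)))

lemma measurableSet_rect : MeasurableSet (rect ε M T) := measurableSet_Ioo.prod measurableSet_Ioo

lemma integral_Ioo_eq {a b : ℝ} (h : a ≤ b) (f : ℝ → ℝ) : ∫ x in Ioo a b, f x = ∫ x in a..b, f x := by
  rw [intervalIntegral.integral_of_le h, integral_Ioc_eq_integral_Ioo]

lemma setIntegral_rect (hε : ε < M) (hT : 0 < T) {f : ℝ × ℝ → ℝ} (hf : Continuous f) :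
    ∫ z in rect ε M T, f z = ∫ x in ε..M, ∫ t in (0 : ℝ)..T, f (x, t) := by
  have hi : IntegrableOn f (rect ε M T) := hf.integrableOn_rect
  rw [IntegrableOn, rect, volume_restrict_box] at hi
  rw [rect, volume_restrict_box, integral_prod _ hi]
  simp only [integral_Ioo_eq hε.le, integral_Ioo_eq hT.le]

lemma setIntegral_rect_symm (hε : ε < M) (hT : 0 < T) {f : ℝ × ℝ → ℝ} (hf : Continuous f) :
    ∫ z in rect ε M T, f z = ∫ t in (0 : ℝ)..T, ∫ x in ε..M, f (x, t) := by
  have hi : IntegrableOn f (rect ε M T) := hf.integrableOn_rect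
  rw [IntegrableOn, rect, volume_restrict_box] at hi
  rw [rect, volume_restrict_box, integral_prod_symm _ hi]
  simp only [integral_Ioo_eq hε.le, integral_Ioo_eq hT.le]

lemma setIntegral_rect_mono {f g : ℝ × ℝ → ℝ} (hf : Continuous f) (hg : Continuous g)
    (h : ∀ z ∈ rect ε M T, f z ≤ g z) : ∫ z in rect ε M T, f z ≤ ∫ z in rect ε M T, g z :=
  setIntegral_mono_on hf.integrableOn_rect hg.integrableOn_rect measurableSet_rect h

lemma setIntegral_rect_deriv_x (hε : ε < M) (hT : 0 < T) {G g : ℝ × ℝ → ℝ} (hG : Continuous G)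
    (hg : Continuous g)
    (h : ∀ x ∈ Ioo ε M, ∀ t ∈ Icc 0 T, HasDerivAt (fun s => G (s, t)) (g (x, t)) x) :
    ∫ z in rect ε M T, g z = ∫ t in (0 : ℝ)..T, (G (M, t) - G (ε, t)) := by
  rw [setIntegral_rect_symm hε hT hg]
  refine intervalIntegral.integral_congr fun t ht => ?_
  rw [uIcc_of_le hT.le] at ht
  exact intervalIntegral.integral_eq_sub_of_hasDerivAt_of_le hε.le
    (f := fun s => G (s, t)) (Continuous.continuousOn (by fun_prop)) (fun x hx => h x hx t ht)
    (Continuous.intervalIntegrable (by fun_prop) _ _)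

lemma setIntegral_rect_deriv_t (hε : ε < M) (hT : 0 < T) {G g : ℝ × ℝ → ℝ} (hG : Continuous G)
    (hg : Continuous g)
    (h : ∀ x ∈ Icc ε M, ∀ t ∈ Ioo 0 T, HasDerivAt (fun s => G (x, s)) (g (x, t)) t) :
    ∫ z in rect ε M T, g z = ∫ x in ε..M, (G (x, T) - G (x, 0)) := by
  rw [setIntegral_rect hε hT hg]
  refine intervalIntegral.integral_congr fun x hx => ?_
  rw [uIcc_of_le hε.le] at hx
  exact intervalIntegral.integral_eq_sub_of_hasDerivAt_of_le hT.le
    (f := fun s => G (x, s)) (Continuous.continuousOn (by fun_prop)) (fun t ht => h x hx t ht)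
    (Continuous.intervalIntegrable (by fun_prop) _ _)

end RectIntegral

/-! ### Weighted Hardy, transport and Carleman estimates -/

section Carleman

variable {ε M T lam α : ℝ}

/-- The Carleman weight. -/
def weight (lam α x t : ℝ) : ℝ := Real.exp (-2 * lam * (x + α * t))

lemma weight_pos (lam α x t : ℝ) : 0 < weight lam α x t := Real.exp_pos _

@[fun_prop]
lemma continuous_weight : Continuous fun z : ℝ × ℝ => weight lam α z.1 z.2 := by
  unfold weight; fun_prop

lemma weight_eq (x t : ℝ) :
    weight lam α x t = Real.exp (-2 * lam * x) * Real.exp (-2 * lam * α * t) := by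
  rw [weight, ← Real.exp_add]; congr 1; ring

lemma hasDerivAt_weight_x (x t : ℝ) :
    HasDerivAt (fun s => weight lam α s t) (-2 * lam * weight lam α x t) x := by
  have h : HasDerivAt (fun s => -2 * lam * (s + α * t)) (-2 * lam) x := by
    simpa using ((hasDerivAt_id x).add_const (α * t)).const_mul (-2 * lam)
  exact h.exp.congr_deriv (by unfold weight; ring)

lemma hasDerivAt_sq {f : ℝ → ℝ} {f' x : ℝ} (h : HasDerivAt f f' x) :
    HasDerivAt (fun x => f x ^ 2) (2 * f x * f') x := by
  simpa using h.fun_pow 2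

lemma hasDerivAt_weight_t (x t : ℝ) :
    HasDerivAt (fun s => weight lam α x s) (-2 * lam * α * weight lam α x t) t := by
  have h : HasDerivAt (fun s => -2 * lam * (x + α * s)) (-2 * lam * α) t := by
    have := (((hasDerivAt_id t).const_mul α).const_add x).const_mul (-2 * lam)
    simpa [mul_assoc] using this
  exact h.exp.congr_deriv (by unfold weight; ring)

/-- Weighted Hardy inequality on an interval. -/
lemma hardy_interval (hε : ε < M) (hlam : 0 ≤ lam) {f f' : ℝ → ℝ} (hf : Continuous f)
    (hf' : Continuous f') (hd : ∀ x ∈ Ioo ε M, HasDerivAt f (f' x) x) (h0 : f ε = 0) :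
    lam ^ 2 * ∫ x in ε..M, Real.exp (-2 * lam * x) * f x ^ 2
      ≤ ∫ x in ε..M, Real.exp (-2 * lam * x) * f' x ^ 2 := by
  have hi : ∀ {g : ℝ → ℝ}, Continuous g → IntervalIntegrable g volume ε M :=
    fun hg => hg.intervalIntegrable _ _
  have hftc : ∫ x in ε..M, (-2 * lam * Real.exp (-2 * lam * x) * f x ^ 2
      + Real.exp (-2 * lam * x) * (2 * f x * f' x)) = Real.exp (-2 * lam * M) * f M ^ 2 := by
    rw [intervalIntegral.integral_eq_sub_of_hasDerivAt_of_le hε.le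
      (f := fun x => Real.exp (-2 * lam * x) * f x ^ 2) (by fun_prop) ?_ (hi (by fun_prop)), h0]
    · simp
    · intro x hx
      have h1 : HasDerivAt (fun x => Real.exp (-2 * lam * x))
          (-2 * lam * Real.exp (-2 * lam * x)) x := by
        have h : HasDerivAt (fun x => -2 * lam * x) (-2 * lam) x := by
          simpa using (hasDerivAt_id x).const_mul (-2 * lam)
        exact h.exp.congr_deriv (by ring)
      exact h1.mul (hasDerivAt_sq (hd x hx))
  -- Pointwise this is `e^{-2λx} (f' - λf)² ≥ 0`, with the cross term written through the derivative
  -- of `e^{-2λx} f²`. The boundary term at `M` has a good sign, so only `f ε = 0` is needed.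
  have hmono : ∫ x in ε..M, (lam * (-2 * lam * Real.exp (-2 * lam * x) * f x ^ 2
      + Real.exp (-2 * lam * x) * (2 * f x * f' x))
      + lam ^ 2 * (Real.exp (-2 * lam * x) * f x ^ 2))
      ≤ ∫ x in ε..M, Real.exp (-2 * lam * x) * f' x ^ 2 := by
    refine intervalIntegral.integral_mono_on hε.le (hi (by fun_prop)) (hi (by fun_prop))
      fun x _ => ?_
    have := mul_nonneg (Real.exp_pos (-2 * lam * x)).le (sq_nonneg (f' x - lam * f x))
    nlinarith
  rw [intervalIntegral.integral_add (hi (by fun_prop)) (hi (by fun_prop)),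
    intervalIntegral.integral_const_mul, intervalIntegral.integral_const_mul, hftc] at hmono
  have : 0 ≤ lam * (Real.exp (-2 * lam * M) * f M ^ 2) := by positivity
  linarith

/-- Weighted Hardy inequality on the rectangle. -/
lemma hardy_rect (hε : ε < M) (hT : 0 < T) (hlam : 0 ≤ lam) {g gx : ℝ → ℝ → ℝ}
    (hg : Continuous fun z : ℝ × ℝ => g z.1 z.2) (hgx : Continuous fun z : ℝ × ℝ => gx z.1 z.2)
    (hd : ∀ x ∈ Ioo ε M, ∀ t ∈ Icc 0 T, HasDerivAt (fun s => g s t) (gx x t) x)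
    (h0 : ∀ t ∈ Icc 0 T, g ε t = 0) :
    lam ^ 2 * ∫ z in rect ε M T, weight lam α z.1 z.2 * g z.1 z.2 ^ 2
      ≤ ∫ z in rect ε M T, weight lam α z.1 z.2 * gx z.1 z.2 ^ 2 := by
  have slice : ∀ {k : ℝ → ℝ → ℝ}, Continuous (fun z : ℝ × ℝ => k z.1 z.2) → ∀ t,
      Continuous fun x => k x t := fun hk t => hk.comp (by fun_prop : Continuous fun x : ℝ => (x, t))
  rw [setIntegral_rect_symm hε hT (by fun_prop), setIntegral_rect_symm hε hT (by fun_prop),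
    ← intervalIntegral.integral_const_mul]
  have hc : ∀ {k : ℝ → ℝ → ℝ}, Continuous (fun z : ℝ × ℝ => k z.1 z.2) →
      Continuous fun t => ∫ x in ε..M, weight lam α x t * k x t ^ 2 := fun {k} hk => by
    refine intervalIntegral.continuous_parametric_intervalIntegral_of_continuous'
      (f := fun t x => weight lam α x t * k x t ^ 2) ?_ ε M
    exact (by fun_prop : Continuous fun z : ℝ × ℝ => weight lam α z.1 z.2 * k z.1 z.2 ^ 2).comp
      continuous_swap
  refine intervalIntegral.integral_mono_on hT.le
    (((hc hg).const_mul _).intervalIntegrable _ _) ((hc hgx).intervalIntegrable _ _) fun t ht => ?_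
  have key := hardy_interval hε hlam (slice hg t) (slice hgx t) (fun x hx => hd x hx t ht) (h0 t ht)
  have e : ∀ k : ℝ → ℝ → ℝ, ∫ x in ε..M, weight lam α x t * k x t ^ 2
      = Real.exp (-2 * lam * α * t) * ∫ x in ε..M, Real.exp (-2 * lam * x) * k x t ^ 2 := fun k => by
    rw [← intervalIntegral.integral_const_mul]
    congr 1; funext x; rw [weight_eq]; ring
  simp only
  rw [e, e]
  have := mul_le_mul_of_nonneg_left key (Real.exp_pos (-2 * lam * α * t)).le
  linarith

/-- Weighted estimate for the transport operator `∂ₓ - a(x) ∂ₜ`. -/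
lemma transport_estimate (hε : ε < M) (hT : 0 < T) (hlam : 0 ≤ lam) {γ a₀ a₁ : ℝ} (hγ : 0 ≤ γ)
    {a : ℝ → ℝ} (ha : Continuous a) (ha₀ : ∀ x ∈ Icc ε M, a₀ ≤ a x) (ha₁ : ∀ x ∈ Icc ε M, a x ≤ a₁)
    (hαa : ∀ x ∈ Icc ε M, γ ≤ 1 - α * a x) {p px pt : ℝ → ℝ → ℝ}
    (hp : Continuous fun z : ℝ × ℝ => p z.1 z.2) (hpx : Continuous fun z : ℝ × ℝ => px z.1 z.2)
    (hpt : Continuous fun z : ℝ × ℝ => pt z.1 z.2)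
    (hdx : ∀ x ∈ Ioo ε M, ∀ t ∈ Icc 0 T, HasDerivAt (fun s => p s t) (px x t) x)
    (hdt : ∀ x ∈ Icc ε M, ∀ t ∈ Ioo 0 T, HasDerivAt (fun s => p x s) (pt x t) t)
    (h0 : ∀ t ∈ Icc 0 T, p ε t = 0) :
    lam ^ 2 * γ ^ 2 * (∫ z in rect ε M T, weight lam α z.1 z.2 * p z.1 z.2 ^ 2)
      + lam * γ * a₀ * (∫ x in ε..M, Real.exp (-2 * lam * x) * p x 0 ^ 2)
      ≤ (∫ z in rect ε M T, weight lam α z.1 z.2 * (px z.1 z.2 - a z.1 * pt z.1 z.2) ^ 2)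
        + lam * γ * a₁ * Real.exp (-2 * lam * α * T)
          * ∫ x in ε..M, Real.exp (-2 * lam * x) * p x T ^ 2 := by
  have slice : ∀ t, Continuous fun x => p x t := fun t =>
    hp.comp (by fun_prop : Continuous fun x : ℝ => (x, t))
  have hX := setIntegral_rect_deriv_x hε hT (G := fun z => weight lam α z.1 z.2 * p z.1 z.2 ^ 2)
    (g := fun z => -2 * lam * weight lam α z.1 z.2 * p z.1 z.2 ^ 2
      + weight lam α z.1 z.2 * (2 * p z.1 z.2 * px z.1 z.2)) (by fun_prop) (by fun_prop)
    (fun x hx t ht => (hasDerivAt_weight_x x t).mul (hasDerivAt_sq (hdx x hx t ht)))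
  have hY := setIntegral_rect_deriv_t hε hT
    (G := fun z => a z.1 * (weight lam α z.1 z.2 * p z.1 z.2 ^ 2))
    (g := fun z => a z.1 * (-2 * lam * α * weight lam α z.1 z.2 * p z.1 z.2 ^ 2
      + weight lam α z.1 z.2 * (2 * p z.1 z.2 * pt z.1 z.2))) (by fun_prop) (by fun_prop)
    (fun x hx t ht =>
      ((hasDerivAt_weight_t x t).mul (hasDerivAt_sq (hdt x hx t ht))).const_mul (a x))
  have hX0 : 0 ≤ ∫ t in (0 : ℝ)..T, (weight lam α M t * p M t ^ 2 - weight lam α ε t * p ε t ^ 2) := by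
    refine intervalIntegral.integral_nonneg hT.le fun t ht => ?_
    rw [h0 t ht]
    have := weight_pos lam α M t
    simp only [ne_eq, OfNat.ofNat_ne_zero, not_false_eq_true, zero_pow, mul_zero, sub_zero]
    positivity
  have hY0 : ∫ x in ε..M, (a x * (weight lam α x T * p x T ^ 2) - a x * (weight lam α x 0 * p x 0 ^ 2))
      ≤ ∫ x in ε..M, (a₁ * Real.exp (-2 * lam * α * T) * (Real.exp (-2 * lam * x) * p x T ^ 2)
        - a₀ * (Real.exp (-2 * lam * x) * p x 0 ^ 2)) := by
    have s1 := slice T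
    have s2 := slice 0
    have w1 : ∀ t, Continuous fun x => weight lam α x t := fun t => by unfold weight; fun_prop
    have w2 := w1 T
    have w3 := w1 0
    refine intervalIntegral.integral_mono_on hε.le (Continuous.intervalIntegrable (by fun_prop) _ _)
      (Continuous.intervalIntegrable (by fun_prop) _ _) fun x hx => ?_
    have e0 : weight lam α x 0 = Real.exp (-2 * lam * x) := by rw [weight_eq]; simp
    rw [e0, weight_eq]
    have h1 : a x * (Real.exp (-2 * lam * x) * Real.exp (-2 * lam * α * T) * p x T ^ 2)
        ≤ a₁ * (Real.exp (-2 * lam * x) * Real.exp (-2 * lam * α * T) * p x T ^ 2) :=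
      mul_le_mul_of_nonneg_right (ha₁ x hx) (by positivity)
    have h2 : a₀ * (Real.exp (-2 * lam * x) * p x 0 ^ 2)
        ≤ a x * (Real.exp (-2 * lam * x) * p x 0 ^ 2) :=
      mul_le_mul_of_nonneg_right (ha₀ x hx) (by positivity)
    linarith
  have hsplit : ∫ x in ε..M, (a₁ * Real.exp (-2 * lam * α * T) * (Real.exp (-2 * lam * x) * p x T ^ 2)
        - a₀ * (Real.exp (-2 * lam * x) * p x 0 ^ 2))
      = a₁ * Real.exp (-2 * lam * α * T) * (∫ x in ε..M, Real.exp (-2 * lam * x) * p x T ^ 2)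
        - a₀ * ∫ x in ε..M, Real.exp (-2 * lam * x) * p x 0 ^ 2 := by
    have s1 := slice T
    have s2 := slice 0
    rw [intervalIntegral.integral_sub (Continuous.intervalIntegrable (by fun_prop) _ _)
      (Continuous.intervalIntegrable (by fun_prop) _ _),
      intervalIntegral.integral_const_mul, intervalIntegral.integral_const_mul]
  rw [hsplit] at hY0
  -- Pointwise this is `(p_x - a p_t - λγp)² ≥ 0` times the weight. Writing `2 p p_x` and `2 a p
  -- p_t` as exact derivatives leaves `2λ²γ(1 - αa) p² ≥ 2λ²γ² p²` from the derivatives of the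
  -- weight, of which `λ²γ² p²` survives the square of the last term.
  have hmono : ∫ z in rect ε M T, (lam * γ * (-2 * lam * weight lam α z.1 z.2 * p z.1 z.2 ^ 2
      + weight lam α z.1 z.2 * (2 * p z.1 z.2 * px z.1 z.2))
      - lam * γ * (a z.1 * (-2 * lam * α * weight lam α z.1 z.2 * p z.1 z.2 ^ 2
      + weight lam α z.1 z.2 * (2 * p z.1 z.2 * pt z.1 z.2)))
      + lam ^ 2 * γ ^ 2 * (weight lam α z.1 z.2 * p z.1 z.2 ^ 2))
      ≤ ∫ z in rect ε M T, weight lam α z.1 z.2 * (px z.1 z.2 - a z.1 * pt z.1 z.2) ^ 2 := by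
    refine setIntegral_rect_mono (by fun_prop) (by fun_prop) fun z hz => ?_
    have hw := (weight_pos lam α z.1 z.2).le
    have h1 := mul_nonneg hw (sq_nonneg (px z.1 z.2 - a z.1 * pt z.1 z.2 - lam * γ * p z.1 z.2))
    have h2 : 0 ≤ 2 * lam ^ 2 * γ * (weight lam α z.1 z.2 * p z.1 z.2 ^ 2)
        * (1 - α * a z.1 - γ) := by
      have := hαa z.1 (Ioo_subset_Icc_self hz.1)
      have : 0 ≤ 1 - α * a z.1 - γ := by linarith
      positivity
    linarith
  rw [integral_add (Continuous.integrableOn_rect (by fun_prop))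
      (Continuous.integrableOn_rect (by fun_prop)),
    integral_sub (Continuous.integrableOn_rect (by fun_prop))
      (Continuous.integrableOn_rect (by fun_prop)), integral_const_mul, integral_const_mul,
    integral_const_mul, hX, hY] at hmono
  have hlg : 0 ≤ lam * γ := by positivity
  have h1 := mul_le_mul_of_nonneg_left hY0 hlg
  have h2 := mul_nonneg hlg hX0
  linarith

/-- Here `P`, `Y`, `U`, `W`, `X` stand for the weighted integrals of the squares of `h_x`, `h_t`,
`h`, `h_x - a h_t` and of the operator; `P0`, `U0` are traces at `t = 0` and `E` is the error at `t
= T`. Only `Y` is delicate: `a h_t` is `h_x` minus `h_x - a h_t`, and the bound for the latter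
contains `Y` again, with a factor that `hbig` makes small enough to absorb. -/
lemma carleman_combine {γ a₀ a₁ a₂ P Y U W X P0 U0 E : ℝ} (hγ : 0 < γ) (ha₀ : 0 < a₀)
    (ha₁ : 0 < a₁) (hlam : 1 ≤ lam) (hbig : 4 * a₂ ^ 2 ≤ lam ^ 2 * a₀ ^ 2 / 2) (nP : 0 ≤ P)
    (nY : 0 ≤ Y) (nX : 0 ≤ X) (nP0 : 0 ≤ P0) (nU0 : 0 ≤ U0) (nE : 0 ≤ E)
    (hP : lam ^ 2 * γ ^ 2 * P + lam * γ * a₀ * P0 ≤ X + γ * a₁ * E) (hU : lam ^ 2 * U ≤ P)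
    (hU0 : lam ^ 2 * U0 ≤ P0) (hW : lam ^ 2 * W ≤ 2 * X + 2 * a₂ ^ 2 * Y)
    (hY : a₀ ^ 2 * Y ≤ 2 * P + 2 * W) :
    lam ^ 2 * (P + Y + U) + lam * (P0 + U0) ≤
      (1 + γ * a₁) * (2 / γ ^ 2 + 2 / (a₀ ^ 2) * (2 / γ ^ 2 + 4) + 2 / (γ * a₀)) * (X + E) := by
  have hlam0 : 0 ≤ lam := by linarith
  set S := X + γ * a₁ * E with hS
  have nS : 0 ≤ S := by positivity
  have bP : lam ^ 2 * P ≤ S / γ ^ 2 := by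
    rw [le_div_iff₀ (by positivity)]
    have : 0 ≤ lam * γ * a₀ * P0 := by positivity
    linarith
  have bP0 : lam * P0 ≤ S / (γ * a₀) := by
    rw [le_div_iff₀ (by positivity)]
    have : 0 ≤ lam ^ 2 * γ ^ 2 * P := by positivity
    linarith
  have hl2 : 1 ≤ lam ^ 2 := one_le_pow₀ hlam
  have bU : lam ^ 2 * U ≤ S / γ ^ 2 := by
    have := mul_le_mul_of_nonneg_right hl2 nP
    linarith
  have bU0 : lam * U0 ≤ S / (γ * a₀) := by
    have h1 := mul_le_mul_of_nonneg_right hl2 nU0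
    have h2 : lam * U0 ≤ lam * P0 := mul_le_mul_of_nonneg_left (by linarith) hlam0
    linarith
  have hXS : X ≤ S := by
    have : 0 ≤ γ * a₁ * E := by positivity
    linarith
  have bY : lam ^ 2 * Y ≤ 2 / (a₀ ^ 2) * (2 / γ ^ 2 + 4) * S := by
    have h1 := mul_le_mul_of_nonneg_left hY (sq_nonneg lam)
    have h4 := mul_le_mul_of_nonneg_right hbig nY
    have h5 : 2 / γ ^ 2 * S = 2 * (S / γ ^ 2) := by ring
    have h3 : lam ^ 2 * a₀ ^ 2 / 2 * Y ≤ (2 / γ ^ 2 + 4) * S := by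
      rw [add_mul, h5]; linarith
    have h6 : lam ^ 2 * Y = 2 / a₀ ^ 2 * (lam ^ 2 * a₀ ^ 2 / 2 * Y) := by field_simp
    rw [h6, mul_assoc]
    exact mul_le_mul_of_nonneg_left h3 (by positivity)
  have hSB : S ≤ (1 + γ * a₁) * (X + E) := by
    have : 0 ≤ γ * a₁ * X := by positivity
    rw [hS, add_mul, mul_add]; linarith
  have hfin : lam ^ 2 * (P + Y + U) + lam * (P0 + U0) ≤
      (2 / γ ^ 2 + 2 / (a₀ ^ 2) * (2 / γ ^ 2 + 4) + 2 / (γ * a₀)) * S := by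
    have e1 : 2 / γ ^ 2 * S = 2 * (S / γ ^ 2) := by ring
    have e2 : 2 / (γ * a₀) * S = 2 * (S / (γ * a₀)) := by ring
    rw [add_mul, add_mul, e1, e2]; linarith
  refine hfin.trans ?_
  rw [mul_comm (1 + γ * a₁), mul_assoc]
  exact mul_le_mul_of_nonneg_left hSB (by positivity)

/-- Carleman estimate for `∂ₓ² - a(x) ∂ₓ ∂ₜ`. -/
lemma carleman_estimate (hε : ε < M) (hT : 0 < T) {γ a₀ a₁ a₂ : ℝ} (hγ : 0 < γ) (ha₀ : 0 < a₀)
    (ha₁ : 0 < a₁) :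
    ∃ C > 0, ∃ lam₀ ≥ (1 : ℝ), ∀ lam ≥ lam₀, ∀ (a a' : ℝ → ℝ) (h hx ht hxx hxt : ℝ → ℝ → ℝ),
      Continuous a → Continuous a' → (∀ x ∈ Ioo ε M, HasDerivAt a (a' x) x) →
      (∀ x ∈ Icc ε M, a₀ ≤ a x) → (∀ x ∈ Icc ε M, a x ≤ a₁) → (∀ x ∈ Icc ε M, |a' x| ≤ a₂) →
      (∀ x ∈ Icc ε M, γ ≤ 1 - α * a x) →
      Continuous (fun z : ℝ × ℝ => h z.1 z.2) → Continuous (fun z : ℝ × ℝ => hx z.1 z.2) →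
      Continuous (fun z : ℝ × ℝ => ht z.1 z.2) → Continuous (fun z : ℝ × ℝ => hxx z.1 z.2) →
      Continuous (fun z : ℝ × ℝ => hxt z.1 z.2) →
      (∀ x ∈ Ioo ε M, ∀ t ∈ Icc 0 T, HasDerivAt (fun s => h s t) (hx x t) x) →
      (∀ x ∈ Ioo ε M, ∀ t ∈ Icc 0 T, HasDerivAt (fun s => hx s t) (hxx x t) x) →
      (∀ x ∈ Icc ε M, ∀ t ∈ Ioo 0 T, HasDerivAt (fun s => hx x s) (hxt x t) t) →
      (∀ x ∈ Ioo ε M, ∀ t ∈ Icc 0 T, HasDerivAt (fun s => ht s t) (hxt x t) x) →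
      (∀ t ∈ Icc 0 T, h ε t = 0) → (∀ t ∈ Icc 0 T, hx ε t = 0) → (∀ t ∈ Icc 0 T, ht ε t = 0) →
      lam ^ 2 * ((∫ z in rect ε M T, weight lam α z.1 z.2 * hx z.1 z.2 ^ 2)
          + (∫ z in rect ε M T, weight lam α z.1 z.2 * ht z.1 z.2 ^ 2)
          + ∫ z in rect ε M T, weight lam α z.1 z.2 * h z.1 z.2 ^ 2)
        + lam * ((∫ x in ε..M, Real.exp (-2 * lam * x) * hx x 0 ^ 2)
          + ∫ x in ε..M, Real.exp (-2 * lam * x) * h x 0 ^ 2)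
        ≤ C * ((∫ z in rect ε M T, weight lam α z.1 z.2 * (hxx z.1 z.2 - a z.1 * hxt z.1 z.2) ^ 2)
          + lam * Real.exp (-2 * lam * α * T) *
            ∫ x in ε..M, Real.exp (-2 * lam * x) * hx x T ^ 2) := by
  -- The threshold yields both `λ ≥ 1` and `4|a₂| ≤ λ a₀`, hence the absorption condition. It and
  -- the constant depend on the bounds of `a` only, so they are uniform in the coefficient.
  refine ⟨(1 + γ * a₁) * (2 / γ ^ 2 + 2 / (a₀ ^ 2) * (2 / γ ^ 2 + 4) + 2 / (γ * a₀)), by positivity, 1 + 4 * |a₂| / a₀, le_add_of_nonneg_right (by positivity), ?_⟩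
  intro lam hlam a a' h hx ht hxx hxt ca ca' hda hA0 hA1 hA2 hAg ch chx cht chxx chxt d1 d2 d3 d4
    z1 z2 z3
  have hlam1 : 1 ≤ lam := le_trans (le_add_of_nonneg_right (by positivity)) hlam
  have hlam0 : 0 ≤ lam := by linarith
  have slice : ∀ {k : ℝ → ℝ → ℝ}, Continuous (fun z : ℝ × ℝ => k z.1 z.2) → ∀ t,
      Continuous fun x => k x t := fun hk t => hk.comp (by fun_prop : Continuous fun x : ℝ => (x, t))
  have k1 := transport_estimate (α := α) hε hT hlam0 hγ.le ca hA0 hA1 hAg chx chxx chxt d2 d3 z2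
  have k2 := hardy_rect (α := α) hε hT hlam0 ch chx d1 z1
  have k3 := hardy_interval hε hlam0 (slice ch 0) (slice chx 0)
    (fun x hx' => d1 x hx' 0 ⟨le_rfl, hT.le⟩) (z1 0 ⟨le_rfl, hT.le⟩)
  -- The `x`-derivative of `h_x - a h_t` is the operator minus `a' h_t`. This brings in `h_t`
  -- without any further `t`-derivative.
  have k4 := hardy_rect (α := α) hε hT hlam0 (g := fun x t => hx x t - a x * ht x t)
    (gx := fun x t => (hxx x t - a x * hxt x t) - a' x * ht x t) (by fun_prop) (by fun_prop)
    (fun x hx' t ht' => by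
      exact ((d2 x hx' t ht').sub ((hda x hx').mul (d4 x hx' t ht'))).congr_deriv (by ring))
    (fun t ht' => by simp [z2 t ht', z3 t ht'])
  set P := ∫ z in rect ε M T, weight lam α z.1 z.2 * hx z.1 z.2 ^ 2 with hP
  set Y := ∫ z in rect ε M T, weight lam α z.1 z.2 * ht z.1 z.2 ^ 2 with hY
  set U := ∫ z in rect ε M T, weight lam α z.1 z.2 * h z.1 z.2 ^ 2 with hU
  set W := ∫ z in rect ε M T, weight lam α z.1 z.2 * (hx z.1 z.2 - a z.1 * ht z.1 z.2) ^ 2 with hW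
  set X := ∫ z in rect ε M T, weight lam α z.1 z.2 * (hxx z.1 z.2 - a z.1 * hxt z.1 z.2) ^ 2 with hX
  set P0 := ∫ x in ε..M, Real.exp (-2 * lam * x) * hx x 0 ^ 2 with hP0
  set U0 := ∫ x in ε..M, Real.exp (-2 * lam * x) * h x 0 ^ 2 with hU0
  set PT := ∫ x in ε..M, Real.exp (-2 * lam * x) * hx x T ^ 2 with hPT
  have nn : ∀ k : ℝ → ℝ → ℝ, 0 ≤ ∫ z in rect ε M T, weight lam α z.1 z.2 * k z.1 z.2 ^ 2 :=
    fun k => integral_nonneg fun z => mul_nonneg (weight_pos _ _ _ _).le (sq_nonneg _)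
  have nP : 0 ≤ P := nn hx
  have nY : 0 ≤ Y := nn ht
  have nX : 0 ≤ X := nn fun x t => hxx x t - a x * hxt x t
  have ni : ∀ k : ℝ → ℝ, 0 ≤ ∫ x in ε..M, Real.exp (-2 * lam * x) * k x ^ 2 := fun k =>
    intervalIntegral.integral_nonneg hε.le fun x _ => by positivity
  have nP0 : 0 ≤ P0 := ni _
  have nU0 : 0 ≤ U0 := ni _
  have nPT : 0 ≤ PT := ni _
  have k5 : ∫ z in rect ε M T, weight lam α z.1 z.2 *
      ((hxx z.1 z.2 - a z.1 * hxt z.1 z.2) - a' z.1 * ht z.1 z.2) ^ 2 ≤ 2 * X + 2 * a₂ ^ 2 * Y := by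
    rw [hX, hY, ← integral_const_mul, ← integral_const_mul,
      ← integral_add (Continuous.integrableOn_rect (by fun_prop))
        (Continuous.integrableOn_rect (by fun_prop))]
    refine setIntegral_rect_mono (by fun_prop) (by fun_prop) fun z hz => ?_
    have hw := (weight_pos lam α z.1 z.2).le
    have h1 : (a' z.1) ^ 2 ≤ a₂ ^ 2 := by
      have := hA2 z.1 (Ioo_subset_Icc_self hz.1)
      exact sq_le_sq.2 (this.trans (le_abs_self _))
    have h2 := mul_le_mul_of_nonneg_right h1 (mul_nonneg hw (sq_nonneg (ht z.1 z.2)))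
    have h3 := mul_nonneg hw
      (sq_nonneg ((hxx z.1 z.2 - a z.1 * hxt z.1 z.2) + a' z.1 * ht z.1 z.2))
    nlinarith
  have k6 : a₀ ^ 2 * Y ≤ 2 * P + 2 * W := by
    rw [hP, hY, hW, ← integral_const_mul, ← integral_const_mul, ← integral_const_mul,
      ← integral_add (Continuous.integrableOn_rect (by fun_prop))
        (Continuous.integrableOn_rect (by fun_prop))]
    refine setIntegral_rect_mono (by fun_prop) (by fun_prop) fun z hz => ?_
    have hw := (weight_pos lam α z.1 z.2).le
    have h1 : a₀ ^ 2 ≤ (a z.1) ^ 2 := by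
      have := hA0 z.1 (Ioo_subset_Icc_self hz.1)
      exact pow_le_pow_left₀ ha₀.le this 2
    have h2 := mul_le_mul_of_nonneg_right h1 (mul_nonneg hw (sq_nonneg (ht z.1 z.2)))
    have h3 := mul_nonneg hw (sq_nonneg (2 * hx z.1 z.2 - a z.1 * ht z.1 z.2))
    nlinarith
  have hbig : 4 * a₂ ^ 2 ≤ lam ^ 2 * a₀ ^ 2 / 2 := by
    have h1 : 4 * |a₂| ≤ lam * a₀ := by
      have : 4 * |a₂| / a₀ ≤ lam := by linarith
      rwa [div_le_iff₀ ha₀] at this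
    have h2 : (4 * |a₂|) ^ 2 ≤ (lam * a₀) ^ 2 := pow_le_pow_left₀ (by positivity) h1 2
    rw [mul_pow, mul_pow, sq_abs] at h2
    linarith [sq_nonneg a₂]
  exact carleman_combine hγ ha₀ ha₁ hlam1 hbig nP nY nX nP0 nU0
    (E := lam * Real.exp (-2 * lam * α * T) * PT) (by positivity) (by linarith) k2 k3
    (k4.trans k5) k6

end Carleman

/-! ### Pointwise algebra of the nonlinearity and its remainder -/

section Pointwise

variable {A W a b c r k da db dc dr v v' : ℝ}

/-- The nonlinear expression `F` in terms of `a = q_xx`, `b = q_xt`, `c = q_t`, `r = q_x(x,0)` and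
`v = 1 / q(x,0)`. -/
def Fval (a b c r v : ℝ) : ℝ := a - b * v ^ 2 / 2 + c * r * v ^ 3 / 2

/-- The linearization of `F`; `k = h(x,0)`. -/
def Lval (b c r v da db dc k dr : ℝ) : ℝ :=
  da - db * v ^ 2 / 2 + b * v ^ 3 * k + (dc * r + c * dr) * v ^ 3 / 2 - 3 / 2 * (c * r * v ^ 4 * k)

/-- In terms of `v = 1/q(x,0)` the expression is polynomial, and `hv` is the identity `1/q - 1/(q+k)
= k/(q(q+k))`. The coefficient of `db` is taken at the new point `v'`, so that no product of `db`
with `k` is left over. -/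
lemma Fval_sub (hv : v - v' = k * v * v') :
    Fval (a + da) (b + db) (c + dc) (r + dr) v' - Fval a b c r v = (da - v' ^ 2 / 2 * db)
      + (b * (v * v' * (v + v') / 2) * k + ((c * dr + dc * (r + dr)) * v' ^ 3 / 2
        - c * r * (v * v' * (v ^ 2 + v * v' + v' ^ 2)) * k / 2)) := by
  unfold Fval
  linear_combination (b * (v + v') / 2 - c * r * (v ^ 2 + v * v' + v' ^ 2) / 2) * hv

/-- The single quadratic term containing a second derivative of `h` is isolated as the first
summand, because `h_xt` is not controlled by the Carleman estimate. All other terms are quadratic in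
`k`, `dc`, `dr`. -/
lemma Fval_sub_Lval (hv : v - v' = k * v * v') :
    Fval (a + da) (b + db) (c + dc) (r + dr) v' - Fval a b c r v - Lval b c r v da db dc k dr
      = db * k * (v * v' * (v + v') / 2)
      + (-(b * (v ^ 3 * v' + v ^ 2 * v' ^ 2 / 2)) * k ^ 2
      + c * r * (v ^ 2 * v' * (3 * v ^ 2 + 2 * v * v' + v' ^ 2)) * k ^ 2 / 2
      - (dc * r + c * dr + dc * dr) * (v * v' * (v ^ 2 + v * v' + v' ^ 2)) * k / 2
      + dc * dr * v ^ 3 / 2) := by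
  have e2 : v' ^ 2 - v ^ 2 = -(k * v * v') * (v + v') := by
    linear_combination (-(v + v')) * hv
  have e3 : v' ^ 3 - v ^ 3 = -(k * v * v') * (v ^ 2 + v * v' + v' ^ 2) := by
    linear_combination (-(v ^ 2 + v * v' + v' ^ 2)) * hv
  have e4 : v' ^ 2 - v ^ 2 + 2 * v ^ 3 * k = 2 * k ^ 2 * (v ^ 3 * v' + v ^ 2 * v' ^ 2 / 2) := by
    linear_combination e2 + (k * v * (2 * v + v')) * hv
  have e5 : v' ^ 3 - v ^ 3 + 3 * v ^ 4 * k
      = k ^ 2 * (v ^ 2 * v' * (3 * v ^ 2 + 2 * v * v' + v' ^ 2)) := by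
    linear_combination e3 + (k * v * (3 * v ^ 2 + 2 * v * v' + v' ^ 2)) * hv
  unfold Fval Lval
  linear_combination (-db / 2) * e2 - b / 2 * e4 + c * r / 2 * e5
    + (dc * r + c * dr + dc * dr) / 2 * e3

lemma abs_Fval_le (hA : 1 ≤ A) (hW : 1 ≤ W) (ha : |a| ≤ A) (hb : |b| ≤ A) (hc : |c| ≤ A)
    (hr : |r| ≤ A) (hv : |v| ≤ W) : |Fval a b c r v| ≤ 2 * (A ^ 2 * W ^ 3) := by
  have hA0 : 0 ≤ A := by linarith
  have hW0 : 0 ≤ W := by linarith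
  have h1 : |Fval a b c r v| ≤ |a| + |b| * |v| ^ 2 / 2 + |c| * |r| * |v| ^ 3 / 2 := by
    unfold Fval
    refine (abs_add_le _ _).trans (add_le_add ((abs_sub _ _).trans (le_of_eq ?_)) (le_of_eq ?_))
    · simp [abs_mul, abs_div]
    · simp [abs_mul, abs_div]
  refine h1.trans ?_
  have h2 : |a| + |b| * |v| ^ 2 / 2 + |c| * |r| * |v| ^ 3 / 2
      ≤ A + A * W ^ 2 / 2 + A * A * W ^ 3 / 2 := by gcongr
  have h3 : A ≤ A ^ 2 := le_self_pow₀ hA two_ne_zero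
  have h4 : (1 : ℝ) ≤ W ^ 3 := one_le_pow₀ hW
  have h5 : W ^ 2 ≤ W ^ 3 := pow_le_pow_right₀ hW (by norm_num)
  have h6 : A * 1 ≤ A ^ 2 * W ^ 3 := by gcongr
  have h7 : A * W ^ 2 ≤ A ^ 2 * W ^ 3 := by gcongr
  have h8 : A * A * W ^ 3 = A ^ 2 * W ^ 3 := by ring
  linarith

lemma abs_Lval_le {s : ℝ} (hA : 1 ≤ A) (hW : 1 ≤ W) (hb : |b| ≤ A) (hc : |c| ≤ A)
    (hr : |r| ≤ A) (hv : |v| ≤ W) (h1 : |da| ≤ s) (h2 : |db| ≤ s) (h3 : |dc| ≤ s) (h4 : |k| ≤ s)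
    (h5 : |dr| ≤ s) : |Lval b c r v da db dc k dr| ≤ 6 * (A ^ 2 * W ^ 4) * s := by
  have hA0 : 0 ≤ A := by linarith
  have hW0 : 0 ≤ W := by linarith
  have hs : 0 ≤ s := (abs_nonneg _).trans h1
  have e1 : |Lval b c r v da db dc k dr| ≤ |da| + |db| * |v| ^ 2 / 2 + |b| * |v| ^ 3 * |k|
      + (|dc| * |r| + |c| * |dr|) * |v| ^ 3 / 2 + 3 / 2 * (|c| * |r| * |v| ^ 4 * |k|) := by
    unfold Lval
    refine (abs_sub _ _).trans (add_le_add ((abs_add_le _ _).trans (add_le_add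
      ((abs_add_le _ _).trans (add_le_add ((abs_sub _ _).trans (le_of_eq ?_)) (le_of_eq ?_))) ?_))
      (le_of_eq ?_))
    · simp [abs_mul, abs_div]
    · simp [abs_mul]
    · rw [abs_div, abs_mul, abs_pow, abs_two]
      gcongr
      exact (abs_add_le _ _).trans (by rw [abs_mul, abs_mul])
    · rw [abs_mul, abs_mul, abs_mul, abs_mul, abs_pow, abs_of_pos (by norm_num : (0 : ℝ) < 3 / 2)]
  have e2 : |da| + |db| * |v| ^ 2 / 2 + |b| * |v| ^ 3 * |k|
      + (|dc| * |r| + |c| * |dr|) * |v| ^ 3 / 2 + 3 / 2 * (|c| * |r| * |v| ^ 4 * |k|)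
      ≤ s + s * W ^ 2 / 2 + A * W ^ 3 * s + (s * A + A * s) * W ^ 3 / 2
        + 3 / 2 * (A * A * W ^ 4 * s) := by gcongr
  have hA2 : A ≤ A ^ 2 := le_self_pow₀ hA two_ne_zero
  have hA1 : 1 ≤ A ^ 2 := one_le_pow₀ hA
  have w1 : (1 : ℝ) ≤ W ^ 4 := one_le_pow₀ hW
  have w2 : W ^ 2 ≤ W ^ 4 := pow_le_pow_right₀ hW (by norm_num)
  have w3 : W ^ 3 ≤ W ^ 4 := pow_le_pow_right₀ hW (by norm_num)
  have f1 : 1 * 1 * s ≤ A ^ 2 * W ^ 4 * s := by gcongr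
  have f2 : 1 * W ^ 2 * s ≤ A ^ 2 * W ^ 4 * s := by gcongr
  have f3 : A * W ^ 3 * s ≤ A ^ 2 * W ^ 4 * s := by gcongr
  linarith

lemma abs_mul_abs_le (x y : ℝ) : |x| * |y| ≤ (x ^ 2 + y ^ 2) / 2 := by
  nlinarith [sq_nonneg (|x| - |y|), sq_abs x, sq_abs y]

lemma abs_mu_le (hW : 0 ≤ W) (hv : |v| ≤ W) (hv' : |v'| ≤ W) :
    |v * v' * (v + v') / 2| ≤ W ^ 3 := by
  have h : |v + v'| ≤ W + W := (abs_add_le _ _).trans (add_le_add hv hv')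
  calc |v * v' * (v + v') / 2| = |v| * |v'| * |v + v'| / 2 := by simp [abs_mul, abs_div]
    _ ≤ W * W * (W + W) / 2 := by gcongr
    _ = W ^ 3 := by ring

lemma abs_cubic_le (hW : 0 ≤ W) (hv : |v| ≤ W) (hv' : |v'| ≤ W) :
    |v * v' * (v ^ 2 + v * v' + v' ^ 2)| ≤ 3 * W ^ 4 := by
  have h : |v ^ 2 + v * v' + v' ^ 2| ≤ W ^ 2 + W * W + W ^ 2 := by
    refine (abs_add_three _ _ _).trans ?_
    rw [abs_mul, abs_pow, abs_pow]
    gcongr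
  calc |v * v' * (v ^ 2 + v * v' + v' ^ 2)| = |v| * |v'| * |v ^ 2 + v * v' + v' ^ 2| := by
        rw [abs_mul, abs_mul]
    _ ≤ W * W * (W ^ 2 + W * W + W ^ 2) := by gcongr
    _ = 3 * W ^ 4 := by ring

/-- The lower order part of `F(q + h) - F(q)`. -/
lemma abs_Fval_sub_le (hA : 1 ≤ A) (hW : 1 ≤ W) (hb : |b| ≤ A) (hc : |c| ≤ A) (hr : |r| ≤ A)
    (hrr : |r + dr| ≤ A) (hv : |v| ≤ W) (hv' : |v'| ≤ W) (hvv : v - v' = k * v * v') :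
    |Fval (a + da) (b + db) (c + dc) (r + dr) v' - Fval a b c r v - (da - v' ^ 2 / 2 * db)|
      ≤ 3 * (A ^ 2 * W ^ 4) * (|k| + |dc| + |dr|) := by
  have hA0 : 0 ≤ A := by linarith
  have hW0 : 0 ≤ W := by linarith
  rw [Fval_sub hvv, add_sub_cancel_left]
  have m1 := abs_mu_le hW0 hv hv'
  have m2 := abs_cubic_le hW0 hv hv'
  set μ := v * v' * (v + v') / 2
  set ν := v * v' * (v ^ 2 + v * v' + v' ^ 2)
  have e1 : |b * μ * k + ((c * dr + dc * (r + dr)) * v' ^ 3 / 2 - c * r * ν * k / 2)|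
      ≤ |b| * |μ| * |k| + ((|c| * |dr| + |dc| * |r + dr|) * |v'| ^ 3 / 2
        + |c| * |r| * |ν| * |k| / 2) := by
    refine (abs_add_le _ _).trans (add_le_add (le_of_eq ?_) ((abs_sub _ _).trans
      (add_le_add ?_ (le_of_eq ?_))))
    · simp [abs_mul]
    · rw [abs_div, abs_mul, abs_pow, abs_two]
      gcongr
      exact (abs_add_le _ _).trans (by rw [abs_mul, abs_mul])
    · simp [abs_mul, abs_div]
  have e2 : |b| * |μ| * |k| + ((|c| * |dr| + |dc| * |r + dr|) * |v'| ^ 3 / 2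
        + |c| * |r| * |ν| * |k| / 2) ≤ A * W ^ 3 * |k| + ((A * |dr| + |dc| * A) * W ^ 3 / 2
        + A * A * (3 * W ^ 4) * |k| / 2) := by gcongr
  have hA2 : A ≤ A ^ 2 := le_self_pow₀ hA two_ne_zero
  have w3 : W ^ 3 ≤ W ^ 4 := pow_le_pow_right₀ hW (by norm_num)
  have f3 : A * W ^ 3 ≤ A ^ 2 * W ^ 4 := by gcongr
  have g1 := mul_le_mul_of_nonneg_right f3 (abs_nonneg k)
  have g2 := mul_le_mul_of_nonneg_right f3 (abs_nonneg dr)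
  have g3 := mul_le_mul_of_nonneg_right f3 (abs_nonneg dc)
  have p0 : 0 ≤ A ^ 2 * W ^ 4 := by positivity
  have p1 := mul_nonneg p0 (abs_nonneg k)
  have p2 := mul_nonneg p0 (abs_nonneg dr)
  have p3 := mul_nonneg p0 (abs_nonneg dc)
  linarith

/-- The quadratic remainder of `F`, up to the term containing the mixed derivative of `h`. -/
lemma abs_Fval_remainder_le (hA : 1 ≤ A) (hW : 1 ≤ W) (hb : |b| ≤ A) (hc : |c| ≤ A) (hr : |r| ≤ A)
    (hrr : |r + dr| ≤ A) (hv : |v| ≤ W) (hv' : |v'| ≤ W) (hvv : v - v' = k * v * v') :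
    |Fval (a + da) (b + db) (c + dc) (r + dr) v' - Fval a b c r v - Lval b c r v da db dc k dr
      - db * k * (v * v' * (v + v') / 2)| ≤ 10 * (A ^ 2 * W ^ 5) * (k ^ 2 + dc ^ 2 + dr ^ 2) := by
  have hA0 : 0 ≤ A := by linarith
  have hW0 : 0 ≤ W := by linarith
  rw [Fval_sub_Lval hvv, add_sub_cancel_left]
  have m2 := abs_cubic_le hW0 hv hv'
  set ν := v * v' * (v ^ 2 + v * v' + v' ^ 2)
  have m3 : |v ^ 3 * v' + v ^ 2 * v' ^ 2 / 2| ≤ 3 / 2 * W ^ 4 := by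
    calc |v ^ 3 * v' + v ^ 2 * v' ^ 2 / 2| ≤ |v| ^ 3 * |v'| + |v| ^ 2 * |v'| ^ 2 / 2 :=
          (abs_add_le _ _).trans (le_of_eq (by simp [abs_mul, abs_div]))
      _ ≤ W ^ 3 * W + W ^ 2 * W ^ 2 / 2 := by gcongr
      _ = 3 / 2 * W ^ 4 := by ring
  set ρ := v ^ 3 * v' + v ^ 2 * v' ^ 2 / 2
  have m4 : |v ^ 2 * v' * (3 * v ^ 2 + 2 * v * v' + v' ^ 2)| ≤ 6 * W ^ 5 := by
    have h : |3 * v ^ 2 + 2 * v * v' + v' ^ 2| ≤ 3 * W ^ 2 + 2 * W * W + W ^ 2 := by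
      refine (abs_add_three _ _ _).trans ?_
      rw [abs_mul, abs_mul, abs_mul, abs_pow, abs_pow, abs_two,
        abs_of_pos (by norm_num : (0 : ℝ) < 3)]
      gcongr
    calc |v ^ 2 * v' * (3 * v ^ 2 + 2 * v * v' + v' ^ 2)|
        = |v| ^ 2 * |v'| * |3 * v ^ 2 + 2 * v * v' + v' ^ 2| := by rw [abs_mul, abs_mul, abs_pow]
      _ ≤ W ^ 2 * W * (3 * W ^ 2 + 2 * W * W + W ^ 2) := by gcongr
      _ = 6 * W ^ 5 := by ring
  set σ := v ^ 2 * v' * (3 * v ^ 2 + 2 * v * v' + v' ^ 2)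
  -- After this regrouping each product has one factor that is a value at the old or the new point,
  -- hence at most `A`, and no separate bound for the increments is needed.
  have hsplit : dc * r + c * dr + dc * dr = dc * (r + dr) + c * dr := by ring
  rw [hsplit]
  have e1 : |-(b * ρ) * k ^ 2 + c * r * σ * k ^ 2 / 2 - (dc * (r + dr) + c * dr) * ν * k / 2
      + dc * dr * v ^ 3 / 2| ≤ |b| * |ρ| * k ^ 2 + |c| * |r| * |σ| * k ^ 2 / 2
      + (|dc| * |r + dr| + |c| * |dr|) * |ν| * |k| / 2 + |dc| * |dr| * |v| ^ 3 / 2 := by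
    refine (abs_add_le _ _).trans (add_le_add ((abs_sub _ _).trans (add_le_add
      ((abs_add_le _ _).trans (add_le_add (le_of_eq ?_) (le_of_eq ?_))) ?_)) (le_of_eq ?_))
    · simp [abs_mul]
    · simp [abs_mul, abs_div]
    · rw [abs_div, abs_mul, abs_mul, abs_two]
      gcongr
      exact (abs_add_le _ _).trans (by rw [abs_mul, abs_mul])
    · simp [abs_mul, abs_div]
  have e2 : |b| * |ρ| * k ^ 2 + |c| * |r| * |σ| * k ^ 2 / 2
      + (|dc| * |r + dr| + |c| * |dr|) * |ν| * |k| / 2 + |dc| * |dr| * |v| ^ 3 / 2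
      ≤ A * (3 / 2 * W ^ 4) * k ^ 2 + A * A * (6 * W ^ 5) * k ^ 2 / 2
      + (|dc| * A + A * |dr|) * (3 * W ^ 4) * |k| / 2 + |dc| * |dr| * W ^ 3 / 2 := by gcongr
  have hA2 : A ≤ A ^ 2 := le_self_pow₀ hA two_ne_zero
  have hA1 : 1 ≤ A ^ 2 := one_le_pow₀ hA
  have w4 : W ^ 4 ≤ W ^ 5 := pow_le_pow_right₀ hW (by norm_num)
  have w3 : W ^ 3 ≤ W ^ 5 := pow_le_pow_right₀ hW (by norm_num)
  have f4 : A * W ^ 4 ≤ A ^ 2 * W ^ 5 := by gcongr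
  have f3 : 1 * W ^ 3 ≤ A ^ 2 * W ^ 5 := by gcongr
  set Q := A ^ 2 * W ^ 5
  have hQ : 0 ≤ Q := by positivity
  have y1 : |dc| * |k| ≤ (dc ^ 2 + k ^ 2) / 2 := abs_mul_abs_le _ _
  have y2 : |dr| * |k| ≤ (dr ^ 2 + k ^ 2) / 2 := abs_mul_abs_le _ _
  have y3 : |dc| * |dr| ≤ (dc ^ 2 + dr ^ 2) / 2 := abs_mul_abs_le _ _
  have g1 := mul_le_mul_of_nonneg_right f4 (sq_nonneg k)
  have g2 := mul_le_mul f4 y1 (by positivity) hQ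
  have g3 := mul_le_mul f4 y2 (by positivity) hQ
  have g4 := mul_le_mul f3 y3 (by positivity) hQ
  have p1 := mul_nonneg hQ (sq_nonneg k)
  have p2 := mul_nonneg hQ (sq_nonneg dr)
  have p3 := mul_nonneg hQ (sq_nonneg dc)
  have e3 : A * A * (6 * W ^ 5) * k ^ 2 / 2 = 3 * (Q * k ^ 2) := by simp only [Q]; ring
  rw [e3] at e2
  linarith

end Pointwise

/-! ### The functional, its formal derivative and Taylor estimates -/

section Functional

variable {ε M T c₀ lam α β : ℝ}

/-- `1 / q(x, 0)`, with `q(x, 0)` replaced by `c₀` where it is smaller. -/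
def qinv (c₀ : ℝ) (q : H5 ε M T) (x : ℝ) : ℝ := (max c₀ (rep q 0 0 x 0))⁻¹

/-- `F(q)` in terms of the extended representatives. -/
def Frep (c₀ : ℝ) (q : H5 ε M T) (x t : ℝ) : ℝ :=
  Fval (rep q 2 0 x t) (rep q 1 1 x t) (rep q 0 1 x t) (rep q 1 0 x 0) (qinv c₀ q x)

/-- The derivative of `F` at `q` in the direction `h`, in terms of the extended representatives. -/
def Lrep (c₀ : ℝ) (q h : H5 ε M T) (x t : ℝ) : ℝ :=
  Lval (rep q 1 1 x t) (rep q 0 1 x t) (rep q 1 0 x 0) (qinv c₀ q x)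
    (rep h 2 0 x t) (rep h 1 1 x t) (rep h 0 1 x t) (rep h 0 0 x 0) (rep h 1 0 x 0)

/-- The derivative of `J` at `q` in the direction `h`. -/
def dJ (lam α β c₀ : ℝ) (q h : H5 ε M T) : ℝ :=
  2 * (∫ z in rect ε M T, weight lam α z.1 z.2 * (Frep c₀ q z.1 z.2 * Lrep c₀ q h z.1 z.2))
    + 2 * β * inner ℝ q h

/-- `q(x, 0) ≥ c₀` on `[ε, M]`. -/
def TraceGE (c₀ : ℝ) (q : H5 ε M T) : Prop := ∀ x ∈ Icc ε M, c₀ ≤ rep q 0 0 x 0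

lemma qinv_eq {q : H5 ε M T} (hq : TraceGE c₀ q) {x : ℝ} (hx : x ∈ Icc ε M) :
    qinv c₀ q x = (rep q 0 0 x 0)⁻¹ := by rw [qinv, max_eq_right (hq x hx)]

lemma abs_qinv_le (hc : 0 < c₀) (q : H5 ε M T) (x : ℝ) : |qinv c₀ q x| ≤ c₀⁻¹ := by
  have h : 0 < max c₀ (rep q 0 0 x 0) := lt_max_of_lt_left hc
  rw [qinv, abs_of_pos (inv_pos.2 h)]
  exact inv_anti₀ hc (le_max_left _ _)

variable (hε : ε < M) (hT : 0 < T)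
include hε hT

lemma continuous_rep_trace (q : H5 ε M T) (i j : ℕ) (t : ℝ) : Continuous fun x => rep q i j x t :=
  (continuous_rep hε hT q i j).comp (by fun_prop : Continuous fun x : ℝ => (x, t))

/-- The truncation at `c₀` keeps the denominator positive outside `[ε, M]` too, where the extended
trace has no lower bound. Hence all integrands below are continuous on the whole plane. -/
lemma continuous_qinv (hc : 0 < c₀) (q : H5 ε M T) : Continuous (qinv c₀ q) := by
  have := continuous_rep_trace hε hT q 0 0 0
  exact (continuous_const.max this).inv₀ fun x => (lt_max_of_lt_left hc).ne'

lemma continuous_Frep (hc : 0 < c₀) (q : H5 ε M T) :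
    Continuous fun z : ℝ × ℝ => Frep c₀ q z.1 z.2 := by
  have h1 := continuous_rep hε hT q 2 0
  have h2 := continuous_rep hε hT q 1 1
  have h3 := continuous_rep hε hT q 0 1
  have h4 := continuous_rep_trace hε hT q 1 0 0
  have h5 := continuous_qinv hε hT hc q
  unfold Frep Fval
  fun_prop

lemma continuous_Lrep (hc : 0 < c₀) (q h : H5 ε M T) :
    Continuous fun z : ℝ × ℝ => Lrep c₀ q h z.1 z.2 := by
  have h2 := continuous_rep hε hT q 1 1
  have h3 := continuous_rep hε hT q 0 1
  have h4 := continuous_rep_trace hε hT q 1 0 0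
  have h5 := continuous_qinv hε hT hc q
  have k1 := continuous_rep hε hT h 2 0
  have k2 := continuous_rep hε hT h 1 1
  have k3 := continuous_rep hε hT h 0 1
  have k4 := continuous_rep_trace hε hT h 0 0 0
  have k5 := continuous_rep_trace hε hT h 1 0 0
  unfold Lrep Lval
  fun_prop

lemma F_eq_Frep {q : H5 ε M T} (hq : TraceGE c₀ q) {x t : ℝ} (hx : x ∈ Icc ε M)
    (ht : t ∈ Icc 0 T) : F q x t = Frep c₀ q x t := by
  have h0 : (0 : ℝ) ∈ Icc 0 T := ⟨le_rfl, hT.le⟩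
  rw [F, D_eq_rep hε hT q (by norm_num) hx ht, D_eq_rep hε hT q (by norm_num) hx ht,
    D_eq_rep hε hT q (by norm_num) hx ht, D_eq_rep hε hT q (by norm_num) hx h0,
    D_eq_rep hε hT q (by norm_num) hx h0, Frep, Fval, qinv_eq hq hx]
  simp only [div_eq_mul_inv, mul_inv, inv_pow]
  ring

lemma J_eq {q : H5 ε M T} (hq : TraceGE c₀ q) :
    J lam α β q = (∫ z in rect ε M T, weight lam α z.1 z.2 * Frep c₀ q z.1 z.2 ^ 2)
      + β * ‖q‖ ^ 2 := by
  rw [J]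
  congr 1
  refine setIntegral_congr_fun measurableSet_rect fun z hz => ?_
  rw [F_eq_Frep hε hT hq (Ioo_subset_Icc_self hz.1) (Ioo_subset_Icc_self hz.2), sq_abs, weight]

/-- The identity `(F+δ)² - F² - 2FL = δ² + 2F(δ-L)` under the integral, together with the exact
expansion of the quadratic penalty. Convexity has to come from `δ²` and the penalty, and `δ - L` is
what they must dominate. -/
lemma J_sub_eq (hc : 0 < c₀) {q h : H5 ε M T} (hq : TraceGE c₀ q) (hqh : TraceGE c₀ (q + h)) :
    J lam α β (q + h) - J lam α β q - dJ lam α β c₀ q h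
      = (∫ z in rect ε M T, weight lam α z.1 z.2 *
        ((Frep c₀ (q + h) z.1 z.2 - Frep c₀ q z.1 z.2) ^ 2 + 2 * Frep c₀ q z.1 z.2 *
          (Frep c₀ (q + h) z.1 z.2 - Frep c₀ q z.1 z.2 - Lrep c₀ q h z.1 z.2))) + β * ‖h‖ ^ 2 := by
  have c1 := continuous_Frep hε hT hc q
  have c2 := continuous_Frep hε hT hc (q + h)
  have c3 := continuous_Lrep hε hT hc q h
  rw [J_eq hε hT hq, J_eq hε hT hqh, dJ, norm_add_sq_real]
  have e : ∫ z in rect ε M T, weight lam α z.1 z.2 *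
        ((Frep c₀ (q + h) z.1 z.2 - Frep c₀ q z.1 z.2) ^ 2 + 2 * Frep c₀ q z.1 z.2 *
          (Frep c₀ (q + h) z.1 z.2 - Frep c₀ q z.1 z.2 - Lrep c₀ q h z.1 z.2))
      = ∫ z in rect ε M T, (weight lam α z.1 z.2 * Frep c₀ (q + h) z.1 z.2 ^ 2
        - weight lam α z.1 z.2 * Frep c₀ q z.1 z.2 ^ 2
        - 2 * (weight lam α z.1 z.2 * (Frep c₀ q z.1 z.2 * Lrep c₀ q h z.1 z.2))) := by
    congr 1; funext z; ring
  rw [e, integral_sub (Continuous.integrableOn_rect (by fun_prop))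
      (Continuous.integrableOn_rect (by fun_prop)),
    integral_sub (Continuous.integrableOn_rect (by fun_prop))
      (Continuous.integrableOn_rect (by fun_prop)), integral_const_mul]
  ring

omit hε hT in
lemma qinv_sub (hc : 0 < c₀) (hε : ε < M) (hT : 0 < T) {q h : H5 ε M T} (hq : TraceGE c₀ q)
    (hqh : TraceGE c₀ (q + h)) {x : ℝ} (hx : x ∈ Icc ε M) :
    qinv c₀ q x - qinv c₀ (q + h) x = rep h 0 0 x 0 * qinv c₀ q x * qinv c₀ (q + h) x := by
  have h1 : 0 < rep q 0 0 x 0 := hc.trans_le (hq x hx)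
  have h2 : 0 < rep (q + h) 0 0 x 0 := hc.trans_le (hqh x hx)
  rw [qinv_eq hq hx, qinv_eq hqh hx]
  have h3 : rep h 0 0 x 0 = rep (q + h) 0 0 x 0 - rep q 0 0 x 0 := by rw [rep_add hε hT]; ring
  rw [h3]
  field_simp

lemma Frep_add (q h : H5 ε M T) (x t : ℝ) : Frep c₀ (q + h) x t =
    Fval (rep q 2 0 x t + rep h 2 0 x t) (rep q 1 1 x t + rep h 1 1 x t)
      (rep q 0 1 x t + rep h 0 1 x t) (rep q 1 0 x 0 + rep h 1 0 x 0) (qinv c₀ (q + h) x) := by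
  rw [Frep, rep_add hε hT, rep_add hε hT, rep_add hε hT, rep_add hε hT]

/-- The uniform constants for the convexity argument, gathered in one. The last bound is for the
`t`-derivative of `F(q)`: the traces do not depend on `t`, so it is the same expression in the
differentiated arguments, with third derivatives of `q`. -/
lemma exists_abs_Frep_sub_le (hc : 0 < c₀) (R : ℝ) : ∃ C > 0, ∀ q h : H5 ε M T, ‖q‖ ≤ R →
    ‖q + h‖ ≤ R → TraceGE c₀ q → TraceGE c₀ (q + h) → ∀ x ∈ Icc ε M, ∀ t,
      |Frep c₀ q x t| ≤ C ∧
      |Frep c₀ (q + h) x t - Frep c₀ q x t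
        - (rep h 2 0 x t - qinv c₀ (q + h) x ^ 2 / 2 * rep h 1 1 x t)|
        ≤ C * (|rep h 0 0 x 0| + |rep h 0 1 x t| + |rep h 1 0 x 0|) ∧
      |Frep c₀ (q + h) x t - Frep c₀ q x t - Lrep c₀ q h x t - rep h 1 1 x t * rep h 0 0 x 0
        * (qinv c₀ q x * qinv c₀ (q + h) x * (qinv c₀ q x + qinv c₀ (q + h) x) / 2)|
        ≤ C * (rep h 0 0 x 0 ^ 2 + rep h 0 1 x t ^ 2 + rep h 1 0 x 0 ^ 2) ∧
      |qinv c₀ q x * qinv c₀ (q + h) x * (qinv c₀ q x + qinv c₀ (q + h) x) / 2| ≤ C ∧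
      |Fval (rep q 2 1 x t) (rep q 1 2 x t) (rep q 0 2 x t) (rep q 1 0 x 0) (qinv c₀ q x)| ≤ C := by
  obtain ⟨K, hK0, hK⟩ := exists_abs_rep_le hε hT
  set A := 1 + K * |R| with hA
  set W := 1 + c₀⁻¹ with hW
  have hA1 : 1 ≤ A := le_add_of_nonneg_right (by positivity)
  have hW1 : 1 ≤ W := le_add_of_nonneg_right (by positivity)
  have hb : ∀ q : H5 ε M T, ‖q‖ ≤ R → ∀ i j x t, |rep q i j x t| ≤ A := fun q hq i j x t => by
    have h1 := hK q i j x t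
    have h2 : K * ‖q‖ ≤ K * |R| := by gcongr; exact hq.trans (le_abs_self R)
    linarith
  have hv : ∀ (q : H5 ε M T) x, |qinv c₀ q x| ≤ W := fun q x =>
    (abs_qinv_le hc q x).trans (by linarith)
  refine ⟨2 * (A ^ 2 * W ^ 3) + 3 * (A ^ 2 * W ^ 4) + 10 * (A ^ 2 * W ^ 5) + W ^ 3, by positivity,
    fun q h hq hqh tq tqh x hx t => ?_⟩
  have p1 : 0 ≤ 2 * (A ^ 2 * W ^ 3) := by positivity
  have p2 : 0 ≤ 3 * (A ^ 2 * W ^ 4) := by positivity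
  have p3 : 0 ≤ 10 * (A ^ 2 * W ^ 5) := by positivity
  have p4 : 0 ≤ W ^ 3 := by positivity
  have hrr : |rep q 1 0 x 0 + rep h 1 0 x 0| ≤ A := by
    rw [← rep_add hε hT]; exact hb _ hqh _ _ _ _
  have hvv := qinv_sub hc hε hT tq tqh hx
  refine ⟨?_, ?_, ?_, ?_, ?_⟩
  · refine (abs_Fval_le hA1 hW1 (hb q hq _ _ _ _) (hb q hq _ _ _ _) (hb q hq _ _ _ _)
      (hb q hq _ _ _ _) (hv q x)).trans (by linarith)
  · rw [Frep_add hε hT, Frep]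
    refine (abs_Fval_sub_le hA1 hW1 (hb q hq _ _ _ _) (hb q hq _ _ _ _) (hb q hq _ _ _ _) hrr
      (hv q x) (hv (q + h) x) hvv).trans (mul_le_mul_of_nonneg_right (by linarith) (by positivity))
  · rw [Frep_add hε hT, Frep, Lrep]
    refine (abs_Fval_remainder_le hA1 hW1 (hb q hq _ _ _ _) (hb q hq _ _ _ _) (hb q hq _ _ _ _) hrr
      (hv q x) (hv (q + h) x) hvv).trans (mul_le_mul_of_nonneg_right (by linarith) (by positivity))
  · exact (abs_mu_le (by linarith) (hv q x) (hv (q + h) x)).trans (by linarith)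
  · refine (abs_Fval_le hA1 hW1 (hb q hq _ _ _ _) (hb q hq _ _ _ _) (hb q hq _ _ _ _)
      (hb q hq _ _ _ _) (hv q x)).trans (by linarith)

/-- Second order Taylor estimate for `J`, uniform on bounded sets of functions with traces bounded
below. -/
lemma exists_taylor_le (hc : 0 < c₀) (R lam α β : ℝ) : ∃ C > 0, ∀ q h : H5 ε M T, ‖q‖ ≤ R →
    ‖q + h‖ ≤ R → TraceGE c₀ q → TraceGE c₀ (q + h) →
      |J lam α β (q + h) - J lam α β q - dJ lam α β c₀ q h| ≤ C * ‖h‖ ^ 2 := by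
  obtain ⟨K, hK0, hK⟩ := exists_abs_rep_le hε hT
  obtain ⟨B, hB0, hB⟩ := exists_abs_Frep_sub_le hε hT hc R
  set w := ∫ z in rect ε M T, weight lam α z.1 z.2 with hw
  have hw0 : 0 ≤ w := integral_nonneg fun z => (weight_pos _ _ _ _).le
  set W := 1 + c₀⁻¹ ^ 2 with hW
  -- The first summand is the square of the Lipschitz constant of `F`; the second is twice the bound
  -- of `F` times the constant of its quadratic remainder.
  set Q := (K + W * K + 3 * B * K) ^ 2 + 2 * B * (K ^ 2 * B + 3 * B * K ^ 2) with hQ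
  refine ⟨Q * w + |β| + 1, by positivity, fun q h hq hqh tq tqh => ?_⟩
  have c1 := continuous_Frep hε hT hc q
  have c2 := continuous_Frep hε hT hc (q + h)
  have c3 := continuous_Lrep hε hT hc q h
  rw [J_sub_eq hε hT hc tq tqh]
  have hI : |∫ z in rect ε M T, weight lam α z.1 z.2 *
        ((Frep c₀ (q + h) z.1 z.2 - Frep c₀ q z.1 z.2) ^ 2 + 2 * Frep c₀ q z.1 z.2 *
          (Frep c₀ (q + h) z.1 z.2 - Frep c₀ q z.1 z.2 - Lrep c₀ q h z.1 z.2))|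
      ≤ ∫ z in rect ε M T, Q * ‖h‖ ^ 2 * weight lam α z.1 z.2 := by
    have hi : IntegrableOn (fun z : ℝ × ℝ => Q * ‖h‖ ^ 2 * weight lam α z.1 z.2) (rect ε M T) :=
      Continuous.integrableOn_rect (by fun_prop)
    rw [← Real.norm_eq_abs]
    refine norm_integral_le_of_norm_le hi ?_
    filter_upwards [ae_restrict_mem measurableSet_rect] with z hz
    obtain ⟨b1, b2, b3, b4, -⟩ := hB q h hq hqh tq tqh z.1 (Ioo_subset_Icc_self hz.1) z.2
    have hwz := (weight_pos lam α z.1 z.2).le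
    rw [norm_mul, Real.norm_of_nonneg hwz, mul_comm (Q * ‖h‖ ^ 2)]
    refine mul_le_mul_of_nonneg_left ?_ hwz
    have k0 : |rep h 0 0 z.1 0| ≤ K * ‖h‖ := hK _ _ _ _ _
    have k1 : |rep h 0 1 z.1 z.2| ≤ K * ‖h‖ := hK _ _ _ _ _
    have k2 : |rep h 1 0 z.1 0| ≤ K * ‖h‖ := hK _ _ _ _ _
    have k3 : |rep h 2 0 z.1 z.2| ≤ K * ‖h‖ := hK _ _ _ _ _
    have k4 : |rep h 1 1 z.1 z.2| ≤ K * ‖h‖ := hK _ _ _ _ _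
    have sqb : ∀ {y : ℝ}, |y| ≤ K * ‖h‖ → y ^ 2 ≤ (K * ‖h‖) ^ 2 := fun hy =>
      sq_le_sq' (abs_le.1 hy).1 (abs_le.1 hy).2
    have hv2 : |qinv c₀ (q + h) z.1 ^ 2 / 2| ≤ W := by
      rw [abs_div, abs_pow, abs_two]
      have := pow_le_pow_left₀ (abs_nonneg _) (abs_qinv_le hc (q + h) z.1) 2
      have h0 : 0 ≤ c₀⁻¹ ^ 2 := by positivity
      linarith
    set f := Frep c₀ (q + h) z.1 z.2 - Frep c₀ q z.1 z.2
    have d1 : |f| ≤ (K + W * K + 3 * B * K) * ‖h‖ := by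
      have t1 : |rep h 2 0 z.1 z.2 - qinv c₀ (q + h) z.1 ^ 2 / 2 * rep h 1 1 z.1 z.2|
          ≤ K * ‖h‖ + W * (K * ‖h‖) := by
        refine (abs_sub _ _).trans (add_le_add k3 ?_)
        rw [abs_mul]; gcongr
      have t2 := abs_sub_abs_le_abs_sub f
        (rep h 2 0 z.1 z.2 - qinv c₀ (q + h) z.1 ^ 2 / 2 * rep h 1 1 z.1 z.2)
      have t3 : B * (|rep h 0 0 z.1 0| + |rep h 0 1 z.1 z.2| + |rep h 1 0 z.1 0|)
          ≤ B * (K * ‖h‖ + K * ‖h‖ + K * ‖h‖) := by gcongr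
      linarith
    have d2 : |f - Lrep c₀ q h z.1 z.2| ≤ (K ^ 2 * B + 3 * B * K ^ 2) * ‖h‖ ^ 2 := by
      have t1 : |rep h 1 1 z.1 z.2 * rep h 0 0 z.1 0 * (qinv c₀ q z.1 * qinv c₀ (q + h) z.1
          * (qinv c₀ q z.1 + qinv c₀ (q + h) z.1) / 2)| ≤ K * ‖h‖ * (K * ‖h‖) * B := by
        rw [abs_mul, abs_mul]; gcongr
      have t2 := abs_sub_abs_le_abs_sub (f - Lrep c₀ q h z.1 z.2)
        (rep h 1 1 z.1 z.2 * rep h 0 0 z.1 0 * (qinv c₀ q z.1 * qinv c₀ (q + h) z.1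
          * (qinv c₀ q z.1 + qinv c₀ (q + h) z.1) / 2))
      have t3 : B * (rep h 0 0 z.1 0 ^ 2 + rep h 0 1 z.1 z.2 ^ 2 + rep h 1 0 z.1 0 ^ 2)
          ≤ B * ((K * ‖h‖) ^ 2 + (K * ‖h‖) ^ 2 + (K * ‖h‖) ^ 2) := by
        have := sqb k0; have := sqb k1; have := sqb k2
        gcongr
      have t4 : (K ^ 2 * B + 3 * B * K ^ 2) * ‖h‖ ^ 2 = K * ‖h‖ * (K * ‖h‖) * B
        + B * ((K * ‖h‖) ^ 2 + (K * ‖h‖) ^ 2 + (K * ‖h‖) ^ 2) := by ring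
      rw [t4]; linarith
    calc ‖f ^ 2 + 2 * Frep c₀ q z.1 z.2 * (f - Lrep c₀ q h z.1 z.2)‖
        ≤ |f| ^ 2 + 2 * |Frep c₀ q z.1 z.2| * |f - Lrep c₀ q h z.1 z.2| := by
          refine (norm_add_le _ _).trans (le_of_eq ?_)
          simp
      _ ≤ ((K + W * K + 3 * B * K) * ‖h‖) ^ 2
          + 2 * B * ((K ^ 2 * B + 3 * B * K ^ 2) * ‖h‖ ^ 2) := by gcongr
      _ = Q * ‖h‖ ^ 2 := by rw [hQ]; ring
  rw [integral_const_mul, ← hw] at hI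
  refine (abs_add_le _ _).trans ?_
  have h2 : |β * ‖h‖ ^ 2| = |β| * ‖h‖ ^ 2 := by rw [abs_mul, abs_of_nonneg (sq_nonneg ‖h‖)]
  rw [h2]
  have := sq_nonneg ‖h‖
  linarith

end Functional

/-! ### The strong convexity inequality -/

section KeyInequality

variable {ε M T c₀ lam α β : ℝ}

/-- Exponential decay beats the linear factor. -/
lemma mul_exp_neg_le_one {b C : ℝ} (hb : 0 < b) (hlam : 0 < lam)
    (h : 2 * C / b ^ 2 ≤ lam) : C * lam * Real.exp (-(b * lam)) ≤ 1 := by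
  rw [Real.exp_neg, ← div_eq_mul_inv, div_le_one (Real.exp_pos _)]
  have h1 := Real.quadratic_le_exp_of_nonneg (mul_pos hb hlam).le
  rw [div_le_iff₀ (by positivity)] at h
  have h2 : C * lam ≤ (b * lam) ^ 2 / 2 := by nlinarith
  have : 0 < b * lam := mul_pos hb hlam
  linarith

/-- Here `Z` is the Taylor remainder of the functional, `Im` the mixed term, `Ik` and `Ir` the
weighted integrals of the squared traces of `h` and `h_x`, `n = ‖h‖²`, `E0 = e^{-2λαT}`, and `PT`
the trace of `h_x` at `t = T`. For `λ ≥ 2 Cc (C₃+1)` the Carleman estimate turns `X/2` into `C₃ + 1`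
copies of the good terms, up to the error at `T`. `C₃` copies pay for the negative terms and one
copy is left, whence the constant `1`. The factor `λ` in front of `P` is available from `hcar`, the
one in front of `Ik` is cancelled by `hIk`. -/
lemma key_combine {B K2L Cc C₃ X Y U P P0 U0 PT Ik Ir Im n Z E0 : ℝ} (hα : 0 < α) (hlam : 1 ≤ lam)
    (hCc : 0 < Cc) (hK2L : 0 ≤ K2L)
    (hC₃ : C₃ = B ^ 2 * (8 + 2 * α + 3 / α) + K2L * (1 + 2 * B ^ 2))
    (hbig : 2 * Cc * (C₃ + 1) ≤ lam)
    (nP : 0 ≤ P) (nY : 0 ≤ Y) (nU : 0 ≤ U) (nP0 : 0 ≤ P0) (nU0 : 0 ≤ U0) (nn : 0 ≤ n)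
    (nE0 : 0 ≤ E0)
    (hZ : X / 2 + 2 * Im - 5 * B ^ 2 * (Ik + Y + Ir) + β * n ≤ Z)
    (hIm : -(E0 * B ^ 2 * K2L * n) - B ^ 2 / 2 * (P0 + U0) - (2 * lam * α + 1) * B ^ 2 / 2 * (P + Ik)
      ≤ Im)
    (hIk : 2 * lam * α * Ik ≤ U0) (hIr : 2 * lam * α * Ir ≤ P0)
    (hcar : lam ^ 2 * (P + Y + U) + lam * (P0 + U0) ≤ Cc * (X + lam * E0 * PT))
    (hPT : PT ≤ K2L * n) (hE0 : C₃ * lam * E0 ≤ β / 2) :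
    P + Y + U + (P0 + U0) + β / 2 * n ≤ Z := by
  have hB2 : 0 ≤ B ^ 2 := sq_nonneg B
  have hα3 : 0 < 3 / α := by positivity
  have hC₃0 : 0 ≤ C₃ := by rw [hC₃]; positivity
  have hlam0 : 0 < lam := by linarith
  have div_bd : ∀ {I V : ℝ}, 0 ≤ V → 2 * lam * α * I ≤ V → 6 * I ≤ 3 / α * V := by
    intro I V hV h
    rw [div_mul_eq_mul_div, le_div_iff₀ hα]
    by_cases hI : 0 ≤ I
    · have : 2 * 1 * α * I ≤ 2 * lam * α * I := by gcongr
      linarith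
    · have : I * α ≤ 0 := mul_nonpos_of_nonpos_of_nonneg (not_le.1 hI).le hα.le
      linarith
  have bk := div_bd nU0 hIk
  have br := div_bd nP0 hIr
  -- the principal part
  have hcar2 : (C₃ + 1) * (lam * (P + Y + U) + (P0 + U0)) ≤ (X + lam * E0 * PT) / 2 := by
    have h1 : 2 * Cc * (C₃ + 1) * (lam * (P + Y + U) + (P0 + U0))
        ≤ lam * (lam * (P + Y + U) + (P0 + U0)) := by gcongr
    have h2 : Cc * ((C₃ + 1) * (lam * (P + Y + U) + (P0 + U0)))
        ≤ Cc * ((X + lam * E0 * PT) / 2) := by linarith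
    exact le_of_mul_le_mul_left h2 hCc
  have hPT2 : lam * E0 * PT ≤ lam * E0 * (K2L * n) := by gcongr
  have hE : C₃ * lam * E0 * n ≤ β / 2 * n := by gcongr
  have l1 : (2 * lam * α + 1) * B ^ 2 * P ≤ lam * (2 * α + 1) * B ^ 2 * P := by
    have : 2 * lam * α + 1 ≤ lam * (2 * α + 1) := by linarith
    gcongr
  have l2 : B ^ 2 * (2 * lam * α * Ik) ≤ B ^ 2 * U0 := by gcongr
  have l3 : B ^ 2 * (6 * Ik) ≤ B ^ 2 * (3 / α * U0) := by gcongr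
  have l4 : B ^ 2 * (6 * Ir) ≤ B ^ 2 * (3 / α * P0) := by gcongr
  have nIr : -(B ^ 2 * (3 / α * P0)) ≤ B ^ 2 * (-5 * Ir) := by
    have : -(3 / α * P0) ≤ -5 * Ir := by
      have : 0 ≤ 3 / α * P0 := by positivity
      linarith
    have := mul_le_mul_of_nonneg_left this hB2
    linarith
  have n1 : E0 * B ^ 2 * K2L * n ≤ lam * (E0 * B ^ 2 * K2L * n) := by
    exact le_mul_of_one_le_left (by positivity) hlam
  -- expand `C₃`
  have x1 : B ^ 2 * (8 + 2 * α + 3 / α) ≤ C₃ := by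
    rw [hC₃]; have : 0 ≤ K2L * (1 + 2 * B ^ 2) := by positivity
    linarith
  have x2 : K2L * (1 + 2 * B ^ 2) ≤ C₃ := by
    rw [hC₃]; have : 0 ≤ B ^ 2 * (8 + 2 * α + 3 / α) := by positivity
    linarith
  have y1 : B ^ 2 * (8 + 2 * α + 3 / α) * (lam * (P + Y + U) + (P0 + U0))
      ≤ C₃ * (lam * (P + Y + U) + (P0 + U0)) := by gcongr
  have y2 : K2L * (1 + 2 * B ^ 2) * (lam * E0 * n) ≤ C₃ * (lam * E0 * n) := by gcongr
  have y3 : P + Y + U ≤ lam * (P + Y + U) := by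
    exact le_mul_of_one_le_left (by positivity) hlam
  have s1 : 0 ≤ B ^ 2 * (lam * Y) := by positivity
  have s1' : B ^ 2 * Y ≤ B ^ 2 * (lam * Y) := by
    have : Y ≤ lam * Y := le_mul_of_one_le_left nY hlam
    gcongr
  have s2 : 0 ≤ B ^ 2 * (lam * U) := by positivity
  have s3 : 0 ≤ B ^ 2 * (lam * P) := by positivity
  have s4 : 0 ≤ B ^ 2 * P0 := by positivity
  have s5 : 0 ≤ B ^ 2 * U0 := by positivity
  have s6 : 0 ≤ B ^ 2 * α * (lam * Y) := by positivity
  have s7 : 0 ≤ B ^ 2 * α * (lam * U) := by positivity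
  have s8 : 0 ≤ B ^ 2 * α * P0 := by positivity
  have s9 : 0 ≤ B ^ 2 * α * U0 := by positivity
  have t1 : 0 ≤ B ^ 2 * (3 / α) * (lam * (P + Y + U)) := by positivity
  have nE : 0 ≤ lam * E0 * (K2L * n) := by positivity
  linarith

/-- From `f² ≥ X²/2 - (f-X)²` and the quadratic bound for the remainder without the mixed term `m`.
The factor `5` is `3` from the square of a sum of three terms plus `2` from the cross product. -/
lemma pointwise_lower_bound {B X f Fq L m k y r : ℝ} (hB : 0 ≤ B) (b1 : |Fq| ≤ B)
    (b2 : |f - X| ≤ B * (|k| + |y| + |r|)) (b3 : |f - L - m| ≤ B * (k ^ 2 + y ^ 2 + r ^ 2)) :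
    X ^ 2 / 2 + 2 * (Fq * m) - 5 * B ^ 2 * (k ^ 2 + y ^ 2 + r ^ 2) ≤ f ^ 2 + 2 * Fq * (f - L) := by
  set n := k ^ 2 + y ^ 2 + r ^ 2 with hn
  have hE : (f - X) ^ 2 ≤ 3 * B ^ 2 * n := by
    have h1 : (f - X) ^ 2 ≤ (B * (|k| + |y| + |r|)) ^ 2 :=
      sq_le_sq' (abs_le.1 b2).1 (abs_le.1 b2).2
    have h2 : (|k| + |y| + |r|) ^ 2 ≤ 3 * n := by
      rw [hn, ← sq_abs k, ← sq_abs y, ← sq_abs r]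
      nlinarith [sq_nonneg (|k| - |y|), sq_nonneg (|y| - |r|), sq_nonneg (|k| - |r|)]
    have h3 := mul_le_mul_of_nonneg_left h2 (sq_nonneg B)
    rw [mul_pow] at h1
    linarith
  have hN : |Fq * (f - L - m)| ≤ B * (B * n) := by
    rw [abs_mul]
    exact mul_le_mul b1 b3 (abs_nonneg _) hB
  have h1 := (abs_le.1 hN).1
  have h2 : X ^ 2 / 2 - (f - X) ^ 2 ≤ f ^ 2 := by nlinarith [sq_nonneg (X + 2 * (f - X))]
  nlinarith

/-- Since `2λα ∫₀ᵀ e^{-2λαt} dt = 1 - e^{-2λαT}` is at most `1`, a function independent of `t` gains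
a factor `1/λ`. This makes the nonlocal traces harmless. -/
lemma setIntegral_weight_trace_le (hε : ε < M) (hT : 0 < T) {k : ℝ → ℝ} (hk : Continuous k) :
    2 * lam * α * ∫ z in rect ε M T, weight lam α z.1 z.2 * k z.1 ^ 2
      ≤ ∫ x in ε..M, Real.exp (-2 * lam * x) * k x ^ 2 := by
  have h := setIntegral_rect_deriv_t hε hT (G := fun z => weight lam α z.1 z.2 * k z.1 ^ 2)
    (g := fun z => -2 * lam * α * weight lam α z.1 z.2 * k z.1 ^ 2) (by fun_prop) (by fun_prop)
    (fun x _ t _ => (hasDerivAt_weight_t x t).mul_const (k x ^ 2))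
  have w1 : ∀ t, Continuous fun x => weight lam α x t := fun t => by unfold weight; fun_prop
  have w2 := w1 T
  have w3 := w1 0
  have h2 : -∫ x in ε..M, Real.exp (-2 * lam * x) * k x ^ 2
      ≤ ∫ x in ε..M, (weight lam α x T * k x ^ 2 - weight lam α x 0 * k x ^ 2) := by
    rw [← intervalIntegral.integral_neg]
    refine intervalIntegral.integral_mono_on hε.le (Continuous.intervalIntegrable (by fun_prop) _ _)
      (Continuous.intervalIntegrable (by fun_prop) _ _) fun x _ => ?_
    have e0 : weight lam α x 0 = Real.exp (-2 * lam * x) := by rw [weight_eq]; simp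
    have := mul_nonneg (weight_pos lam α x T).le (sq_nonneg (k x))
    rw [e0]; linarith
  have h3 : ∫ z in rect ε M T, -2 * lam * α * weight lam α z.1 z.2 * k z.1 ^ 2
      = -(2 * lam * α) * ∫ z in rect ε M T, weight lam α z.1 z.2 * k z.1 ^ 2 := by
    rw [← integral_const_mul]; congr 1; funext z; ring
  rw [h3] at h
  linarith

lemma intervalIntegral_exp_mul_le (h0 : 0 ≤ ε) (hε : ε < M) (hlam : 0 ≤ lam) {k : ℝ → ℝ} {C : ℝ}
    (hk : Continuous k) (h : ∀ x ∈ Icc ε M, k x ≤ C) (hC : 0 ≤ C) :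
    ∫ x in ε..M, Real.exp (-2 * lam * x) * k x ≤ (M - ε) * C := by
  have : ∫ _ in ε..M, C = (M - ε) * C := by simp
  rw [← this]
  refine intervalIntegral.integral_mono_on hε.le (Continuous.intervalIntegrable (by fun_prop) _ _)
    (Continuous.intervalIntegrable (by fun_prop) _ _) fun x hx => ?_
  have h1 : Real.exp (-2 * lam * x) ≤ 1 := by
    rw [Real.exp_le_one_iff]
    have : 0 ≤ lam * x := mul_nonneg hlam (h0.trans hx.1)
    linarith
  calc Real.exp (-2 * lam * x) * k x ≤ Real.exp (-2 * lam * x) * C := by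
        gcongr; exact h x hx
    _ ≤ 1 * C := by gcongr
    _ = C := one_mul C

variable (hε : ε < M) (hT : 0 < T)
include hε hT

/-- Differentiation of the boundary condition along the side, extended to the end points by
continuity. It supplies the boundary value of `h_t` needed for Hardy's inequality. -/
lemma rep_dt_eq_zero {h : H5 ε M T} (h0 : ∀ t ∈ Icc 0 T, rep h 0 0 ε t = 0) :
    ∀ t ∈ Icc 0 T, rep h 0 1 ε t = 0 := by
  have hi : ∀ t ∈ Ioo 0 T, rep h 0 1 ε t = 0 := fun t ht => by
    have h1 := hasDerivAt_rep_t hε hT h (i := 0) (j := 0) (by norm_num) ⟨le_rfl, hε.le⟩ ht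
    have h2 : HasDerivAt (fun s => rep h 0 0 ε s) 0 t := by
      refine (hasDerivAt_const t (0 : ℝ)).congr_of_eventuallyEq ?_
      filter_upwards [Ioo_mem_nhds ht.1 ht.2] with s hs
      exact h0 s (Ioo_subset_Icc_self hs)
    exact h1.unique h2
  have hc : Continuous fun t => rep h 0 1 ε t :=
    (continuous_rep hε hT h 0 1).comp (by fun_prop : Continuous fun t : ℝ => (ε, t))
  have : EqOn (fun t => rep h 0 1 ε t) (fun _ => 0) (closure (Ioo 0 T)) :=
    EqOn.closure hi hc continuous_const
  rw [closure_Ioo hT.ne] at this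
  exact this

lemma hasDerivAt_qinv_sq {q : H5 ε M T} (hc : 0 < c₀) (hq : TraceGE c₀ q) {x : ℝ}
    (hx : x ∈ Ioo ε M) : HasDerivAt (fun x => qinv c₀ q x ^ 2 / 2)
      (-(qinv c₀ q x ^ 3 * rep q 1 0 x 0)) x := by
  have hxm := Ioo_subset_Icc_self hx
  have h1 := hasDerivAt_rep_x hε hT q (i := 0) (j := 0) (by norm_num) hx ⟨le_rfl, hT.le⟩
  have hpos : rep q 0 0 x 0 ≠ 0 := (hc.trans_le (hq x hxm)).ne'
  have h2 := (hasDerivAt_sq (h1.inv hpos)).div_const 2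
  have h3 : HasDerivAt (fun x => (rep q 0 0 x 0)⁻¹ ^ 2 / 2)
      (-(qinv c₀ q x ^ 3 * rep q 1 0 x 0)) x := by
    refine h2.congr_deriv ?_
    rw [qinv_eq hq hxm, Pi.inv_apply]
    field_simp
  refine h3.congr_of_eventuallyEq ?_
  filter_upwards [Ioo_mem_nhds hx.1 hx.2] with s hs
  rw [qinv_eq hq (Ioo_subset_Icc_self hs)]

/-- The Carleman estimate with the coefficient `1 / (2 q²(x,0))`. -/
lemma exists_carleman_H5 (hα : 0 < α) (hc : 0 < c₀) (hαc : α * (c₀⁻¹ ^ 2 / 2) < 1) (R : ℝ) :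
    ∃ C > 0, ∃ lam₀ ≥ (1 : ℝ), ∀ lam ≥ lam₀, ∀ q h : H5 ε M T, ‖q‖ ≤ R → TraceGE c₀ q →
      (∀ t ∈ Icc 0 T, rep h 0 0 ε t = 0) → (∀ t ∈ Icc 0 T, rep h 1 0 ε t = 0) →
      lam ^ 2 * ((∫ z in rect ε M T, weight lam α z.1 z.2 * rep h 1 0 z.1 z.2 ^ 2)
          + (∫ z in rect ε M T, weight lam α z.1 z.2 * rep h 0 1 z.1 z.2 ^ 2)
          + ∫ z in rect ε M T, weight lam α z.1 z.2 * rep h 0 0 z.1 z.2 ^ 2)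
        + lam * ((∫ x in ε..M, Real.exp (-2 * lam * x) * rep h 1 0 x 0 ^ 2)
          + ∫ x in ε..M, Real.exp (-2 * lam * x) * rep h 0 0 x 0 ^ 2)
        ≤ C * ((∫ z in rect ε M T, weight lam α z.1 z.2 *
            (rep h 2 0 z.1 z.2 - qinv c₀ q z.1 ^ 2 / 2 * rep h 1 1 z.1 z.2) ^ 2)
          + lam * Real.exp (-2 * lam * α * T) *
            ∫ x in ε..M, Real.exp (-2 * lam * x) * rep h 1 0 x T ^ 2) := by
  obtain ⟨K, hK0, hK⟩ := exists_abs_rep_le hε hT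
  set B := c₀ + K * |R| with hB
  have hB0 : 0 < B := by positivity
  have hbd : ∀ q : H5 ε M T, ‖q‖ ≤ R → ∀ i j x t, |rep q i j x t| ≤ K * |R| :=
    fun q hq i j x t => (hK q i j x t).trans (by gcongr; exact hq.trans (le_abs_self R))
  -- The coefficient is `a = v²/2` with `1/B ≤ v ≤ 1/c₀`, because `B` dominates both `c₀` and the
  -- trace. Its derivative is `-v³ q_x(x,0)`, which explains `a₂`.
  obtain ⟨C, hC, lam₀, hlam₀, key⟩ := carleman_estimate (α := α) hε hT
    (γ := 1 - α * (c₀⁻¹ ^ 2 / 2)) (a₀ := B⁻¹ ^ 2 / 2) (a₁ := c₀⁻¹ ^ 2 / 2)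
    (a₂ := c₀⁻¹ ^ 3 * (K * |R|)) (by linarith) (by positivity) (by positivity)
  refine ⟨C, hC, lam₀, hlam₀, fun lam hlam q h hq tq z1 z2 => ?_⟩
  have cq := continuous_qinv hε hT hc q
  have cr := continuous_rep_trace hε hT q 1 0 0
  have vpos : ∀ x, 0 < qinv c₀ q x := fun x => inv_pos.2 (lt_max_of_lt_left hc)
  have vle : ∀ x, qinv c₀ q x ≤ c₀⁻¹ := fun x => (le_abs_self _).trans (abs_qinv_le hc q x)
  have vle2 : ∀ x, qinv c₀ q x ^ 2 / 2 ≤ c₀⁻¹ ^ 2 / 2 := fun x => by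
    have := pow_le_pow_left₀ (vpos x).le (vle x) 2
    linarith
  refine key lam hlam (fun x => qinv c₀ q x ^ 2 / 2) (fun x => -(qinv c₀ q x ^ 3 * rep q 1 0 x 0))
    (rep h 0 0) (rep h 1 0) (rep h 0 1) (rep h 2 0) (rep h 1 1) (by fun_prop) (by fun_prop)
    (fun x hx => hasDerivAt_qinv_sq hε hT hc tq hx) (fun x hx => ?_) (fun x _ => vle2 x)
    (fun x hx => ?_) (fun x _ => ?_) (continuous_rep hε hT h _ _) (continuous_rep hε hT h _ _)
    (continuous_rep hε hT h _ _) (continuous_rep hε hT h _ _) (continuous_rep hε hT h _ _)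
    (fun x hx t ht => hasDerivAt_rep_x hε hT h (by norm_num) hx ht)
    (fun x hx t ht => hasDerivAt_rep_x hε hT h (by norm_num) hx ht)
    (fun x hx t ht => hasDerivAt_rep_t hε hT h (by norm_num) hx ht)
    (fun x hx t ht => hasDerivAt_rep_x hε hT h (by norm_num) hx ht) z1 z2
    (rep_dt_eq_zero hε hT z1)
  · have h1 : B⁻¹ ≤ qinv c₀ q x := by
      refine inv_anti₀ (lt_max_of_lt_left hc) (max_le ?_ ?_)
      · rw [hB]; exact le_add_of_nonneg_right (by positivity)
      · have := (abs_le.1 (hbd q hq 0 0 x 0)).2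
        linarith
    have := pow_le_pow_left₀ (inv_pos.2 hB0).le h1 2
    linarith
  · rw [abs_neg, abs_mul, abs_pow]
    have h1 := abs_qinv_le hc q x
    have h2 := hbd q hq 1 0 x 0
    gcongr
  · have := mul_le_mul_of_nonneg_left (vle2 x) hα.le
    linarith

/-- Integration by parts in time for the term with the mixed derivative of `h`. -/
lemma mixed_term_ge (h0 : 0 ≤ ε) (hα : 0 < α) (hlam : 0 ≤ lam) {B N : ℝ} (hB0 : 0 ≤ B)
    {Fq Fqt p pt : ℝ → ℝ → ℝ} {k μ : ℝ → ℝ}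
    (cF : Continuous fun z : ℝ × ℝ => Fq z.1 z.2) (cFt : Continuous fun z : ℝ × ℝ => Fqt z.1 z.2)
    (cp : Continuous fun z : ℝ × ℝ => p z.1 z.2) (cpt : Continuous fun z : ℝ × ℝ => pt z.1 z.2)
    (ck : Continuous k) (cμ : Continuous μ)
    (dF : ∀ x ∈ Icc ε M, ∀ t ∈ Ioo 0 T, HasDerivAt (fun s => Fq x s) (Fqt x t) t)
    (dp : ∀ x ∈ Icc ε M, ∀ t ∈ Ioo 0 T, HasDerivAt (fun s => p x s) (pt x t) t)
    (bF : ∀ x ∈ Icc ε M, ∀ t, |Fq x t| ≤ B) (bFt : ∀ x ∈ Icc ε M, ∀ t, |Fqt x t| ≤ B)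
    (bμ : ∀ x ∈ Icc ε M, |μ x| ≤ B) (bp : ∀ x, |p x T| ≤ N) (bk : ∀ x, |k x| ≤ N) :
    -(Real.exp (-2 * lam * α * T) * B ^ 2 * ((M - ε) * N ^ 2))
      - B ^ 2 / 2 * ((∫ x in ε..M, Real.exp (-2 * lam * x) * p x 0 ^ 2)
        + ∫ x in ε..M, Real.exp (-2 * lam * x) * k x ^ 2)
      - (2 * lam * α + 1) * B ^ 2 / 2 *
        ((∫ z in rect ε M T, weight lam α z.1 z.2 * p z.1 z.2 ^ 2)
          + ∫ z in rect ε M T, weight lam α z.1 z.2 * k z.1 ^ 2)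
      ≤ ∫ z in rect ε M T, weight lam α z.1 z.2 *
        (Fq z.1 z.2 * (pt z.1 z.2 * k z.1 * μ z.1)) := by
  have slice : ∀ {k : ℝ → ℝ → ℝ}, Continuous (fun z : ℝ × ℝ => k z.1 z.2) → ∀ t,
      Continuous fun x => k x t := fun hk t => hk.comp (by fun_prop : Continuous fun x : ℝ => (x, t))
  have sF0 := slice cF 0
  have sFT := slice cF T
  have sp0 := slice cp 0
  have spT := slice cp T
  have sw0 : Continuous fun x => weight lam α x 0 := by unfold weight; fun_prop
  have swT : Continuous fun x => weight lam α x T := by unfold weight; fun_prop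
  have hN : 0 ≤ N := (abs_nonneg _).trans (bk 0)
  have hibp := setIntegral_rect_deriv_t hε hT
    (G := fun z => weight lam α z.1 z.2 * (Fq z.1 z.2 * p z.1 z.2) * (k z.1 * μ z.1))
    (g := fun z => (-2 * lam * α * weight lam α z.1 z.2 * (Fq z.1 z.2 * p z.1 z.2)
      + weight lam α z.1 z.2 * (Fqt z.1 z.2 * p z.1 z.2 + Fq z.1 z.2 * pt z.1 z.2))
        * (k z.1 * μ z.1)) (by fun_prop) (by fun_prop)
    (fun x hx t ht => ((hasDerivAt_weight_t x t).mul ((dF x hx t ht).mul (dp x hx t ht))).mul_const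
      (k x * μ x))
  -- Since `kμ` is independent of `t`, the derivative of `h_x` is moved onto the weight and onto
  -- `Fq`. The former costs a factor `2λα`, the latter a bounded one.
  have e1 : ∫ z in rect ε M T, weight lam α z.1 z.2 * (Fq z.1 z.2 * (pt z.1 z.2 * k z.1 * μ z.1))
      = (∫ z in rect ε M T, (-2 * lam * α * weight lam α z.1 z.2 * (Fq z.1 z.2 * p z.1 z.2)
      + weight lam α z.1 z.2 * (Fqt z.1 z.2 * p z.1 z.2 + Fq z.1 z.2 * pt z.1 z.2))
        * (k z.1 * μ z.1)) + ∫ z in rect ε M T, weight lam α z.1 z.2 *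
        ((2 * lam * α * Fq z.1 z.2 - Fqt z.1 z.2) * (p z.1 z.2 * k z.1) * μ z.1) := by
    rw [← integral_add (Continuous.integrableOn_rect (by fun_prop))
      (Continuous.integrableOn_rect (by fun_prop))]
    congr 1; funext z; ring
  have e2 : -((2 * lam * α + 1) * B ^ 2 / 2 *
        ((∫ z in rect ε M T, weight lam α z.1 z.2 * p z.1 z.2 ^ 2)
          + ∫ z in rect ε M T, weight lam α z.1 z.2 * k z.1 ^ 2))
      ≤ ∫ z in rect ε M T, weight lam α z.1 z.2 *
        ((2 * lam * α * Fq z.1 z.2 - Fqt z.1 z.2) * (p z.1 z.2 * k z.1) * μ z.1) := by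
    rw [← integral_add (Continuous.integrableOn_rect (by fun_prop))
      (Continuous.integrableOn_rect (by fun_prop)), ← integral_const_mul, ← integral_neg]
    refine setIntegral_rect_mono (by fun_prop) (by fun_prop) fun z hz => ?_
    have hx := Ioo_subset_Icc_self hz.1
    have hw := (weight_pos lam α z.1 z.2).le
    have hla : 0 ≤ 2 * lam * α := by positivity
    have b1 : |2 * lam * α * Fq z.1 z.2 - Fqt z.1 z.2| ≤ (2 * lam * α + 1) * B := by
      refine (abs_sub _ _).trans ?_
      rw [abs_mul, abs_of_nonneg hla, add_mul, one_mul]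
      exact add_le_add (mul_le_mul_of_nonneg_left (bF _ hx _) hla) (bFt _ hx _)
    have b2 : |(2 * lam * α * Fq z.1 z.2 - Fqt z.1 z.2) * (p z.1 z.2 * k z.1) * μ z.1|
        ≤ (2 * lam * α + 1) * B * ((p z.1 z.2 ^ 2 + k z.1 ^ 2) / 2) * B := by
      rw [abs_mul, abs_mul, abs_mul (p z.1 z.2)]
      have := abs_mul_abs_le (p z.1 z.2) (k z.1)
      have := bμ _ hx
      gcongr
    have b3 := mul_le_mul_of_nonneg_left ((abs_le.1 b2).1) hw
    linarith
  -- At `t = T` the sup bound `N` suffices, since the weight provides `e^{-2λαT}`. At `t = 0` there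
  -- is no such factor, and Young's inequality leaves the traces that the Carleman estimate
  -- controls.
  have e3 : -(Real.exp (-2 * lam * α * T) * B ^ 2 * ((M - ε) * N ^ 2))
      - B ^ 2 / 2 * ((∫ x in ε..M, Real.exp (-2 * lam * x) * p x 0 ^ 2)
        + ∫ x in ε..M, Real.exp (-2 * lam * x) * k x ^ 2)
      ≤ ∫ x in ε..M, (weight lam α x T * (Fq x T * p x T) * (k x * μ x)
        - weight lam α x 0 * (Fq x 0 * p x 0) * (k x * μ x)) := by
    have c1 : ∫ x in ε..M, Real.exp (-2 * lam * x) * (fun _ => N ^ 2) x ≤ (M - ε) * N ^ 2 :=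
      intervalIntegral_exp_mul_le h0 hε hlam continuous_const (fun _ _ => le_rfl) (by positivity)
    have c2 : Real.exp (-2 * lam * α * T) * B ^ 2 * (∫ x in ε..M, Real.exp (-2 * lam * x) * N ^ 2)
        ≤ Real.exp (-2 * lam * α * T) * B ^ 2 * ((M - ε) * N ^ 2) := by gcongr
    have c3 : -(Real.exp (-2 * lam * α * T) * B ^ 2
          * (∫ x in ε..M, Real.exp (-2 * lam * x) * N ^ 2))
        - B ^ 2 / 2 * ((∫ x in ε..M, Real.exp (-2 * lam * x) * p x 0 ^ 2)
        + ∫ x in ε..M, Real.exp (-2 * lam * x) * k x ^ 2)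
        = ∫ x in ε..M, (-(Real.exp (-2 * lam * α * T) * B ^ 2 * (Real.exp (-2 * lam * x) * N ^ 2))
          - B ^ 2 / 2 * (Real.exp (-2 * lam * x) * p x 0 ^ 2
          + Real.exp (-2 * lam * x) * k x ^ 2)) := by
      rw [intervalIntegral.integral_sub (Continuous.intervalIntegrable (by fun_prop) _ _)
        (Continuous.intervalIntegrable (by fun_prop) _ _), intervalIntegral.integral_neg,
        intervalIntegral.integral_const_mul, intervalIntegral.integral_const_mul,
        intervalIntegral.integral_add (Continuous.intervalIntegrable (by fun_prop) _ _)
        (Continuous.intervalIntegrable (by fun_prop) _ _)]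
    have c4 : ∫ x in ε..M, (-(Real.exp (-2 * lam * α * T) * B ^ 2 * (Real.exp (-2 * lam * x) * N ^ 2))
          - B ^ 2 / 2 * (Real.exp (-2 * lam * x) * p x 0 ^ 2
          + Real.exp (-2 * lam * x) * k x ^ 2))
        ≤ ∫ x in ε..M, (weight lam α x T * (Fq x T * p x T) * (k x * μ x)
        - weight lam α x 0 * (Fq x 0 * p x 0) * (k x * μ x)) := by
      refine intervalIntegral.integral_mono_on hε.le
        (Continuous.intervalIntegrable (by fun_prop) _ _)
        (Continuous.intervalIntegrable (by fun_prop) _ _) fun x hx => ?_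
      have e0 : weight lam α x 0 = Real.exp (-2 * lam * x) := by rw [weight_eq]; simp
      rw [e0, weight_eq]
      have hw := (Real.exp_pos (-2 * lam * x)).le
      have hw2 := mul_nonneg hw (Real.exp_pos (-2 * lam * α * T)).le
      have b1 : |Fq x T * p x T * (k x * μ x)| ≤ B * N * (N * B) := by
        rw [abs_mul, abs_mul, abs_mul]
        have := bF x hx T; have := bp x; have := bk x; have := bμ x hx
        gcongr
      have b2 : |Fq x 0 * (p x 0 * k x) * μ x| ≤ B * ((p x 0 ^ 2 + k x ^ 2) / 2) * B := by
        rw [abs_mul, abs_mul, abs_mul (p x 0)]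
        have := bF x hx 0; have := abs_mul_abs_le (p x 0) (k x); have := bμ x hx
        gcongr
      have b3 := mul_le_mul_of_nonneg_left ((abs_le.1 b1).1) hw2
      have b4 := mul_le_mul_of_nonneg_left ((abs_le.1 b2).2) hw
      linarith
    linarith
  rw [e1, hibp]
  linarith

/-- The strong convexity inequality for `J` on bounded sets of functions with common boundary
data. -/
lemma exists_convexity_inequality (h0 : 0 ≤ ε) (hα : 0 < α) (hc : 0 < c₀)
    (hαc : α * (c₀⁻¹ ^ 2 / 2) < 1) (R : ℝ) :
    ∃ lam₁ ≥ (1 : ℝ), ∀ lam ≥ lam₁, ∀ β ≥ 2 * Real.exp (-lam * α * T), ∀ q h : H5 ε M T,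
      ‖q‖ ≤ R → ‖q + h‖ ≤ R → TraceGE c₀ q → TraceGE c₀ (q + h) →
      (∀ t ∈ Icc 0 T, rep h 0 0 ε t = 0) → (∀ t ∈ Icc 0 T, rep h 1 0 ε t = 0) →
      (∫ z in rect ε M T, weight lam α z.1 z.2 * rep h 1 0 z.1 z.2 ^ 2)
          + (∫ z in rect ε M T, weight lam α z.1 z.2 * rep h 0 1 z.1 z.2 ^ 2)
          + (∫ z in rect ε M T, weight lam α z.1 z.2 * rep h 0 0 z.1 z.2 ^ 2)
        + ((∫ x in ε..M, Real.exp (-2 * lam * x) * rep h 1 0 x 0 ^ 2)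
          + ∫ x in ε..M, Real.exp (-2 * lam * x) * rep h 0 0 x 0 ^ 2)
        + β / 2 * ‖h‖ ^ 2 ≤ J lam α β (q + h) - J lam α β q - dJ lam α β c₀ q h := by
  obtain ⟨K, hK0, hK⟩ := exists_abs_rep_le hε hT
  obtain ⟨B, hB0, hB⟩ := exists_abs_Frep_sub_le hε hT hc R
  obtain ⟨Cc, hCc, lam₀, hlam₀, hcar⟩ := exists_carleman_H5 hε hT hα hc hαc R
  set K2L := (M - ε) * K ^ 2 with hK2L
  have hK2L0 : 0 ≤ K2L := mul_nonneg (by linarith) (sq_nonneg K)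
  set C₃ := B ^ 2 * (8 + 2 * α + 3 / α) + K2L * (1 + 2 * B ^ 2) with hC₃
  have hC₃0 : 0 ≤ C₃ := by positivity
  -- The three thresholds are for the Carleman estimate, for the absorption of the negative terms,
  -- and for the exponential to beat `C₃ λ`.
  refine ⟨max lam₀ (max (2 * Cc * (C₃ + 1)) (2 * C₃ / (α * T) ^ 2)), le_max_of_le_left hlam₀,
    fun lam hlam β hβ q h hq hqh tq tqh z1 z2 => ?_⟩
  have hl1 : lam₀ ≤ lam := (le_max_left _ _).trans hlam
  have hl2 : 2 * Cc * (C₃ + 1) ≤ lam := ((le_max_left _ _).trans (le_max_right _ _)).trans hlam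
  have hl3 : 2 * C₃ / (α * T) ^ 2 ≤ lam := ((le_max_right _ _).trans (le_max_right _ _)).trans hlam
  have hlam1 : 1 ≤ lam := le_trans hlam₀ hl1
  have hlam0 : 0 < lam := by linarith
  have cF := continuous_Frep hε hT hc q
  have cF' := continuous_Frep hε hT hc (q + h)
  have cL := continuous_Lrep hε hT hc q h
  have cv := continuous_qinv hε hT hc q
  have cv' := continuous_qinv hε hT hc (q + h)
  have ch := continuous_rep_trace hε hT h 0 0 0
  have chx0 := continuous_rep_trace hε hT h 1 0 0
  have chx := continuous_rep hε hT h 1 0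
  have cht := continuous_rep hε hT h 0 1
  have chxx := continuous_rep hε hT h 2 0
  have chxt := continuous_rep hε hT h 1 1
  set μ : ℝ → ℝ := fun x =>
    qinv c₀ q x * qinv c₀ (q + h) x * (qinv c₀ q x + qinv c₀ (q + h) x) / 2 with hμ
  have cμ : Continuous μ := by fun_prop
  have hbd := hB q h hq hqh tq tqh
  have cFt : Continuous fun z : ℝ × ℝ => Fval (rep q 2 1 z.1 z.2) (rep q 1 2 z.1 z.2)
      (rep q 0 2 z.1 z.2) (rep q 1 0 z.1 0) (qinv c₀ q z.1) := by
    have h1 := continuous_rep hε hT q 2 1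
    have h2 := continuous_rep hε hT q 1 2
    have h3 := continuous_rep hε hT q 0 2
    have h4 := continuous_rep_trace hε hT q 1 0 0
    unfold Fval
    fun_prop
  have hIm := mixed_term_ge hε hT h0 hα hlam0.le hB0.le (N := K * ‖h‖) (Fq := Frep c₀ q)
    (Fqt := fun x t => Fval (rep q 2 1 x t) (rep q 1 2 x t) (rep q 0 2 x t) (rep q 1 0 x 0)
      (qinv c₀ q x)) (p := rep h 1 0) (pt := rep h 1 1) (k := fun x => rep h 0 0 x 0) (μ := μ)
    cF cFt chx chxt ch cμ
    (fun x hx t ht => by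
      have h1 := hasDerivAt_rep_t hε hT q (i := 2) (j := 0) (by norm_num) hx ht
      have h2 := hasDerivAt_rep_t hε hT q (i := 1) (j := 1) (by norm_num) hx ht
      have h3 := hasDerivAt_rep_t hε hT q (i := 0) (j := 1) (by norm_num) hx ht
      exact (h1.sub ((h2.mul_const _).div_const 2)).add
        (((h3.mul_const _).mul_const _).div_const 2))
    (fun x hx t ht => hasDerivAt_rep_t hε hT h (by norm_num) hx ht)
    (fun x hx t => (hbd x hx t).1) (fun x hx t => (hbd x hx t).2.2.2.2)
    (fun x hx => (hbd x hx 0).2.2.2.1) (fun x => hK h _ _ _ _) (fun x => hK h _ _ _ _)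
  have hIk := setIntegral_weight_trace_le (lam := lam) (α := α) hε hT ch
  have hIr := setIntegral_weight_trace_le (lam := lam) (α := α) hε hT chx0
  -- The coefficient belongs to `q + h`, not to `q`, in accordance with the form of the principal
  -- part of the increment.
  have hcarl := hcar lam hl1 (q + h) h hqh tqh z1 z2
  have hPT : ∫ x in ε..M, Real.exp (-2 * lam * x) * rep h 1 0 x T ^ 2 ≤ K2L * ‖h‖ ^ 2 := by
    have := intervalIntegral_exp_mul_le (lam := lam) (k := fun x => rep h 1 0 x T ^ 2)
      (C := (K * ‖h‖) ^ 2) h0 hε hlam0.le ((continuous_rep_trace hε hT h 1 0 T).pow 2)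
      (fun x _ => sq_le_sq' (abs_le.1 (hK h 1 0 x T)).1 (abs_le.1 (hK h 1 0 x T)).2) (sq_nonneg _)
    refine this.trans (le_of_eq ?_)
    rw [hK2L]; ring
  -- One factor `e^{-λαT}` of `e^{-2λαT}` absorbs `C₃ λ`; the other is at most `β/2`.
  have hE0 : C₃ * lam * Real.exp (-2 * lam * α * T) ≤ β / 2 := by
    have h1 := mul_exp_neg_le_one (mul_pos hα hT) hlam0 hl3
    have h2 : Real.exp (-2 * lam * α * T)
        = Real.exp (-(α * T * lam)) * Real.exp (-lam * α * T) := by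
      rw [← Real.exp_add]; congr 1; ring
    have h3 := mul_le_mul_of_nonneg_right h1 (Real.exp_pos (-lam * α * T)).le
    rw [h2]; linarith
  have hZ : (∫ z in rect ε M T, weight lam α z.1 z.2 *
        (rep h 2 0 z.1 z.2 - qinv c₀ (q + h) z.1 ^ 2 / 2 * rep h 1 1 z.1 z.2) ^ 2) / 2
      + 2 * (∫ z in rect ε M T, weight lam α z.1 z.2 *
        (Frep c₀ q z.1 z.2 * (rep h 1 1 z.1 z.2 * rep h 0 0 z.1 0 * μ z.1)))
      - 5 * B ^ 2 * ((∫ z in rect ε M T, weight lam α z.1 z.2 * rep h 0 0 z.1 0 ^ 2)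
        + (∫ z in rect ε M T, weight lam α z.1 z.2 * rep h 0 1 z.1 z.2 ^ 2)
        + ∫ z in rect ε M T, weight lam α z.1 z.2 * rep h 1 0 z.1 0 ^ 2) + β * ‖h‖ ^ 2
      ≤ J lam α β (q + h) - J lam α β q - dJ lam α β c₀ q h := by
    rw [J_sub_eq hε hT hc tq tqh]
    refine add_le_add ?_ le_rfl
    have hsum : (∫ z in rect ε M T, weight lam α z.1 z.2 * rep h 0 0 z.1 0 ^ 2)
        + (∫ z in rect ε M T, weight lam α z.1 z.2 * rep h 0 1 z.1 z.2 ^ 2)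
        + (∫ z in rect ε M T, weight lam α z.1 z.2 * rep h 1 0 z.1 0 ^ 2)
        = ∫ z in rect ε M T, (weight lam α z.1 z.2 * rep h 0 0 z.1 0 ^ 2
          + weight lam α z.1 z.2 * rep h 0 1 z.1 z.2 ^ 2
          + weight lam α z.1 z.2 * rep h 1 0 z.1 0 ^ 2) := by
      rw [integral_add (Continuous.integrableOn_rect (by fun_prop))
        (Continuous.integrableOn_rect (by fun_prop)),
        integral_add (Continuous.integrableOn_rect (by fun_prop))
        (Continuous.integrableOn_rect (by fun_prop))]
    rw [hsum, ← integral_const_mul, ← integral_const_mul, ← integral_div,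
      ← integral_add (Continuous.integrableOn_rect (by fun_prop))
        (Continuous.integrableOn_rect (by fun_prop)),
      ← integral_sub (Continuous.integrableOn_rect (by fun_prop))
        (Continuous.integrableOn_rect (by fun_prop))]
    refine setIntegral_rect_mono (by fun_prop) (by fun_prop) fun z hz => ?_
    obtain ⟨b1, b2, b3, -, -⟩ := hbd z.1 (Ioo_subset_Icc_self hz.1) z.2
    have hw := (weight_pos lam α z.1 z.2).le
    have key : (rep h 2 0 z.1 z.2 - qinv c₀ (q + h) z.1 ^ 2 / 2 * rep h 1 1 z.1 z.2) ^ 2 / 2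
        + 2 * (Frep c₀ q z.1 z.2 * (rep h 1 1 z.1 z.2 * rep h 0 0 z.1 0 * μ z.1))
        - 5 * B ^ 2 * (rep h 0 0 z.1 0 ^ 2 + rep h 0 1 z.1 z.2 ^ 2 + rep h 1 0 z.1 0 ^ 2)
        ≤ (Frep c₀ (q + h) z.1 z.2 - Frep c₀ q z.1 z.2) ^ 2 + 2 * Frep c₀ q z.1 z.2 *
          (Frep c₀ (q + h) z.1 z.2 - Frep c₀ q z.1 z.2 - Lrep c₀ q h z.1 z.2) :=
      pointwise_lower_bound hB0.le b1 b2 b3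
    have := mul_le_mul_of_nonneg_left key hw
    linarith
  refine key_combine hα hlam1 hCc hK2L0 hC₃ hl2 ?_ ?_ ?_ ?_ ?_ (sq_nonneg ‖h‖)
    (Real.exp_pos (-2 * lam * α * T)).le hZ (le_trans (le_of_eq ?_) hIm) hIk hIr hcarl hPT hE0
  · exact integral_nonneg fun z => mul_nonneg (weight_pos _ _ _ _).le (sq_nonneg _)
  · exact integral_nonneg fun z => mul_nonneg (weight_pos _ _ _ _).le (sq_nonneg _)
  · exact integral_nonneg fun z => mul_nonneg (weight_pos _ _ _ _).le (sq_nonneg _)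
  · exact intervalIntegral.integral_nonneg hε.le fun x _ => by positivity
  · exact intervalIntegral.integral_nonneg hε.le fun x _ => by positivity
  · rw [hK2L]; ring

end KeyInequality

/-- Riesz representation on a closed subspace. -/
lemma exists_inner_eq_of_isClosed {E : Type*} [NormedAddCommGroup E] [InnerProductSpace ℝ E]
    [CompleteSpace E] {S : Set E} (hS : IsClosed S) (zero : (0 : E) ∈ S)
    (add : ∀ x ∈ S, ∀ y ∈ S, x + y ∈ S) (smul : ∀ (c : ℝ), ∀ x ∈ S, c • x ∈ S) {f : E → ℝ} {C : ℝ}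
    (f_add : ∀ x y, f (x + y) = f x + f y) (f_smul : ∀ (c : ℝ) x, f (c • x) = c * f x)
    (f_le : ∀ x, |f x| ≤ C * ‖x‖) : ∃ G ∈ S, ∀ h ∈ S, inner ℝ G h = f h := by
  let V : Submodule ℝ E :=
    { carrier := S
      zero_mem' := zero
      add_mem' := fun hx hy => add _ hx _ hy
      smul_mem' := fun c _ hx => smul c _ hx }
  have : CompleteSpace V := hS.completeSpace_coe
  let L : E →ₗ[ℝ] ℝ := { toFun := f, map_add' := f_add, map_smul' := f_smul }
  let L' : E →L[ℝ] ℝ := L.mkContinuous C f_le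
  let G : V := (InnerProductSpace.toDual ℝ V).symm (L'.comp V.subtypeL)
  exact ⟨G.1, G.2, fun h hh => InnerProductSpace.toDual_symm_apply (𝕜 := ℝ) (x := (⟨h, hh⟩ : V))
    (y := L'.comp V.subtypeL)⟩

/-! ### Completeness of the Sobolev space -/

section Completeness

variable {Ω : Set (ℝ × ℝ)}

lemma IsTest.memLp {φ : ℝ × ℝ → ℝ} (h : IsTest Ω φ) :
    MemLp φ 2 ((volume : Measure (ℝ × ℝ)).restrict Ω) :=
  (h.1.continuous.memLp_of_hasCompactSupport h.2.1).restrict Ω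

lemma continuous_integral_mul_test {φ : ℝ × ℝ → ℝ} (h : IsTest Ω φ) :
    Continuous fun u : L2 Ω => ∫ p in Ω, u p * φ p := by
  have e : (fun u : L2 Ω => ∫ p in Ω, u p * φ p) = fun u => inner ℝ u (h.memLp.toLp φ) := by
    funext u
    rw [L2.inner_def]
    refine integral_congr_ae ?_
    filter_upwards [h.memLp.coeFn_toLp] with p hp
    rw [hp]
    simp [mul_comm]
  rw [e]
  fun_prop

/-- For a fixed test function the defining identity is continuous in the tuple, because pairing with
a test function is an `L²` inner product. Completeness is used for the Riesz theorem and for the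
existence of minimizers. -/
lemma isClosed_sobolev (k : ℕ) (Ω : Set (ℝ × ℝ)) :
    IsClosed (sobolev k Ω : Set (PiLp 2 (fun _ : MIdx k => L2 Ω))) := by
  have e : (sobolev k Ω : Set (PiLp 2 (fun _ : MIdx k => L2 Ω)))
      = ⋂ (a : MIdx k) (φ : ℝ × ℝ → ℝ) (_ : IsTest Ω φ),
        {u | ∫ p in Ω, u (MIdx.zero k) p * mixedDeriv a.1.1 a.1.2 φ p
          = (-1) ^ (a.1.1.val + a.1.2.val) * ∫ p in Ω, u a p * φ p} := by
    ext u
    simp only [mem_iInter]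
    rfl
  rw [e]
  refine isClosed_iInter fun a => isClosed_iInter fun φ => isClosed_iInter fun hφ => ?_
  exact isClosed_eq ((continuous_integral_mul_test (hφ.mixedDeriv _ _)).comp
    (PiLp.continuous_apply 2 _ _))
    (continuous_const.mul ((continuous_integral_mul_test hφ).comp (PiLp.continuous_apply 2 _ _)))

instance (k : ℕ) (Ω : Set (ℝ × ℝ)) : CompleteSpace (sobolev k Ω) :=
  (isClosed_sobolev k Ω).completeSpace_coe

end Completeness

/-! ### Closedness and convexity of the constraint sets -/

section Spaces

variable {ε M T c₀ cbar R lam α β : ℝ} (hε : ε < M) (hT : 0 < T)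
include hε hT

/-- Point evaluations are bounded linear functionals on `H⁵`. Hence sets described by boundary
values and trace bounds are closed. -/
lemma continuous_rep_apply (i j : ℕ) (x t : ℝ) : Continuous fun q : H5 ε M T => rep q i j x t := by
  obtain ⟨K, -, hK⟩ := exists_abs_rep_le hε hT
  let L : H5 ε M T →ₗ[ℝ] ℝ :=
    { toFun := fun q => rep q i j x t
      map_add' := fun q h => rep_add hε hT q h i j x t
      map_smul' := fun c q => rep_smul c q i j x t }
  exact (L.mkContinuous K fun q => hK q i j x t).continuous

lemma mem_H0_iff (h : H5 ε M T) : h ∈ H0 ε M T ↔ ∀ t ∈ Icc 0 T,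
    rep h 0 0 ε t = 0 ∧ rep h 1 0 ε t = 0 ∧ rep h 1 0 M t = 0 := by
  refine forall₂_congr fun t ht => ?_
  rw [D_eq_rep hε hT h (by norm_num) ⟨le_rfl, hε.le⟩ ht,
    D_eq_rep hε hT h (by norm_num) ⟨le_rfl, hε.le⟩ ht,
    D_eq_rep hε hT h (by norm_num) ⟨hε.le, le_rfl⟩ ht]

/-- `H₀` as a submodule. -/
def H0sub : Submodule ℝ (H5 ε M T) where
  carrier := H0 ε M T
  zero_mem' := by
    rw [mem_H0_iff hε hT]
    have h0 : ∀ i j x t, rep (0 : H5 ε M T) i j x t = 0 := fun i j x t => by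
      rw [← zero_smul ℝ (0 : H5 ε M T), rep_smul, zero_mul]
    intro t _
    simp [h0]
  add_mem' := by
    intro u v hu hv
    rw [mem_H0_iff hε hT] at *
    intro t ht
    obtain ⟨u1, u2, u3⟩ := hu t ht
    obtain ⟨v1, v2, v3⟩ := hv t ht
    rw [rep_add hε hT, rep_add hε hT, rep_add hε hT, u1, u2, u3, v1, v2, v3]
    simp
  smul_mem' := by
    intro c u hu
    rw [mem_H0_iff hε hT] at *
    intro t ht
    obtain ⟨u1, u2, u3⟩ := hu t ht
    rw [rep_smul, rep_smul, rep_smul, u1, u2, u3]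
    simp

lemma isClosed_H0 : IsClosed (H0 ε M T) := by
  have e : H0 ε M T = ⋂ t ∈ Icc 0 T, ({h | rep h 0 0 ε t = 0} ∩ ({h | rep h 1 0 ε t = 0} ∩
      {h | rep h 1 0 M t = 0})) := by
    ext h
    rw [mem_H0_iff hε hT]
    simp only [mem_iInter]
    rfl
  rw [e]
  exact isClosed_biInter fun t _ =>
    (isClosed_eq (continuous_rep_apply hε hT _ _ _ _) continuous_const).inter
      ((isClosed_eq (continuous_rep_apply hε hT _ _ _ _) continuous_const).inter
        (isClosed_eq (continuous_rep_apply hε hT _ _ _ _) continuous_const))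

lemma mem_admissible_iff (g₀ g₁ : ℝ → ℝ) (q : H5 ε M T) : q ∈ admissible ε M T cbar g₀ g₁ ↔
    (∀ t ∈ Icc 0 T, rep q 0 0 ε t = g₀ (t + ε) ∧
      rep q 1 0 ε t = g₁ (t + ε) + derivWithin g₀ (Icc ε (T + ε)) (t + ε) ∧ rep q 1 0 M t = 0) ∧
    TraceGE (1 / (2 * cbar ^ (1 / 4 : ℝ))) q := by
  refine and_congr (forall₂_congr fun t ht => ?_) (forall₂_congr fun x hx => ?_)
  · rw [D_eq_rep hε hT q (by norm_num) ⟨le_rfl, hε.le⟩ ht,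
      D_eq_rep hε hT q (by norm_num) ⟨le_rfl, hε.le⟩ ht,
      D_eq_rep hε hT q (by norm_num) ⟨hε.le, le_rfl⟩ ht]
  · rw [D_eq_rep hε hT q (by norm_num) hx ⟨le_rfl, hT.le⟩]

lemma isClosed_admissible (g₀ g₁ : ℝ → ℝ) : IsClosed (admissible ε M T cbar g₀ g₁) := by
  have e : admissible ε M T cbar g₀ g₁ =
      (⋂ t ∈ Icc 0 T, ({q | rep q 0 0 ε t = g₀ (t + ε)} ∩
        ({q | rep q 1 0 ε t = g₁ (t + ε) + derivWithin g₀ (Icc ε (T + ε)) (t + ε)} ∩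
          {q | rep q 1 0 M t = 0}))) ∩
      ⋂ x ∈ Icc ε M, {q | 1 / (2 * cbar ^ (1 / 4 : ℝ)) ≤ rep q 0 0 x 0} := by
    ext q
    rw [mem_admissible_iff hε hT]
    simp only [mem_inter_iff, mem_iInter]
    rfl
  rw [e]
  refine (isClosed_biInter fun t _ => ?_).inter (isClosed_biInter fun x _ => ?_)
  · exact (isClosed_eq (continuous_rep_apply hε hT _ _ _ _) continuous_const).inter
      ((isClosed_eq (continuous_rep_apply hε hT _ _ _ _) continuous_const).inter
        (isClosed_eq (continuous_rep_apply hε hT _ _ _ _) continuous_const))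
  · exact isClosed_le continuous_const (continuous_rep_apply hε hT _ _ _ _)

lemma isClosed_feasible (g₀ g₁ : ℝ → ℝ) : IsClosed (feasible ε M T cbar R g₀ g₁) :=
  Metric.isClosed_closedBall.inter (isClosed_admissible hε hT g₀ g₁)

lemma convex_admissible (g₀ g₁ : ℝ → ℝ) : Convex ℝ (admissible ε M T cbar g₀ g₁) := by
  intro x hx y hy a b ha hb hab
  rw [mem_admissible_iff hε hT] at *
  have hr : ∀ i j s t, rep (a • x + b • y) i j s t = a * rep x i j s t + b * rep y i j s t :=
    fun i j s t => by rw [rep_add hε hT, rep_smul, rep_smul]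
  refine ⟨fun t ht => ?_, fun s hs => ?_⟩
  · obtain ⟨x1, x2, x3⟩ := hx.1 t ht
    obtain ⟨y1, y2, y3⟩ := hy.1 t ht
    rw [hr, hr, hr, x1, x2, x3, y1, y2, y3, ← add_mul, ← add_mul, hab]
    simp
  · rw [hr]
    have h1 := mul_le_mul_of_nonneg_left (hx.2 s hs) ha
    have h2 := mul_le_mul_of_nonneg_left (hy.2 s hs) hb
    have h3 : a * (1 / (2 * cbar ^ (1 / 4 : ℝ))) + b * (1 / (2 * cbar ^ (1 / 4 : ℝ)))
        = 1 / (2 * cbar ^ (1 / 4 : ℝ)) := by rw [← add_mul, hab, one_mul]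
    linarith

lemma convex_feasible (g₀ g₁ : ℝ → ℝ) : Convex ℝ (feasible ε M T cbar R g₀ g₁) :=
  (convex_closedBall _ _).inter (convex_admissible hε hT g₀ g₁)

lemma sub_mem_H0 {g₀ g₁ : ℝ → ℝ} {p q : H5 ε M T} (hp : p ∈ admissible ε M T cbar g₀ g₁)
    (hq : q ∈ admissible ε M T cbar g₀ g₁) : p - q ∈ H0 ε M T := by
  rw [mem_admissible_iff hε hT] at hp hq
  rw [mem_H0_iff hε hT]
  intro t ht
  obtain ⟨x1, x2, x3⟩ := hp.1 t ht
  obtain ⟨y1, y2, y3⟩ := hq.1 t ht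
  rw [rep_sub hε hT, rep_sub hε hT, rep_sub hε hT, x1, x2, x3, y1, y2, y3]
  simp

end Spaces

/-! ### The Fréchet derivative and its Lipschitz continuity -/

section Frechet

variable {ε M T c₀ lam α β : ℝ} (hε : ε < M) (hT : 0 < T)
include hε hT

lemma dJ_add (hc : 0 < c₀) (q h k : H5 ε M T) :
    dJ lam α β c₀ q (h + k) = dJ lam α β c₀ q h + dJ lam α β c₀ q k := by
  have c1 := continuous_Frep hε hT hc q
  have c2 := continuous_Lrep hε hT hc q h
  have c3 := continuous_Lrep hε hT hc q k
  have e : ∫ z in rect ε M T, weight lam α z.1 z.2 *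
        (Frep c₀ q z.1 z.2 * Lrep c₀ q (h + k) z.1 z.2)
      = (∫ z in rect ε M T, weight lam α z.1 z.2 * (Frep c₀ q z.1 z.2 * Lrep c₀ q h z.1 z.2))
        + ∫ z in rect ε M T, weight lam α z.1 z.2 *
          (Frep c₀ q z.1 z.2 * Lrep c₀ q k z.1 z.2) := by
    rw [← integral_add (Continuous.integrableOn_rect (by fun_prop))
      (Continuous.integrableOn_rect (by fun_prop))]
    congr 1; funext z
    simp only [Lrep, Lval, rep_add hε hT]
    ring
  rw [dJ, dJ, dJ, e, inner_add_right]
  ring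

omit hε hT in
lemma dJ_smul (q h : H5 ε M T) (s : ℝ) :
    dJ lam α β c₀ q (s • h) = s * dJ lam α β c₀ q h := by
  have e : ∫ z in rect ε M T, weight lam α z.1 z.2 *
        (Frep c₀ q z.1 z.2 * Lrep c₀ q (s • h) z.1 z.2)
      = s * ∫ z in rect ε M T, weight lam α z.1 z.2 *
          (Frep c₀ q z.1 z.2 * Lrep c₀ q h z.1 z.2) := by
    rw [← integral_const_mul]
    congr 1; funext z
    simp only [Lrep, Lval, rep_smul]
    ring
  have e2 : inner ℝ q (s • h) = s * inner ℝ q h := real_inner_smul_right q h s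
  rw [dJ, dJ, e, e2]
  ring

lemma exists_abs_dJ_le (hc : 0 < c₀) (lam α β : ℝ) (q : H5 ε M T) :
    ∃ C, ∀ h : H5 ε M T, |dJ lam α β c₀ q h| ≤ C * ‖h‖ := by
  obtain ⟨K, hK0, hK⟩ := exists_abs_rep_le hε hT
  set A := 1 + K * ‖q‖ with hA
  set W := 1 + c₀⁻¹ with hW
  have hA1 : 1 ≤ A := le_add_of_nonneg_right (by positivity)
  have hW1 : 1 ≤ W := le_add_of_nonneg_right (by positivity)
  have hb : ∀ i j x t, |rep q i j x t| ≤ A := fun i j x t => by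
    have h1 := hK q i j x t
    linarith
  have hv : ∀ x, |qinv c₀ q x| ≤ W := fun x => (abs_qinv_le hc q x).trans (by linarith)
  set w := ∫ z in rect ε M T, weight lam α z.1 z.2 with hw
  refine ⟨2 * (2 * (A ^ 2 * W ^ 3) * (6 * (A ^ 2 * W ^ 4) * K) * w) + 2 * |β| * ‖q‖, fun h => ?_⟩
  have hI : |∫ z in rect ε M T, weight lam α z.1 z.2 *
      (Frep c₀ q z.1 z.2 * Lrep c₀ q h z.1 z.2)|
      ≤ ∫ z in rect ε M T, 2 * (A ^ 2 * W ^ 3) * (6 * (A ^ 2 * W ^ 4) * (K * ‖h‖))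
        * weight lam α z.1 z.2 := by
    have hi : IntegrableOn (fun z : ℝ × ℝ => 2 * (A ^ 2 * W ^ 3) * (6 * (A ^ 2 * W ^ 4) * (K * ‖h‖))
        * weight lam α z.1 z.2) (rect ε M T) := Continuous.integrableOn_rect (by fun_prop)
    rw [← Real.norm_eq_abs]
    refine norm_integral_le_of_norm_le hi (Filter.Eventually.of_forall fun z => ?_)
    have hwz := (weight_pos lam α z.1 z.2).le
    rw [norm_mul, Real.norm_of_nonneg hwz, mul_comm _ (weight lam α z.1 z.2)]
    refine mul_le_mul_of_nonneg_left ?_ hwz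
    rw [norm_mul]
    exact mul_le_mul (abs_Fval_le hA1 hW1 (hb _ _ _ _) (hb _ _ _ _) (hb _ _ _ _) (hb _ _ _ _) (hv _))
      (abs_Lval_le hA1 hW1 (hb _ _ _ _) (hb _ _ _ _) (hb _ _ _ _) (hv _) (hK _ _ _ _ _)
        (hK _ _ _ _ _) (hK _ _ _ _ _) (hK _ _ _ _ _) (hK _ _ _ _ _)) (norm_nonneg _)
      (by positivity)
  rw [integral_const_mul, ← hw] at hI
  have h2 : |2 * β * inner ℝ q h| ≤ 2 * |β| * (‖q‖ * ‖h‖) := by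
    rw [abs_mul, abs_mul, abs_two]
    gcongr
    exact abs_real_inner_le_norm q h
  refine (abs_add_le _ _).trans ?_
  rw [abs_mul 2, abs_two]
  linarith

lemma exists_inner_eq_dJ (hc : 0 < c₀) (lam α β : ℝ) (q : H5 ε M T) :
    ∃ G ∈ H0 ε M T, ∀ h ∈ H0 ε M T, inner ℝ G h = dJ lam α β c₀ q h := by
  obtain ⟨C, hC⟩ := exists_abs_dJ_le hε hT hc lam α β q
  exact exists_inner_eq_of_isClosed (isClosed_H0 hε hT) (H0sub hε hT).zero_mem
    (fun _ hx _ hy => (H0sub hε hT).add_mem hx hy) (fun c _ hx => (H0sub hε hT).smul_mem c hx)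
    (dJ_add hε hT hc q) (fun c h => dJ_smul q h c) hC

/-- Adding an element of `H₀` need not preserve the trace constraint, but a small one keeps half of
the lower bound. The Taylor estimate is therefore always used at level `c₀ / 2`. -/
lemma TraceGE.add_of_small {K δ : ℝ} (hK0 : 0 ≤ K)
    (hK : ∀ (q : H5 ε M T) (i j : ℕ) (x t : ℝ), |rep q i j x t| ≤ K * ‖q‖) {q h : H5 ε M T}
    (hq : TraceGE c₀ q) (hδ : K * δ ≤ c₀ / 2) (hh : ‖h‖ ≤ δ) : TraceGE (c₀ / 2) (q + h) := by
  intro x hx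
  rw [rep_add hε hT]
  have h1 := (abs_le.1 (hK h 0 0 x 0)).1
  have h2 := hq x hx
  have h3 : K * ‖h‖ ≤ K * δ := by gcongr
  linarith

omit hε hT in
lemma TraceGE.half (hc : 0 < c₀) {q : H5 ε M T} (hq : TraceGE c₀ q) : TraceGE (c₀ / 2) q :=
  fun x hx => by linarith [hq x hx]

omit hε hT in
lemma dJ_half (hc : 0 < c₀) {q : H5 ε M T} (hq : TraceGE c₀ q) (h : H5 ε M T) :
    dJ lam α β (c₀ / 2) q h = dJ lam α β c₀ q h := by
  rw [dJ, dJ]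
  congr 2
  refine setIntegral_congr_fun measurableSet_rect fun z hz => ?_
  have hx := Ioo_subset_Icc_self hz.1
  simp only [Frep, Lrep, qinv_eq hq hx, qinv_eq (hq.half hc) hx]

lemma isFrechetDeriv_of_inner_eq (hc : 0 < c₀) {q G : H5 ε M T} (hq : TraceGE c₀ q)
    (hG : G ∈ H0 ε M T) (h : ∀ h ∈ H0 ε M T, inner ℝ G h = dJ lam α β c₀ q h) :
    IsFrechetDeriv (J lam α β) q G := by
  refine ⟨hG, ?_⟩
  obtain ⟨K, hK0, hK⟩ := exists_abs_rep_le hε hT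
  -- Chosen so that `‖h‖ ≤ δ` implies `|h(x,0)| ≤ c₀/2`.
  set δ := c₀ / (2 * K) with hδ
  have hδ0 : 0 < δ := by positivity
  have hKδ : K * δ ≤ c₀ / 2 := by rw [hδ]; apply le_of_eq; field_simp
  obtain ⟨C, hC0, hC⟩ := exists_taylor_le hε hT (half_pos hc) (‖q‖ + δ) lam α β
  rw [hasFDerivWithinAt_iff_isLittleO]
  have hO : (fun h : H5 ε M T => J lam α β (q + h) - J lam α β (q + 0) - (innerSL ℝ G) (h - 0))
      =O[𝓝[H0 ε M T] 0] fun h : H5 ε M T => ‖h‖ ^ 2 := by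
    refine Asymptotics.IsBigO.of_bound C ?_
    have hball : Metric.ball (0 : H5 ε M T) δ ∈ 𝓝[H0 ε M T] (0 : H5 ε M T) :=
      mem_nhdsWithin_of_mem_nhds (Metric.ball_mem_nhds _ hδ0)
    filter_upwards [hball, self_mem_nhdsWithin] with k hk hk0
    rw [mem_ball_zero_iff] at hk
    have hk' : ‖q + k‖ ≤ ‖q‖ + δ := (norm_add_le _ _).trans (by linarith)
    have := hC q k (by linarith) hk' (hq.half hc) (hq.add_of_small hε hT hK0.le hK hKδ hk.le)
    rw [dJ_half hc hq, ← h k hk0] at this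
    rw [add_zero, sub_zero, innerSL_apply_apply, Real.norm_eq_abs, norm_pow, norm_norm]
    exact this
  refine hO.trans_isLittleO ?_
  simp only [sub_zero]
  have hlim : Filter.Tendsto (fun h : H5 ε M T => ‖h‖) (𝓝[H0 ε M T] 0) (𝓝 0) := by
    have : Filter.Tendsto (fun h : H5 ε M T => ‖h‖) (𝓝 0) (𝓝 0) := by
      simpa using (continuous_norm (E := H5 ε M T)).tendsto 0
    exact this.mono_left nhdsWithin_le_nhds
  have h1 : (fun h : H5 ε M T => ‖h‖) =o[𝓝[H0 ε M T] 0] fun _ : H5 ε M T => (1 : ℝ) :=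
    (Asymptotics.isLittleO_one_iff ℝ).2 hlim
  have h2 := h1.mul_isBigO (Asymptotics.isBigO_refl (fun h : H5 ε M T => ‖h‖) (𝓝[H0 ε M T] 0))
  refine Asymptotics.IsLittleO.of_norm_right ?_
  simpa [pow_two] using h2

lemma IsFrechetDeriv.hasDerivAt {I : H5 ε M T → ℝ} {q G h : H5 ε M T} (hG : IsFrechetDeriv I q G)
    (hh : h ∈ H0 ε M T) : HasDerivAt (fun s : ℝ => I (q + s • h)) (inner ℝ G h) 0 := by
  have h1 : HasDerivWithinAt (fun s : ℝ => s • h) h univ 0 := by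
    have := (hasDerivAt_id (0 : ℝ)).smul_const h
    rw [one_smul] at this
    exact this.hasDerivWithinAt
  have h2 := hG.2
  rw [← zero_smul ℝ h] at h2
  have h3 := HasFDerivWithinAt.comp_hasDerivWithinAt (0 : ℝ) h2 h1
    (fun s _ => (H0sub hε hT).smul_mem s hh)
  rw [hasDerivWithinAt_univ] at h3
  exact h3

/-- Both gradients lie in `H₀`, so their difference is itself an admissible direction in which to
compare them. -/
lemma IsFrechetDeriv.unique {I : H5 ε M T → ℝ} {q G₁ G₂ : H5 ε M T} (h₁ : IsFrechetDeriv I q G₁)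
    (h₂ : IsFrechetDeriv I q G₂) : G₁ = G₂ := by
  have hm : G₁ - G₂ ∈ H0 ε M T := (H0sub hε hT).sub_mem h₁.1 h₂.1
  have e := (h₁.hasDerivAt hε hT hm).unique (h₂.hasDerivAt hε hT hm)
  have : inner ℝ (G₁ - G₂) (G₁ - G₂) = 0 := by rw [inner_sub_left, e, sub_self]
  exact sub_eq_zero.1 (inner_self_eq_zero.1 this)

lemma existsUnique_isFrechetDeriv (hc : 0 < c₀) {q : H5 ε M T} (hq : TraceGE c₀ q) :
    ∃! G : H5 ε M T, IsFrechetDeriv (J lam α β) q G := by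
  obtain ⟨G, hG, h⟩ := exists_inner_eq_dJ hε hT hc lam α β q
  exact ⟨G, isFrechetDeriv_of_inner_eq hε hT hc hq hG h, fun G' hG' =>
    hG'.unique hε hT (isFrechetDeriv_of_inner_eq hε hT hc hq hG h)⟩

lemma IsFrechetDeriv.inner_eq_dJ (hc : 0 < c₀) {q G : H5 ε M T} (hq : TraceGE c₀ q)
    (hG : IsFrechetDeriv (J lam α β) q G) {h : H5 ε M T} (hh : h ∈ H0 ε M T) :
    inner ℝ G h = dJ lam α β c₀ q h := by
  obtain ⟨G', hG', h'⟩ := exists_inner_eq_dJ hε hT hc lam α β q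
  rw [hG.unique hε hT (isFrechetDeriv_of_inner_eq hε hT hc hq hG' h')]
  exact h' h hh

/-- The Fréchet derivative is Lipschitz on bounded sets of functions with common boundary data. -/
lemma exists_lipschitz (hc : 0 < c₀) {R : ℝ} (hR : 0 < R) (lam α β : ℝ) :
    ∃ K > 0, ∀ q₁ q₂ G₁ G₂ : H5 ε M T, ‖q₁‖ ≤ R → ‖q₂‖ ≤ R → TraceGE c₀ q₁ → TraceGE c₀ q₂ →
      q₂ - q₁ ∈ H0 ε M T → IsFrechetDeriv (J lam α β) q₁ G₁ → IsFrechetDeriv (J lam α β) q₂ G₂ →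
      ‖G₂ - G₁‖ ≤ K * ‖q₂ - q₁‖ := by
  obtain ⟨K, hK0, hK⟩ := exists_abs_rep_le hε hT
  set δ := c₀ / (2 * K) with hδ
  have hδ0 : 0 < δ := by positivity
  have hKδ : K * δ ≤ c₀ / 2 := by rw [hδ]; apply le_of_eq; field_simp
  obtain ⟨C, hC0, hC⟩ := exists_taylor_le hε hT (half_pos hc) (R + δ) lam α β
  -- Since `‖q₂ - q₁‖ ≤ 2R`, a direction of norm `θ‖q₂ - q₁‖` is short enough for the Taylor
  -- estimate at level `c₀ / 2`.
  set θ := min 1 (δ / (2 * R)) with hθ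
  have hθ0 : 0 < θ := lt_min one_pos (by positivity)
  have hθ1 : θ ≤ 1 := min_le_left _ _
  have hθR : θ * (2 * R) ≤ δ := by
    have := min_le_right 1 (δ / (2 * R))
    rwa [← hθ, le_div_iff₀ (by positivity)] at this
  refine ⟨6 * C / θ, by positivity, fun q₁ q₂ G₁ G₂ n1 n2 t1 t2 hk hG₁ hG₂ => ?_⟩
  have hg : G₂ - G₁ ∈ H0 ε M T := (H0sub hε hT).sub_mem hG₂.1 hG₁.1
  obtain ⟨k, hkdef⟩ : ∃ k, k = q₂ - q₁ := ⟨_, rfl⟩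
  have hq2 : q₁ + k = q₂ := by rw [hkdef]; abel
  rw [← hkdef] at hk ⊢
  -- Three Taylor expansions, from `q₂` to `q₂ + h`, from `q₁` to `q₂ + h` and from `q₁` to `q₂`,
  -- are combined so that all values of `J` cancel. No second derivative of `J` is needed.
  have key : ∀ h ∈ H0 ε M T, ‖h‖ ≤ δ → inner ℝ (G₂ - G₁) h ≤ 3 * C * (‖k‖ ^ 2 + ‖h‖ ^ 2) := by
    intro h hh hhδ
    have t3 := t2.add_of_small hε hT hK0.le hK hKδ hhδ
    have n3 : ‖q₂ + h‖ ≤ R + δ := (norm_add_le _ _).trans (by linarith)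
    have e1 := hC q₂ h (by linarith) n3 (t2.half hc) t3
    have e2 := hC q₁ (k + h) (by linarith) (by rw [← add_assoc, hq2]; exact n3) (t1.half hc)
      (by rw [← add_assoc, hq2]; exact t3)
    have e3 := hC q₁ k (by linarith) (by rw [hq2]; linarith) (t1.half hc)
      (by rw [hq2]; exact t2.half hc)
    rw [← add_assoc, hq2, dJ_add hε hT (half_pos hc)] at e2
    rw [hq2] at e3
    rw [dJ_half hc t2, ← hG₂.inner_eq_dJ hε hT hc t2 hh] at e1
    rw [dJ_half hc t1, dJ_half hc t1, ← hG₁.inner_eq_dJ hε hT hc t1 hh] at e2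
    rw [dJ_half hc t1] at e3
    have e4 : ‖k + h‖ ^ 2 ≤ 2 * (‖k‖ ^ 2 + ‖h‖ ^ 2) := by
      have h1 : ‖k + h‖ ^ 2 ≤ (‖k‖ + ‖h‖) ^ 2 :=
        pow_le_pow_left₀ (norm_nonneg _) (norm_add_le _ _) 2
      linarith [sq_nonneg (‖k‖ - ‖h‖)]
    have e5 := mul_le_mul_of_nonneg_left e4 hC0.le
    rw [inner_sub_left]
    linarith [(abs_le.1 e1).1, (abs_le.1 e2).2, (abs_le.1 e3).1]
  by_cases hgz : G₂ - G₁ = 0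
  · rw [hgz, norm_zero]; positivity
  have hgn : 0 < ‖G₂ - G₁‖ := norm_pos_iff.2 hgz
  by_cases hkz : k = 0
  · exfalso
    rw [hkz, add_zero] at hq2
    rw [← hq2] at hG₂
    exact hgz (sub_eq_zero.2 (hG₂.unique hε hT hG₁))
  have hkn : 0 < ‖k‖ := norm_pos_iff.2 hkz
  have hk2R : ‖k‖ ≤ 2 * R := by
    rw [hkdef]; exact (norm_sub_le _ _).trans (by linarith)
  set g := G₂ - G₁
  -- The test direction is parallel to `g` with length comparable to `‖k‖`, which balances the two
  -- squares in `key`: the left side is `θ‖k‖‖g‖` and the right side is of order `‖k‖²`.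
  have hnorm : ‖(θ * ‖k‖ / ‖g‖) • g‖ = θ * ‖k‖ := by
    rw [norm_smul, Real.norm_of_nonneg (by positivity)]
    field_simp
  have hfin := key ((θ * ‖k‖ / ‖g‖) • g) ((H0sub hε hT).smul_mem _ hg) (by
    rw [hnorm]
    exact (mul_le_mul_of_nonneg_left hk2R hθ0.le).trans hθR)
  have hinner : inner ℝ g ((θ * ‖k‖ / ‖g‖) • g) = θ * ‖k‖ / ‖g‖ * inner ℝ g g :=
    real_inner_smul_right g g _
  rw [hnorm, hinner, real_inner_self_eq_norm_sq] at hfin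
  have h1 : θ * ‖k‖ / ‖g‖ * ‖g‖ ^ 2 = ‖k‖ * (θ * ‖g‖) := by field_simp
  have h2 : 3 * C * (‖k‖ ^ 2 + (θ * ‖k‖) ^ 2) ≤ ‖k‖ * (6 * C * ‖k‖) := by
    have : θ ^ 2 ≤ 1 := pow_le_one₀ hθ0.le hθ1
    have h3 : θ ^ 2 * ‖k‖ ^ 2 ≤ 1 * ‖k‖ ^ 2 := by gcongr
    have h4 := mul_le_mul_of_nonneg_left h3 hC0.le
    nlinarith
  rw [h1] at hfin
  have h3 : θ * ‖g‖ ≤ 6 * C * ‖k‖ := le_of_mul_le_mul_left (hfin.trans h2) hkn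
  rw [div_mul_eq_mul_div, le_div_iff₀ hθ0]
  linarith

end Frechet

/-! ### Consequences of a strong gradient inequality -/

section StrongConvexity

variable {E : Type*} [NormedAddCommGroup E] [InnerProductSpace ℝ E] {S : Set E} {f : E → ℝ} {κ : ℝ}

/-- The gradient inequalities at the intermediate point are averaged. The linear terms cancel and a
positive quadratic term remains. -/
lemma strictConvexOn_of_gradient_ineq (hS : Convex ℝ S) (hκ : 0 < κ)
    (h : ∀ x ∈ S, ∃ g : E, ∀ y ∈ S, f x + inner ℝ g (y - x) + κ * ‖y - x‖ ^ 2 ≤ f y) :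
    StrictConvexOn ℝ S f := by
  refine ⟨hS, fun x hx y hy hxy a b ha hb hab => ?_⟩
  have hz : a • x + b • y ∈ S := hS hx hy ha.le hb.le hab
  obtain ⟨g, hg⟩ := h _ hz
  set z := a • x + b • y with hzdef
  have h1 := hg x hx
  have h2 := hg y hy
  have hzx : x ≠ z := by
    intro hxz
    apply hxy
    have h3 : b • (x - y) = 0 := by
      have : x - z = b • (x - y) := by
        rw [hzdef, eq_sub_of_add_eq hab, sub_smul, one_smul, smul_sub]; abel
      rw [← this, ← hxz, sub_self]
    exact sub_eq_zero.1 ((smul_eq_zero.1 h3).resolve_left hb.ne')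
  have hpos : 0 < ‖x - z‖ := norm_pos_iff.2 (sub_ne_zero.2 hzx)
  have hsum : a * inner ℝ g (x - z) + b * inner ℝ g (y - z) = 0 := by
    rw [← real_inner_smul_right, ← real_inner_smul_right, ← inner_add_right]
    have : a • (x - z) + b • (y - z) = 0 := by
      rw [smul_sub, smul_sub, sub_add_sub_comm, ← add_smul, hab, one_smul, hzdef, sub_self]
    rw [this, inner_zero_right]
  have h3 := mul_le_mul_of_nonneg_left h1 ha.le
  have h4 := mul_le_mul_of_nonneg_left h2 hb.le
  have h5 : 0 < a * (κ * ‖x - z‖ ^ 2) := by positivity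
  have h6 : 0 ≤ b * (κ * ‖y - z‖ ^ 2) := by positivity
  have h7 : a * f z + b * f z = f z := by rw [← add_mul, hab, one_mul]
  simp only [smul_eq_mul]
  linarith

/-- The inequality at a midpoint bounds `‖x - y‖²` by the excesses of `f x` and `f y` over the
infimum. So minimizing sequences are Cauchy, without weak compactness, and minimizers are unique.
The gradient inequality at the limit replaces lower semicontinuity of `f`. -/
lemma existsUnique_isMinOn_of_gradient_ineq [CompleteSpace E] (hS : Convex ℝ S) (hSc : IsClosed S)
    (hne : S.Nonempty) (hκ : 0 < κ) (hbdd : ∀ x ∈ S, 0 ≤ f x)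
    (h : ∀ x ∈ S, ∃ g : E, ∀ y ∈ S, f x + inner ℝ g (y - x) + κ * ‖y - x‖ ^ 2 ≤ f y) :
    ∃! x, x ∈ S ∧ ∀ y ∈ S, f x ≤ f y := by
  set m := sInf (f '' S) with hm
  have hB : BddBelow (f '' S) := ⟨0, by rintro _ ⟨x, hx, rfl⟩; exact hbdd x hx⟩
  have hml : ∀ x ∈ S, m ≤ f x := fun x hx => csInf_le hB ⟨x, hx, rfl⟩
  have hpar : ∀ x ∈ S, ∀ y ∈ S, κ / 2 * ‖x - y‖ ^ 2 ≤ (f x - m) + (f y - m) := by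
    intro x hx y hy
    have hz : (1 / 2 : ℝ) • x + (1 / 2 : ℝ) • y ∈ S :=
      hS hx hy (by norm_num) (by norm_num) (by norm_num)
    obtain ⟨g, hg⟩ := h _ hz
    set z := (1 / 2 : ℝ) • x + (1 / 2 : ℝ) • y with hzdef
    have e1 : x - z = (1 / 2 : ℝ) • (x - y) := by rw [hzdef]; module
    have e2 : y - z = -((1 / 2 : ℝ) • (x - y)) := by rw [hzdef]; module
    have h1 := hg x hx
    have h2 := hg y hy
    rw [e1] at h1
    rw [e2, inner_neg_right, norm_neg] at h2
    rw [norm_smul, Real.norm_of_nonneg (by norm_num)] at h1 h2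
    have := hml z hz
    linarith
  have hseq : ∀ n : ℕ, ∃ x ∈ S, f x < m + 1 / ((n : ℝ) + 1) := fun n => by
    obtain ⟨_, ⟨x, hx, rfl⟩, hlt⟩ := exists_lt_of_csInf_lt (hne.image f)
      (lt_add_of_pos_right m (Nat.one_div_pos_of_nat (n := n) (α := ℝ)))
    exact ⟨x, hx, hlt⟩
  choose u huS hu using hseq
  have hcau : CauchySeq u := by
    rw [Metric.cauchySeq_iff']
    intro η hη
    obtain ⟨N, hN⟩ := exists_nat_one_div_lt (show 0 < κ * η ^ 2 / 4 by positivity)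
    refine ⟨N, fun n hn => ?_⟩
    have h1 := hpar (u n) (huS n) (u N) (huS N)
    have h2 := hu n
    have h3 := hu N
    have h4 : 1 / ((n : ℝ) + 1) ≤ 1 / ((N : ℝ) + 1) := Nat.one_div_le_one_div hn
    rw [dist_eq_norm]
    have h5 : κ / 2 * ‖u n - u N‖ ^ 2 < κ / 2 * η ^ 2 := by linarith
    have h6 : ‖u n - u N‖ ^ 2 < η ^ 2 := lt_of_mul_lt_mul_left h5 (by positivity)
    exact lt_of_pow_lt_pow_left₀ 2 hη.le h6
  obtain ⟨x, hx⟩ := cauchySeq_tendsto_of_complete hcau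
  have hxS : x ∈ S := hSc.mem_of_tendsto hx (Filter.Eventually.of_forall huS)
  have hxm : f x ≤ m := by
    obtain ⟨g, hg⟩ := h x hxS
    have hle : ∀ n, f x + inner ℝ g (u n - x) ≤ m + 1 / ((n : ℝ) + 1) := fun n => by
      have h1 := hg (u n) (huS n)
      have h2 : 0 ≤ κ * ‖u n - x‖ ^ 2 := by positivity
      linarith [hu n]
    have l1 : Filter.Tendsto (fun n => f x + inner ℝ g (u n - x)) Filter.atTop
        (𝓝 (f x + inner ℝ g (x - x))) :=
      tendsto_const_nhds.add (tendsto_const_nhds.inner (hx.sub tendsto_const_nhds))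
    have l2 : Filter.Tendsto (fun n : ℕ => m + 1 / ((n : ℝ) + 1)) Filter.atTop (𝓝 (m + 0)) :=
      tendsto_const_nhds.add tendsto_one_div_add_atTop_nhds_zero_nat
    have := le_of_tendsto_of_tendsto' l1 l2 hle
    simpa using this
  refine ⟨x, ⟨hxS, fun y hy => hxm.trans (hml y hy)⟩, fun y ⟨hy, hymin⟩ => ?_⟩
  have h1 := hpar y hy x hxS
  have h2 := hymin x hxS
  have h3 : κ / 2 * ‖y - x‖ ^ 2 ≤ 0 := by linarith
  have h4 : ‖y - x‖ ^ 2 ≤ 0 := by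
    by_contra hcon
    have : 0 < κ / 2 * ‖y - x‖ ^ 2 := mul_pos (by positivity) (not_le.1 hcon)
    linarith
  have h5 : ‖y - x‖ = 0 := by
    have := sq_nonneg ‖y - x‖
    exact pow_eq_zero_iff two_ne_zero |>.1 (le_antisymm h4 this)
  exact sub_eq_zero.1 (norm_eq_zero.1 h5)

lemma deriv_nonneg_of_min {φ : ℝ → ℝ} {c : ℝ} (hφ : HasDerivAt φ c 0)
    (h : ∀ s ∈ Icc (0 : ℝ) 1, φ 0 ≤ φ s) : 0 ≤ c := by
  have hlim := (hasDerivWithinAt_iff_tendsto_slope' (s := Ioi (0 : ℝ)) (lt_irrefl (0 : ℝ))).1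
    hφ.hasDerivWithinAt
  refine ge_of_tendsto hlim ?_
  have : Ioo (0 : ℝ) 1 ∈ 𝓝[>] (0 : ℝ) := Ioo_mem_nhdsGT one_pos
  filter_upwards [this] with s hs
  rw [slope_def_field]
  exact div_nonneg (sub_nonneg.2 (h s ⟨hs.1.le, hs.2.le⟩)) (by linarith [hs.1])

end StrongConvexity

/-! ### Translation to the stated form -/

section Final

variable {ε M T cbar R lam α β : ℝ} (hε : ε < M) (hT : 0 < T)
include hε hT

omit hε hT in
lemma J_nonneg (hβ : 0 ≤ β) (q : H5 ε M T) : 0 ≤ J lam α β q :=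
  add_nonneg (integral_nonneg fun z => by positivity) (by positivity)

omit hε hT in
-- The largest value of `1/(2q²(x,0))` allowed by the trace constraint, hence the source of the
-- range of `α`.
lemma inv_trace_bound_sq (hc : 0 < cbar) :
    (1 / (2 * cbar ^ (1 / 4 : ℝ)))⁻¹ ^ 2 / 2 = 2 * √cbar := by
  have h : (cbar ^ (1 / 4 : ℝ)) ^ 2 = √cbar := by
    rw [← Real.rpow_natCast, ← Real.rpow_mul hc.le, Real.sqrt_eq_rpow]
    norm_num
  rw [one_div, inv_inv, mul_pow, h]
  ring

lemma setIntegral_weighted_D_sq_eq (h : H5 ε M T) :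
    (∫ p in rect ε M T, Real.exp (-2 * lam * (p.1 + α * p.2)) *
        (|D h 1 0 p.1 p.2| ^ 2 + |D h 0 1 p.1 p.2| ^ 2 + |D h 0 0 p.1 p.2| ^ 2))
      = (∫ z in rect ε M T, weight lam α z.1 z.2 * rep h 1 0 z.1 z.2 ^ 2)
          + (∫ z in rect ε M T, weight lam α z.1 z.2 * rep h 0 1 z.1 z.2 ^ 2)
          + ∫ z in rect ε M T, weight lam α z.1 z.2 * rep h 0 0 z.1 z.2 ^ 2 := by
  have c1 := continuous_rep hε hT h 1 0
  have c2 := continuous_rep hε hT h 0 1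
  have c3 := continuous_rep hε hT h 0 0
  rw [← integral_add (Continuous.integrableOn_rect (by fun_prop))
      (Continuous.integrableOn_rect (by fun_prop)),
    ← integral_add (Continuous.integrableOn_rect (by fun_prop))
      (Continuous.integrableOn_rect (by fun_prop))]
  refine setIntegral_congr_fun measurableSet_rect fun z hz => ?_
  have hx := Ioo_subset_Icc_self hz.1
  have ht := Ioo_subset_Icc_self hz.2
  simp only [sq_abs]
  rw [D_eq_rep hε hT h (by norm_num) hx ht, D_eq_rep hε hT h (by norm_num) hx ht,
    D_eq_rep hε hT h (by norm_num) hx ht, weight]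
  ring

lemma integral_weighted_D_trace_sq_eq (h : H5 ε M T) :
    (∫ x in ε..M, Real.exp (-2 * lam * x) * (|D h 1 0 x 0| ^ 2 + |D h 0 0 x 0| ^ 2))
      = (∫ x in ε..M, Real.exp (-2 * lam * x) * rep h 1 0 x 0 ^ 2)
          + ∫ x in ε..M, Real.exp (-2 * lam * x) * rep h 0 0 x 0 ^ 2 := by
  have c1 := continuous_rep_trace hε hT h 1 0 0
  have c2 := continuous_rep_trace hε hT h 0 0 0
  rw [← intervalIntegral.integral_add (Continuous.intervalIntegrable (by fun_prop) _ _)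
    (Continuous.intervalIntegrable (by fun_prop) _ _)]
  refine intervalIntegral.integral_congr fun x hx => ?_
  rw [uIcc_of_le hε.le] at hx
  have h0 : (0 : ℝ) ∈ Icc 0 T := ⟨le_rfl, hT.le⟩
  simp only [sq_abs]
  rw [D_eq_rep hε hT h (by norm_num) hx h0, D_eq_rep hε hT h (by norm_num) hx h0]
  ring

end Final

end Convexification

end

open Convexification in
theorem theorem5p1 (ε M T cbar R : ℝ) (hε : 0 < ε) (hε1 : ε < 1) (hM : 1 < M) (hT : 0 < T)
    (hc : 0 < cbar) (hR : 0 < R) :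
    (∀ (g₀ g₁ : ℝ → ℝ) (lam α β : ℝ),
      (∀ q ∈ admissible ε M T cbar g₀ g₁, ∃! G : H5 ε M T, IsFrechetDeriv (J lam α β) q G) ∧
      ∃ K > 0, ∀ q₁ ∈ feasible ε M T cbar R g₀ g₁, ∀ q₂ ∈ feasible ε M T cbar R g₀ g₁,
        ∀ G₁ G₂ : H5 ε M T, IsFrechetDeriv (J lam α β) q₁ G₁ → IsFrechetDeriv (J lam α β) q₂ G₂ →
          ‖G₂ - G₁‖ ≤ K * ‖q₂ - q₁‖) ∧
    (∀ α ∈ Set.Ioo 0 (1 / (2 * √cbar)), ∃ C > 0, ∀ lam₀ ≥ (1 : ℝ), ∃ lam₁ ≥ lam₀,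
      ∀ (g₀ g₁ : ℝ → ℝ), ∀ lam ≥ lam₁, ∀ β ∈ Set.Ico (2 * Real.exp (-lam * α * T)) 1,
        StrictConvexOn ℝ (feasible ε M T cbar R g₀ g₁) (J lam α β) ∧
        (∀ q h : H5 ε M T, q ∈ feasible ε M T cbar R g₀ g₁ →
          q + h ∈ feasible ε M T cbar R g₀ g₁ →
          ∀ G : H5 ε M T, IsFrechetDeriv (J lam α β) q G →
            J lam α β (q + h) - J lam α β q - inner ℝ G h ≥
              C * (∫ p in rect ε M T, Real.exp (-2 * lam * (p.1 + α * p.2)) *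
                  (|D h 1 0 p.1 p.2| ^ 2 + |D h 0 1 p.1 p.2| ^ 2
                    + |D h 0 0 p.1 p.2| ^ 2))
                + C * (∫ x in ε..M, Real.exp (-2 * lam * x) *
                  (|D h 1 0 x 0| ^ 2 + |D h 0 0 x 0| ^ 2))
                + β / 2 * ‖h‖ ^ 2) ∧
        ((feasible ε M T cbar R g₀ g₁).Nonempty →
          (∃! qmin : H5 ε M T, qmin ∈ feasible ε M T cbar R g₀ g₁ ∧
            ∀ q ∈ feasible ε M T cbar R g₀ g₁, J lam α β qmin ≤ J lam α β q) ∧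
          ∀ qmin ∈ feasible ε M T cbar R g₀ g₁, ∀ G : H5 ε M T,
            IsFrechetDeriv (J lam α β) qmin G →
              ((∀ q ∈ feasible ε M T cbar R g₀ g₁, J lam α β qmin ≤ J lam α β q) ↔
                ∀ q ∈ feasible ε M T cbar R g₀ g₁, inner ℝ G (qmin - q) ≤ 0))) := by
  have hεM : ε < M := hε1.trans hM
  have hc₀ : 0 < 1 / (2 * cbar ^ (1 / 4 : ℝ)) := by positivity
  have trace : ∀ {g₀ g₁ : ℝ → ℝ} {q : H5 ε M T}, q ∈ admissible ε M T cbar g₀ g₁ →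
      TraceGE (1 / (2 * cbar ^ (1 / 4 : ℝ))) q := fun hq => ((mem_admissible_iff hεM hT _ _ _).1 hq).2
  -- The convexity constant is `1` whatever `lam₀` is, so the threshold can be enlarged without
  -- affecting it.
  refine ⟨fun g₀ g₁ lam α β => ⟨fun q hq => existsUnique_isFrechetDeriv hεM hT hc₀ (trace hq), ?_⟩,
    fun α hα => ⟨1, one_pos, fun lam₀ hlam₀ => ?_⟩⟩
  · obtain ⟨K, hK0, hK⟩ := exists_lipschitz hεM hT hc₀ hR lam α β
    exact ⟨K, hK0, fun q₁ h₁ q₂ h₂ G₁ G₂ hG₁ hG₂ => hK q₁ q₂ G₁ G₂ (mem_closedBall_zero_iff.1 h₁.1)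
      (mem_closedBall_zero_iff.1 h₂.1) (trace h₁.2) (trace h₂.2) (sub_mem_H0 hεM hT h₂.2 h₁.2)
      hG₁ hG₂⟩
  · have hαc : α * ((1 / (2 * cbar ^ (1 / 4 : ℝ)))⁻¹ ^ 2 / 2) < 1 := by
      rw [inv_trace_bound_sq hc]
      exact (lt_div_iff₀ (by positivity)).1 hα.2
    obtain ⟨lam₁, -, key⟩ := exists_convexity_inequality hεM hT hε.le hα.1 hc₀ hαc R
    refine ⟨max lam₀ lam₁, le_max_left _ _, fun g₀ g₁ lam hlam β hβ => ?_⟩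
    have hβ0 : 0 < β := lt_of_lt_of_le (by positivity) hβ.1
    have main : ∀ q h : H5 ε M T, q ∈ feasible ε M T cbar R g₀ g₁ →
        q + h ∈ feasible ε M T cbar R g₀ g₁ → ∀ G : H5 ε M T, IsFrechetDeriv (J lam α β) q G →
          J lam α β (q + h) - J lam α β q - inner ℝ G h ≥
            1 * (∫ p in rect ε M T, Real.exp (-2 * lam * (p.1 + α * p.2)) *
                (|D h 1 0 p.1 p.2| ^ 2 + |D h 0 1 p.1 p.2| ^ 2 + |D h 0 0 p.1 p.2| ^ 2))
              + 1 * (∫ x in ε..M, Real.exp (-2 * lam * x) *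
                (|D h 1 0 x 0| ^ 2 + |D h 0 0 x 0| ^ 2)) + β / 2 * ‖h‖ ^ 2 := by
      intro q h hq hqh G hG
      have hh : h ∈ H0 ε M T := by
        have := sub_mem_H0 hεM hT hqh.2 hq.2
        rwa [add_sub_cancel_left] at this
      have hh' := (mem_H0_iff hεM hT h).1 hh
      rw [hG.inner_eq_dJ hεM hT hc₀ (trace hq.2) hh, setIntegral_weighted_D_sq_eq hεM hT,
        integral_weighted_D_trace_sq_eq hεM hT, one_mul, one_mul]
      exact key lam ((le_max_right _ _).trans hlam) β hβ.1 q h (mem_closedBall_zero_iff.1 hq.1)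
        (mem_closedBall_zero_iff.1 hqh.1) (trace hq.2) (trace hqh.2)
        (fun t ht => (hh' t ht).1) (fun t ht => (hh' t ht).2.1)
    have grad : ∀ x ∈ feasible ε M T cbar R g₀ g₁, ∀ G : H5 ε M T, IsFrechetDeriv (J lam α β) x G →
        ∀ y ∈ feasible ε M T cbar R g₀ g₁,
          J lam α β x + inner ℝ G (y - x) + β / 2 * ‖y - x‖ ^ 2 ≤ J lam α β y := by
      intro x hx G hG y hy
      have h1 := main x (y - x) hx (by rwa [add_sub_cancel]) G hG
      rw [add_sub_cancel] at h1
      have h2 : 0 ≤ ∫ p in rect ε M T, Real.exp (-2 * lam * (p.1 + α * p.2)) *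
          (|D (y - x) 1 0 p.1 p.2| ^ 2 + |D (y - x) 0 1 p.1 p.2| ^ 2
            + |D (y - x) 0 0 p.1 p.2| ^ 2) :=
        MeasureTheory.integral_nonneg fun z => by positivity
      have h3 : 0 ≤ ∫ s in ε..M, Real.exp (-2 * lam * s) *
          (|D (y - x) 1 0 s 0| ^ 2 + |D (y - x) 0 0 s 0| ^ 2) :=
        intervalIntegral.integral_nonneg hεM.le fun s _ => by positivity
      linarith
    have grad' : ∀ x ∈ feasible ε M T cbar R g₀ g₁, ∃ G : H5 ε M T,
        ∀ y ∈ feasible ε M T cbar R g₀ g₁,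
          J lam α β x + inner ℝ G (y - x) + β / 2 * ‖y - x‖ ^ 2 ≤ J lam α β y := fun x hx => by
      obtain ⟨G, hG, -⟩ := existsUnique_isFrechetDeriv hεM hT hc₀ (trace hx.2) (lam := lam)
        (α := α) (β := β)
      exact ⟨G, grad x hx G hG⟩
    have hconv := convex_feasible (cbar := cbar) (R := R) hεM hT g₀ g₁
    refine ⟨strictConvexOn_of_gradient_ineq hconv (half_pos hβ0) grad', main, fun hne =>
      ⟨existsUnique_isMinOn_of_gradient_ineq hconv (isClosed_feasible hεM hT g₀ g₁) hne
        (half_pos hβ0) (fun q _ => J_nonneg hβ0.le q) grad', fun qmin hqmin G hG =>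
      ⟨fun hmin q hq => ?_, fun hvi q hq => ?_⟩⟩⟩
    -- The segment from `qmin` to `q` stays in the feasible set, so the directional derivative at
    -- its initial point is nonnegative.
    · have hd := hG.hasDerivAt hεM hT (sub_mem_H0 hεM hT hq.2 hqmin.2)
      have h0 : 0 ≤ inner ℝ G (q - qmin) := by
        refine deriv_nonneg_of_min hd fun s hs => ?_
        rw [zero_smul, add_zero]
        exact hmin _ (hconv.add_smul_sub_mem hqmin hq hs)
      rw [← neg_sub q qmin, inner_neg_right]
      linarith
    · have h1 := grad qmin hqmin G hG q hq
      have h2 := hvi q hq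
      rw [← neg_sub q qmin, inner_neg_right] at h2
      have h3 : 0 ≤ β / 2 * ‖q - qmin‖ ^ 2 := by positivity
      linarith
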